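/- **Theorem (Exponential volume).** Let $d\ge 0$ be an integer. *Graphical construction.* To the sites $x\in\mathbb Z^d$ attach i.i.d. Poisson processes of rate one with arrival times $\tau(x,i)$, $i\ge1$, and i.i.d. random variables $U(x,i)$, uniform on $[0,1]$ and independent of the Poisson processes. For a finite set $\Lambda\subset\mathbb Z^d$ and numbers $0<c(0)\le c(1)\le\dots\le c(2d)$, the growth model $(\sigma_{\Lambda;t})_{t\ge0}$ with values in $\{0,1\}^\Lambda$ starts from the empty configuration $\sigma_{\Lambda;0}\equiv0$. At each arrival time $t=\tau(x,i)$ of a site $x\in\Lambda$, a vacant site $x$ becomes occupied (value $1$) if and only if $U(x,i)\le c(N)$, where $N$ is the number of neighbours $y\in\Lambda$ of $x$ (i.e. $|x-y|=1$) which are occupied just before time $t$. Occupied sites remain occupied forever. *Rates.* The rates $0<c_\beta(0)\le\dots\le c_\beta(2d)$ depend on a parameter $\beta>0$, and there are real numbers $\Gamma_0\le\Gamma_1\le\dots\le\Gamma_d$ such that $$\lim_{\beta\to\infty}\frac1\beta\ln c_\beta(n)=-\Gamma_{d-n}\quad(0\le n\le d),\qquad \lim_{\beta\to\infty}\frac1\beta\ln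 c_\beta(n)=0\quad(d\le n\le 2d).$$ Set $\kappa_0=\Gamma_0$ and $\kappa_i=\max\Big(\Gamma_{i-1},\dfrac{\Gamma_i+i\,\kappa_{i-1}}{i+1}\Big)$ for $1\le i\le d$. *Claim.* Let $L>0$ and let $\Lambda_\beta=[-\tfrac12 e^{\beta L},\tfrac12 e^{\beta L}]^d\cap\mathbb Z^d$ be the cubic box of sidelength $\exp(\beta L)$ centred at the origin. Let $\kappa>0$ and $\tau_\beta=\exp(\beta\kappa)$, and let $\sigma_{\Lambda_\beta;t}$ be the growth model in $\Lambda_\beta$ with rates $c_\beta$. * If $\kappa<\max(\Gamma_d-dL,\kappa_d)$, then $p_\beta=\mathbb P\big(\sigma_{\Lambda_\beta;\tau_\beta}(0)=1\big)$ satisfies $\lim_{\beta\to\infty}p_\beta=0$ and is exponentially small in $\beta$: $\limsup_{\beta\to\infty}\frac1\beta\ln p_\beta<0$. * If $\kappa>\max(\Gamma_d-dL,\kappa_d)$, then $q_\beta=\mathbb P\big(\exists x\in\Lambda_\beta:\ \sigma_{\Lambda_\beta;\tau_\beta}(x)=0\big)$ satisfies $\lim_{\beta\to\infty}q_\beta=0$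 and is super-exponentially small in $\beta$: $\lim_{\beta\to\infty}\frac1\beta\ln q_\beta=-\infty$. (Here $\ln 0=-\infty$.) -/

import Mathlib

open MeasureTheory ProbabilityTheory Filter Topology
open scoped ENNReal

/-- The sites of the lattice `ℤ^d`. -/
abbrev Site (d : ℕ) : Type := Fin d → ℤ

/-- Two sites are neighbours when they are at distance one (for points of `ℤ^d` the Euclidean
and the `ℓ¹` distance equal one simultaneously). -/
def Neighbours {d : ℕ} (x y : Site d) : Prop := ∑ i, |x i - y i| = 1

/-- The cubic box `[-ℓ/2, ℓ/2]^d ∩ ℤ^d` of sidelength `ℓ`, centred at the origin. -/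
noncomputable def cubicBox (d : ℕ) (ℓ : ℝ) : Finset (Site d) :=
  Fintype.piFinset fun _ => Finset.Icc ⌈-(ℓ / 2)⌉ ⌊ℓ / 2⌋

/-- A configuration in a finite volume is encoded by the finite set `η` of its occupied sites;
this is the number `N(x, η)` of occupied neighbours of the site `x`. -/
noncomputable def occupiedNeighbours {d : ℕ} (x : Site d) (η : Finset (Site d)) : ℕ := by
  classical exact (η.filter fun y => Neighbours x y).card

/-- The arrival time `τ(x, i)`, `i ≥ 1`, of a point process attached to the site `x` with
successive waiting times `w x 0, w x 1, …`. -/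
def arrivalTime {d : ℕ} (w : Site d → ℕ → ℝ) (x : Site d) (i : ℕ) : ℝ :=
  ∑ j ∈ Finset.range i, w x j

/-- The set of the arrival times up to time `t` attached to the sites of the volume `Λ`. -/
def arrivalTimesUpTo {d : ℕ} (Λ : Finset (Site d)) (w : Site d → ℕ → ℝ) (t : ℝ) : Set ℝ :=
  {s | s ≤ t ∧ ∃ x ∈ Λ, ∃ i, 1 ≤ i ∧ arrivalTime w x i = s}

/-- The updating rule at the time `s`: a site `x` of `Λ` for which `s = τ(x, i)` for some `i ≥ 1`
becomes occupied if `U(x, i) ≤ c (N(x, η))`, where `η` is the configuration just before `s`.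
Occupied sites remain occupied. -/
noncomputable def updateAt {d : ℕ} (Λ : Finset (Site d)) (c : ℕ → ℝ) (w u : Site d → ℕ → ℝ)
    (η : Finset (Site d)) (s : ℝ) : Finset (Site d) := by
  classical exact
    η ∪ Λ.filter fun x => ∃ i, 1 ≤ i ∧ arrivalTime w x i = s ∧ u x i ≤ c (occupiedNeighbours x η)

/-- The set of the occupied sites at time `t` of the growth model in the finite volume `Λ` with
rates `c`, started from the empty configuration, for given waiting times `w` and marks `u`: the
updating rule is applied at the successive arrival times `s ≤ t`, in increasing order. (There are
almost surely finitely many of them; the other case is given the value `∅`.) -/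
noncomputable def occupiedSites {d : ℕ} (Λ : Finset (Site d)) (c : ℕ → ℝ)
    (w u : Site d → ℕ → ℝ) (t : ℝ) : Finset (Site d) := by
  classical exact
    if h : (arrivalTimesUpTo Λ w t).Finite then
      (h.toFinset.sort (· ≤ ·)).foldl (updateAt Λ c w u) ∅
    else ∅

/-- The random objects of the graphical construction: i.i.d. Poisson processes of rate one
attached to the sites of `ℤ^d`, given by i.i.d. exponential waiting times `W x j` of parameter
one, and i.i.d. marks `U x i`, uniform on `[0, 1]`, independent of the Poisson processes. -/
structure IsGraphicalFamily {Ω : Type*} [MeasurableSpace Ω] (P : Measure Ω) {d : ℕ}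
    (W U : Site d → ℕ → Ω → ℝ) : Prop where
  waiting_law : ∀ x j, HasLaw (W x j) (expMeasure 1) P
  mark_law : ∀ x i, HasLaw (U x i) (volume.restrict (Set.Icc (0 : ℝ) 1)) P
  indep : iIndepFun
    (Sum.elim (fun p : Site d × ℕ => W p.1 p.2) (fun p : Site d × ℕ => U p.1 p.2)) P

/-- The set of the occupied sites at time `t` of the random growth model in `Λ`. -/
noncomputable def sigma {Ω : Type*} {d : ℕ} (W U : Site d → ℕ → Ω → ℝ) (Λ : Finset (Site d))
    (c : ℕ → ℝ) (t : ℝ) (ω : Ω) : Finset (Site d) :=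
  occupiedSites Λ c (fun x j => W x j ω) (fun x i => U x i ω) t

/-- The hypothesis on the rates `c β n`, `0 ≤ n ≤ 2d`, with activation energies
`Γ 0 ≤ ⋯ ≤ Γ d`. -/
structure RateHypothesis (d : ℕ) (c : ℝ → ℕ → ℝ) (Γ : ℕ → ℝ) : Prop where
  pos : ∀ β, 0 < β → ∀ n, n ≤ 2 * d → 0 < c β n
  mono : ∀ β, 0 < β → ∀ m n, m ≤ n → n ≤ 2 * d → c β m ≤ c β n
  lim_low : ∀ n, n ≤ d → Tendsto (fun β => 1 / β * Real.log (c β n)) atTop (𝓝 (-Γ (d - n)))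
  lim_high : ∀ n, d ≤ n → n ≤ 2 * d → Tendsto (fun β => 1 / β * Real.log (c β n)) atTop (𝓝 0)
  energy_mono : ∀ m n, m ≤ n → n ≤ d → Γ m ≤ Γ n

/-- The critical constants: `κ_0 = Γ_0` and `κ_i = max (Γ_{i-1}) ((Γ_i + i κ_{i-1}) / (i + 1))`
for `i ≥ 1`. -/
noncomputable def criticalConstant (Γ : ℕ → ℝ) : ℕ → ℝ
  | 0 => Γ 0
  | i + 1 => max (Γ i) ((Γ (i + 1) + ((i + 1 : ℕ) : ℝ) * criticalConstant Γ i) / ((i + 1 : ℕ) + 1))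

/-- `p β` is exponentially small in `β`: `limsup (1/β) ln (p β) < 0`, where `ln 0 = -∞`. -/
def ExponentiallySmall (p : ℝ → ℝ≥0∞) : Prop :=
  limsup (fun β : ℝ => ENNReal.log (p β) / (β : EReal)) atTop < 0

/-- `p β` is super-exponentially small in `β`: `lim (1/β) ln (p β) = -∞`, where `ln 0 = -∞`. -/
def SuperExponentiallySmall (p : ℝ → ℝ≥0∞) : Prop :=
  Tendsto (fun β : ℝ => ENNReal.log (p β) / (β : EReal)) atTop (𝓝 ⊥)

/-! The growth is driven by nucleation and spreading. A site with `d - n` occupied neighbours acts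
as a nucleation site for growth in the `n` remaining directions, at a rate of about `exp (-β Γ_n)`,
and a droplet in `n` directions spreads by filling its faces, which are growth problems in `n - 1`
directions. Both regimes are therefore proved by induction on the number of free directions, and the
recursion for `κ_n` balances the time to nucleate in a box of critical size against the time to
cross it.

Slow regime. If `κ < Γ_d - dL`, a first moment bound excludes any nucleation in the volume. If `κ <
κ_d`, the induction `smallClustersLikely` controls connected sets of sites that fill up in a time
window of length `exp (β κ)` next to occupied half-spaces in the directions of `A`, with `n = d -
|A|`. Such clusters stay bounded across the walls and of size at most `exp (β l)` along them, where
`n l + κ < Γ_n`. Three arguments carry this. Occupying one site at a time at most doubles the size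
of a cluster, so only clusters of intermediate size need to be excluded (`spread_of_intermediate`).
Adjacent layers force rare marks (`IsHistory.extent_le`). Finally, a long cluster has a slab without
nucleation, filled only from its two sides. Adding a wall reduces its filling to the case `n - 1`,
in which the growth advances a bounded distance per window of length `exp (β κ')`, `κ' < κ_{n-1}`
(`IsHistory.advance_le`, `IsHistory.free_slab_lt`). The slab is too wide to be crossed in time
because `l > κ - κ'`. For `n = d`, the cluster of the origin must contain a nucleation in a box
where none is likely.

Fast regime. `boxesFill` shows that an `i`-dimensional box of sides at least `m`, supported in the
other directions, fills in time about `exp (β Γ_i) / m ^ i + exp (β κ_i)`. A cube of at most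
critical size nucleates, and the nucleus then grows face by face; face sizes increase with the
radius, so the filling times add up to the scale `exp (β κ_i)` up to a factor linear in `β`. `Fills`
is a statement about the marks inside the box, valid for every growing set, so no conditioning on
the past is needed and union bounds suffice.

All probabilities reduce to two estimates for independent marked Poisson processes: a window
contains a mark of rank `r` with probability at most `r (b - a)`, and contains none with probability
at most `exp (-r (b - a))` when `r ≤ 1`. -/

/-! ### A marked Poisson process on a half-line -/

/-- The real-valued probability that a marked Poisson process has no point of mark at most `r`
in the window `(a, b]`. -/
noncomputable def voidProb (r a b : ℝ) : ℝ := Real.exp (-(r * (max b 0 - max a 0)))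

lemma lintegral_expMeasure_one (g : ℝ → ℝ≥0∞) (hg : Measurable g) :
    ∫⁻ w, g w ∂(expMeasure 1) = ∫⁻ w in Set.Ioi 0, ENNReal.ofReal (Real.exp (-w)) * g w := by
  have h : expMeasure 1 = volume.withDensity (exponentialPDF 1) := rfl
  have hm : Measurable (exponentialPDF 1) := (measurable_exponentialPDFReal 1).ennreal_ofReal
  rw [h, lintegral_withDensity_eq_lintegral_mul _ hm hg, ← setLIntegral_univ,
    ← Set.Iio_union_Ici (a := (0 : ℝ)), lintegral_union measurableSet_Ici
      (Set.disjoint_left.2 fun x hx hy => not_lt.2 (Set.mem_Ici.1 hy) (Set.mem_Iio.1 hx)), setLIntegral_congr_fun measurableSet_Iio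
      (g := fun _ => 0) (fun w hw => by simp [exponentialPDF_of_neg hw]), lintegral_zero, zero_add,
    setLIntegral_congr (Ioi_ae_eq_Ici (a := (0:ℝ))).symm]
  refine setLIntegral_congr_fun measurableSet_Ioi fun w hw => ?_
  simp [exponentialPDF_of_nonneg (le_of_lt hw)]

lemma setLIntegral_ofReal_Ioc {F f : ℝ → ℝ} {a b : ℝ} (hab : a ≤ b) (hf : Continuous f)
    (h0 : ∀ x, 0 ≤ f x) (hF : ∀ x, HasDerivAt F (f x) x) :
    ∫⁻ w in Set.Ioc a b, ENNReal.ofReal (f w) = ENNReal.ofReal (F b - F a) := by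
  rw [← ofReal_integral_eq_lintegral_ofReal, ← intervalIntegral.integral_of_le hab,
    intervalIntegral.integral_eq_sub_of_hasDerivAt (fun x _ => hF x)
      (hf.intervalIntegrable _ _)]
  · exact (hf.integrableOn_Icc).mono_set Set.Ioc_subset_Icc_self
  · exact Eventually.of_forall h0

/-- Renewal equation: after a first waiting time `w` the process starts afresh, seen through the
window shifted by `w`, and a first point inside the window is harmless with probability `1 - r`. -/
lemma lintegral_voidProb {r a b : ℝ} (hr1 : r ≤ 1) (hab : a ≤ b) :
    ∫⁻ w, ENNReal.ofReal ((1 - Set.indicator (Set.Ioc a b) (fun _ => r) w) *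
      voidProb r (a - w) (b - w)) ∂(expMeasure 1) = ENNReal.ofReal (voidProb r a b) := by
  have hexp := isProbabilityMeasure_expMeasure one_pos
  have hmeas : Measurable fun w => ENNReal.ofReal ((1 - Set.indicator (Set.Ioc a b)
      (fun _ => r) w) * voidProb r (a - w) (b - w)) := by
    refine Measurable.ennreal_ofReal (Measurable.mul ?_ ?_)
    · exact measurable_const.sub (measurable_const.indicator measurableSet_Ioc)
    · unfold voidProb; fun_prop
  rw [lintegral_expMeasure_one _ hmeas]
  set a' := max a 0 with ha'
  set b' := max b 0 with hb'
  have h0a : 0 ≤ a' := le_max_right _ _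
  have hab' : a' ≤ b' := max_le_max_right _ hab
  -- The first point falls before, inside or after the part of the window on the positive half-line.
  have hsplit : Set.Ioi (0 : ℝ) = Set.Ioc 0 a' ∪ (Set.Ioc a' b' ∪ Set.Ioi b') := by
    rw [Set.Ioc_union_Ioi_eq_Ioi hab', Set.Ioc_union_Ioi_eq_Ioi h0a]
  rw [hsplit, lintegral_union (measurableSet_Ioc.union measurableSet_Ioi)
    (by rw [Set.Ioc_union_Ioi_eq_Ioi hab']
        exact Set.disjoint_left.2 fun x hx hy => not_lt.2 hx.2 hy),
    lintegral_union measurableSet_Ioi (Set.disjoint_left.2 fun x hx hy => not_lt.2 hx.2 hy)]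
  have h1 : ∫⁻ w in Set.Ioc 0 a', ENNReal.ofReal (Real.exp (-w)) *
      ENNReal.ofReal ((1 - Set.indicator (Set.Ioc a b) (fun _ => r) w) *
        voidProb r (a - w) (b - w)) =
      ENNReal.ofReal (Real.exp (-(r * (b' - a'))) - Real.exp (-a') * Real.exp (-(r * (b' - a')))) := by
    rw [setLIntegral_congr_fun measurableSet_Ioc
      (g := fun w => ENNReal.ofReal (Real.exp (-w) * Real.exp (-(r * (b' - a')))))]
    · rw [setLIntegral_ofReal_Ioc (F := fun w => - (Real.exp (-w) * Real.exp (-(r * (b' - a')))))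
        h0a (by fun_prop) (fun x => by positivity)]
      · congr 1; simp; ring
      · intro x
        have := (((hasDerivAt_id x).neg.exp).mul_const (Real.exp (-(r * (b' - a'))))).neg
        exact this.congr_deriv (by simp)
    · intro w hw
      have hwa : w ≤ a := by
        rcases le_total a 0 with h | h
        · rw [ha', max_eq_right h] at hw; exact absurd hw.1 (not_lt.2 hw.2)
        · rw [ha', max_eq_left h] at hw; exact hw.2
      have : w ∉ Set.Ioc a b := fun h => not_lt.2 hwa h.1
      simp only [Set.indicator_of_notMem this, sub_zero, one_mul]
      rw [← ENNReal.ofReal_mul (Real.exp_pos _).le]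
      congr 2
      have hb0 : 0 < b := hw.1.trans_le (hwa.trans hab)
      rw [voidProb, max_eq_left (by linarith), max_eq_left (by linarith), ha', hb',
        max_eq_left hb0.le, max_eq_left (hw.1.trans_le hwa).le]
      congr 2; ring
  have h2 : ∫⁻ w in Set.Ioc a' b', ENNReal.ofReal (Real.exp (-w)) *
      ENNReal.ofReal ((1 - Set.indicator (Set.Ioc a b) (fun _ => r) w) *
        voidProb r (a - w) (b - w)) =
      ENNReal.ofReal (Real.exp (-a') * Real.exp (-(r * (b' - a'))) - Real.exp (-b')) := by
    rw [setLIntegral_congr_fun measurableSet_Ioc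
      (g := fun w => ENNReal.ofReal ((1 - r) * Real.exp (-(r * (b' - w)) - w)))]
    · rw [setLIntegral_ofReal_Ioc (F := fun w => - Real.exp (-(r * (b' - w)) - w))
        hab' (by fun_prop) (fun x => by have := sub_nonneg.2 hr1; positivity)]
      · congr 1; rw [← Real.exp_add]; simp; ring_nf
      · intro x
        have h := (((((hasDerivAt_id x).const_sub b').const_mul r).neg).sub (hasDerivAt_id x)).exp.neg
        exact h.congr_deriv (by simp; ring)
    · intro w hw
      have hb0 : b' = b := by
        rw [hb', max_eq_left]
        by_contra hb
        rw [hb', max_eq_right (not_le.1 hb).le] at hw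
        exact absurd (h0a.trans_lt hw.1) (not_lt.2 hw.2)
      have hwa : a < w := (le_max_left _ _).trans_lt hw.1
      have hwb : w ≤ b := hb0 ▸ hw.2
      simp only [Set.indicator_of_mem (show w ∈ Set.Ioc a b from ⟨hwa, hwb⟩)]
      rw [← ENNReal.ofReal_mul (Real.exp_pos _).le]
      congr 1
      rw [voidProb, max_eq_left (by linarith), max_eq_right (by linarith), hb0, mul_left_comm,
        ← Real.exp_add]
      ring_nf
  have h3 : ∫⁻ w in Set.Ioi b', ENNReal.ofReal (Real.exp (-w)) *
      ENNReal.ofReal ((1 - Set.indicator (Set.Ioc a b) (fun _ => r) w) *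
        voidProb r (a - w) (b - w)) = ENNReal.ofReal (Real.exp (-b')) := by
    rw [setLIntegral_congr_fun measurableSet_Ioi (g := fun w => ENNReal.ofReal (Real.exp (-w)))]
    · rw [← ofReal_integral_eq_lintegral_ofReal (integrableOn_exp_neg_Ioi b')
        (Eventually.of_forall fun x => (Real.exp_pos _).le), integral_exp_neg_Ioi]
    · intro w hw
      have hbw : b < w := (le_max_left _ _).trans_lt hw
      have : w ∉ Set.Ioc a b := fun h => not_lt.2 h.2 hbw
      simp only [Set.indicator_of_notMem this]
      rw [voidProb, max_eq_right (by linarith), max_eq_right (by linarith)]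
      simp
  rw [h1, h2, h3]
  have e1 : Real.exp (-a') * Real.exp (-(r * (b' - a'))) ≤ Real.exp (-(r * (b' - a'))) :=
    mul_le_of_le_one_left (Real.exp_pos _).le (by simpa using h0a)
  have e2 : Real.exp (-b') ≤ Real.exp (-a') * Real.exp (-(r * (b' - a'))) := by
    rw [← Real.exp_add, Real.exp_le_exp]; nlinarith
  rw [← ENNReal.ofReal_add (by linarith) (Real.exp_pos _).le,
    ← ENNReal.ofReal_add (by linarith) (by linarith [Real.exp_pos (-b')])]
  congr 1
  simp [voidProb, ← ha', ← hb']

/-- The waiting times `W` and the marks `U` of a Poisson process of rate one on the half-line with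
independent uniform marks. -/
structure IsMarkedPoisson {Ω : Type*} [MeasurableSpace Ω] (P : Measure Ω)
    (W U : ℕ → Ω → ℝ) : Prop where
  measurable_waiting : ∀ j, Measurable (W j)
  measurable_mark : ∀ j, Measurable (U j)
  waiting_law : ∀ j, P.map (W j) = expMeasure 1
  mark_law : ∀ j, P.map (U j) = volume.restrict (Set.Icc (0 : ℝ) 1)
  indep : iIndepFun (Sum.elim W U) P

/-- None of the first `n` points lies in the window `(a, b]` and has a mark at most `r`. -/
def NoMark (n : ℕ) (r a b : ℝ) (w u : ℕ → ℝ) : Prop :=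
  ∀ i < n, ∑ j ∈ Finset.range (i + 1), w j ∈ Set.Ioc a b → r < u i

lemma noMark_succ (n : ℕ) (r a b : ℝ) (w u : ℕ → ℝ) :
    NoMark (n + 1) r a b w u ↔ (w 0 ∈ Set.Ioc a b → r < u 0) ∧
      NoMark n r (a - w 0) (b - w 0) (fun k => w (k + 1)) (fun k => u (k + 1)) := by
  unfold NoMark
  constructor
  · refine fun h => ⟨fun h0 => h 0 (by omega) (by simpa using h0), fun i hi hS => ?_⟩
    refine h (i + 1) (by omega) ?_
    rw [Finset.sum_range_succ']
    constructor <;> linarith [hS.1, hS.2]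
  · rintro ⟨h0, h⟩ i hi hS
    rcases i with _ | i
    · exact h0 (by simpa using hS)
    · refine h i (by omega) ?_
      rw [Finset.sum_range_succ'] at hS
      constructor <;> linarith [hS.1, hS.2]

lemma measurableSet_noMark {α : Type*} [MeasurableSpace α] (n : ℕ) (r : ℝ) {a b : α → ℝ}
    {w u : α → ℕ → ℝ} (ha : Measurable a) (hb : Measurable b) (hw : Measurable w)
    (hu : Measurable u) : MeasurableSet {z | NoMark n r (a z) (b z) (w z) (u z)} := by
  unfold NoMark
  simp only [Set.ofPred_forall]
  refine MeasurableSet.iInter fun i => MeasurableSet.iInter fun _ => ?_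
  refine MeasurableSet.imp ?_ (measurableSet_lt (by fun_prop) (by fun_prop))
  exact (measurableSet_lt ha (by fun_prop)).inter (measurableSet_le (by fun_prop) hb)

namespace IsMarkedPoisson

variable {Ω : Type*} [MeasurableSpace Ω] {P : Measure Ω} [IsProbabilityMeasure P]
  {W U : ℕ → Ω → ℝ}

omit [IsProbabilityMeasure P] in
lemma measurable_elim (h : IsMarkedPoisson P W U) (i : ℕ ⊕ ℕ) : Measurable (Sum.elim W U i) := by
  cases i
  · exact h.measurable_waiting _
  · exact h.measurable_mark _

omit [IsProbabilityMeasure P] in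
lemma shift (h : IsMarkedPoisson P W U) :
    IsMarkedPoisson P (fun k => W (k + 1)) (fun k => U (k + 1)) where
  measurable_waiting j := h.measurable_waiting _
  measurable_mark j := h.measurable_mark _
  waiting_law j := h.waiting_law _
  mark_law j := h.mark_law _
  indep := by
    have := h.indep.precomp (g := Sum.map (· + 1) (· + 1))
      (Sum.map_injective.2 ⟨add_left_injective 1, add_left_injective 1⟩)
    convert this using 1
    ext i ω
    cases i <;> rfl

/-- Disjoint blocks of an independent family are independent. This product structure permits
conditioning on the first point, hence the inductions on the number of points below. -/
lemma map_first_rest (h : IsMarkedPoisson P W U) :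
    P.map (fun ω => ((W 0 ω, U 0 ω), ((fun k => W (k + 1) ω), (fun k => U (k + 1) ω)))) =
      ((expMeasure 1).prod (volume.restrict (Set.Icc (0 : ℝ) 1))).prod
        (P.map fun ω => ((fun k => W (k + 1) ω), (fun k => U (k + 1) ω))) := by
  have hW := h.measurable_waiting
  have hU := h.measurable_mark
  have h1 : IndepFun (W 0) (U 0) P :=
    h.indep.indepFun (i := Sum.inl 0) (j := Sum.inr 0) (by simp)
  have h2 : P.map (fun ω => (W 0 ω, U 0 ω)) =
      (expMeasure 1).prod (volume.restrict (Set.Icc (0 : ℝ) 1)) := by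
    rw [(indepFun_iff_map_prod_eq_prod_map_map (hW 0).aemeasurable (hU 0).aemeasurable).1 h1,
      h.waiting_law, h.mark_law]
  rw [← h2]
  refine (indepFun_iff_map_prod_eq_prod_map_map (by fun_prop) (by fun_prop)).1 ?_
  set m : ℕ ⊕ ℕ → MeasurableSpace Ω := fun i => MeasurableSpace.comap (Sum.elim W U i) inferInstance
  have hm : ∀ i, Measurable[m i] (Sum.elim W U i) := fun i => comap_measurable _
  have hi := indep_iSup_of_disjoint (m := m) (fun i => (h.measurable_elim i).comap_le)
    h.indep.iIndep (S := {Sum.inl 0, Sum.inr 0}) (T := {Sum.inl 0, Sum.inr 0}ᶜ)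
    disjoint_compl_right
  have key : ∀ (S : Set (ℕ ⊕ ℕ)) (i : ℕ ⊕ ℕ), i ∈ S → Measurable[⨆ i ∈ S, m i] (Sum.elim W U i) :=
    fun S i hiS => (hm i).mono (le_iSup₂_of_le i hiS le_rfl) le_rfl
  rw [IndepFun_iff_Indep]
  refine indep_of_indep_of_le_left (indep_of_indep_of_le_right hi ?_) ?_
  · refine Measurable.comap_le ?_
    refine Measurable.prodMk ?_ ?_
    · exact @measurable_pi_lambda _ _ _ (_) _ _ fun k =>
        key _ (Sum.inl (k + 1)) (by simp)
    · exact @measurable_pi_lambda _ _ _ (_) _ _ fun k =>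
        key _ (Sum.inr (k + 1)) (by simp)
  · refine Measurable.comap_le ?_
    exact Measurable.prodMk (key _ (Sum.inl 0) (by simp)) (key _ (Sum.inr 0) (by simp))

lemma measure_first_rest (h : IsMarkedPoisson P W U)
    {p : ℝ → ℝ → (ℕ → ℝ) → (ℕ → ℝ) → Prop}
    (hp : MeasurableSet {z : (ℝ × ℝ) × ((ℕ → ℝ) × (ℕ → ℝ)) | p z.1.1 z.1.2 z.2.1 z.2.2}) :
    P {ω | p (W 0 ω) (U 0 ω) (fun k => W (k + 1) ω) (fun k => U (k + 1) ω)} =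
      ∫⁻ w, (∫⁻ u in Set.Icc (0 : ℝ) 1,
        P {ω | p w u (fun k => W (k + 1) ω) (fun k => U (k + 1) ω)}) ∂(expMeasure 1) := by
  have hW := h.measurable_waiting
  have hU := h.measurable_mark
  have hexp := isProbabilityMeasure_expMeasure one_pos
  have hY : Measurable fun ω => ((fun k => W (k + 1) ω), (fun k => U (k + 1) ω)) := by fun_prop
  have := Measure.isProbabilityMeasure_map (μ := P) hY.aemeasurable
  have e : {ω | p (W 0 ω) (U 0 ω) (fun k => W (k + 1) ω) (fun k => U (k + 1) ω)} =
    (fun ω => ((W 0 ω, U 0 ω), ((fun k => W (k + 1) ω), (fun k => U (k + 1) ω)))) ⁻¹'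
      {z : (ℝ × ℝ) × ((ℕ → ℝ) × (ℕ → ℝ)) | p z.1.1 z.1.2 z.2.1 z.2.2} := rfl
  rw [e, ← Measure.map_apply (by fun_prop) hp, h.map_first_rest, Measure.prod_apply hp,
    lintegral_prod _ (measurable_measure_prodMk_left hp).aemeasurable]
  refine lintegral_congr fun w => lintegral_congr fun u => ?_
  rw [Measure.map_apply hY (measurable_prodMk_left hp)]
  rfl

/-- Chernoff bound: the Laplace transform of a waiting time at `1` is `1 / 2`, and the induction
multiplies these factors. -/
lemma measure_sum_le (n : ℕ) : ∀ {W U : ℕ → Ω → ℝ}, IsMarkedPoisson P W U → ∀ b : ℝ,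
    P {ω | ∑ j ∈ Finset.range n, W j ω ≤ b} ≤ ENNReal.ofReal (Real.exp b * (1 / 2) ^ n) := by
  induction n with
  | zero =>
    intro W U h b
    rcases le_or_gt 0 b with hb | hb
    · refine prob_le_one.trans ?_
      simpa using hb
    · simp [not_le.2 hb]
  | succ n ih =>
    intro W U h b
    have e : {ω | ∑ j ∈ Finset.range (n + 1), W j ω ≤ b} =
        {ω | ∑ j ∈ Finset.range n, W (j + 1) ω ≤ b - W 0 ω} := by
      ext ω; simp only [Set.mem_ofPred_eq, Finset.sum_range_succ']; constructor <;> intro h <;> linarith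
    rw [e, h.measure_first_rest (p := fun w _ ws _ => ∑ j ∈ Finset.range n, ws j ≤ b - w)
      (measurableSet_le (by fun_prop) (by fun_prop))]
    calc _ ≤ ∫⁻ w, ENNReal.ofReal (Real.exp (b - w) * (1 / 2) ^ n) ∂(expMeasure 1) := by
          refine lintegral_mono fun w => ?_
          refine (lintegral_mono fun u => ih h.shift (b - w)).trans ?_
          simp
      _ = ENNReal.ofReal (Real.exp b * (1 / 2) ^ (n + 1)) := by
          rw [lintegral_expMeasure_one _ (by fun_prop)]
          have : ∀ w : ℝ, ENNReal.ofReal (Real.exp (-w)) *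
              ENNReal.ofReal (Real.exp (b - w) * (1 / 2) ^ n) =
              ENNReal.ofReal (Real.exp b * (1 / 2) ^ n * Real.exp ((-2) * w)) := by
            intro w
            rw [← ENNReal.ofReal_mul (Real.exp_pos _).le]
            congr 1
            rw [show (-2) * w = -w + -w by ring, sub_eq_add_neg, Real.exp_add, Real.exp_add]
            ring
          simp only [this]
          rw [← ofReal_integral_eq_lintegral_ofReal]
          · rw [integral_const_mul, integral_exp_mul_Ioi (by norm_num)]
            congr 1
            simp [pow_succ]; ring
          · exact (integrableOn_exp_mul_Ioi (by norm_num) 0).const_mul _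
          · exact Eventually.of_forall fun x => by positivity

lemma lintegral_mark (r w a b : ℝ) (hr0 : 0 ≤ r) (K : ℝ≥0∞) :
    ∫⁻ u in Set.Icc (0 : ℝ) 1, (Set.indicator {u | w ∈ Set.Ioc a b → r < u} (fun _ => K) u) =
      ENNReal.ofReal (1 - Set.indicator (Set.Ioc a b) (fun _ => r) w) * K := by
  by_cases hw : w ∈ Set.Ioc a b
  · have : {u : ℝ | w ∈ Set.Ioc a b → r < u} = Set.Ioi r := by ext; simp [hw]
    rw [this, lintegral_indicator measurableSet_Ioi, lintegral_const, Measure.restrict_restrict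
      measurableSet_Ioi, Measure.restrict_apply_univ]
    have e : Set.Ioi r ∩ Set.Icc 0 1 = Set.Ioc r 1 := by
      ext x; simp only [Set.mem_inter_iff, Set.mem_Ioi, Set.mem_Icc, Set.mem_Ioc]
      exact ⟨fun h => ⟨h.1, h.2.2⟩, fun h => ⟨h.1, hr0.trans h.1.le, h.2⟩⟩
    rw [e, Real.volume_Ioc, Set.indicator_of_mem hw, mul_comm]
  · have : {u : ℝ | w ∈ Set.Ioc a b → r < u} = Set.univ := by ext; simp [hw]
    rw [this]
    simp [Set.indicator_of_notMem hw]

lemma measurableSet_window (r a b : ℝ) :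
    MeasurableSet {z : (ℝ × ℝ) × ((ℕ → ℝ) × (ℕ → ℝ)) | z.1.1 ∈ Set.Ioc a b → r < z.1.2} :=
  MeasurableSet.imp (measurableSet_Ioc.preimage (by fun_prop)) (measurableSet_lt (by fun_prop)
    (by fun_prop))

/-- The induction starts from `voidProb ≤ 1`, and the renewal equation propagates the inequality. -/
lemma ofReal_voidProb_le (n : ℕ) {r : ℝ} (hr0 : 0 ≤ r) (hr1 : r ≤ 1) : ∀ {W U : ℕ → Ω → ℝ},
    IsMarkedPoisson P W U → ∀ {a b : ℝ}, a ≤ b →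
    ENNReal.ofReal (voidProb r a b) ≤ P {ω | NoMark n r a b (W · ω) (U · ω)} := by
  induction n with
  | zero =>
    intro W U h a b hab
    have : ∀ ω, NoMark 0 r a b (W · ω) (U · ω) := fun ω i hi => by omega
    simp only [this, Set.ofPred_true, measure_univ, voidProb]
    rw [ENNReal.ofReal_le_one, Real.exp_le_one_iff]
    have := max_le_max_right 0 hab
    nlinarith
  | succ n ih =>
    intro W U h a b hab
    simp only [noMark_succ]
    rw [h.measure_first_rest (p := fun w u ws us => (w ∈ Set.Ioc a b → r < u) ∧
      NoMark n r (a - w) (b - w) ws us) ((measurableSet_window r a b).inter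
        (measurableSet_noMark n r (by fun_prop) (by fun_prop) (by fun_prop) (by fun_prop))),
      ← lintegral_voidProb hr1 hab]
    refine lintegral_mono fun w => ?_
    rw [ENNReal.ofReal_mul (by
      by_cases hw : w ∈ Set.Ioc a b <;> simp [hw, hr1]), ← lintegral_mark r w a b hr0]
    refine lintegral_mono fun u => ?_
    by_cases hu : w ∈ Set.Ioc a b → r < u
    · rw [Set.indicator_of_mem (show u ∈ {u | w ∈ Set.Ioc a b → r < u} from hu)]
      refine (ih h.shift (sub_le_sub_right hab w)).trans (measure_mono fun ω hω => ⟨hu, hω⟩)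
    · rw [Set.indicator_of_notMem (show u ∉ {u | w ∈ Set.Ioc a b → r < u} from hu)]
      exact zero_le

/-- The reverse inequality requires that the first `n` points exhaust the window. For `n = 0` the
event is then empty when `0 ≤ b`, and the void probability is `1` when `b < 0`. -/
lemma measure_noMark_le (n : ℕ) {r : ℝ} (hr0 : 0 ≤ r) (hr1 : r ≤ 1) : ∀ {W U : ℕ → Ω → ℝ},
    IsMarkedPoisson P W U → ∀ {a b : ℝ}, a ≤ b →
    P {ω | NoMark n r a b (W · ω) (U · ω) ∧ b < ∑ j ∈ Finset.range n, W j ω} ≤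
      ENNReal.ofReal (voidProb r a b) := by
  induction n with
  | zero =>
    intro W U h a b hab
    rcases le_or_gt 0 b with hb | hb
    · simp [not_lt.2 hb]
    · refine prob_le_one.trans ?_
      simp [voidProb, max_eq_right hb.le, max_eq_right (hab.trans hb.le)]
  | succ n ih =>
    intro W U h a b hab
    simp only [noMark_succ, Finset.sum_range_succ', ← sub_lt_iff_lt_add]
    rw [h.measure_first_rest (p := fun w u ws us => ((w ∈ Set.Ioc a b → r < u) ∧
      NoMark n r (a - w) (b - w) ws us) ∧ b - w < ∑ j ∈ Finset.range n, ws j)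
        (((measurableSet_window r a b).inter
        (measurableSet_noMark n r (by fun_prop) (by fun_prop) (by fun_prop) (by fun_prop))).inter
        (measurableSet_lt (f := fun z : (ℝ × ℝ) × ((ℕ → ℝ) × (ℕ → ℝ)) => b - z.1.1)
          (g := fun z => ∑ j ∈ Finset.range n, z.2.1 j) (by fun_prop) (by fun_prop))),
      ← lintegral_voidProb hr1 hab]
    refine lintegral_mono fun w => ?_
    rw [ENNReal.ofReal_mul (by
      by_cases hw : w ∈ Set.Ioc a b <;> simp [hw, hr1]), ← lintegral_mark r w a b hr0]
    refine lintegral_mono fun u => ?_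
    by_cases hu : w ∈ Set.Ioc a b → r < u
    · rw [Set.indicator_of_mem (show u ∈ {u | w ∈ Set.Ioc a b → r < u} from hu)]
      refine (measure_mono fun ω hω => ?_).trans (ih h.shift (sub_le_sub_right hab w))
      exact ⟨hω.1.2, hω.2⟩
    · rw [Set.indicator_of_notMem (show u ∉ {u | w ∈ Set.Ioc a b → r < u} from hu)]
      have : ∀ ω, ¬ (((w ∈ Set.Ioc a b → r < u) ∧ NoMark n r (a - w) (b - w)
        (fun k => W (k + 1) ω) (fun k => U (k + 1) ω)) ∧
          b - w < ∑ j ∈ Finset.range n, W (j + 1) ω) := fun ω hω => hu hω.1.1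
      exact (measure_mono_null (t := ∅) (fun ω hω => this ω hω) measure_empty).le

lemma measure_forall_noMark_le (h : IsMarkedPoisson P W U) {r a b : ℝ} (hr0 : 0 ≤ r) (hr1 : r ≤ 1)
    (hab : a ≤ b) :
    P {ω | ∀ n, NoMark n r a b (W · ω) (U · ω)} ≤ ENNReal.ofReal (voidProb r a b) := by
  have key : ∀ n : ℕ, P {ω | ∀ n, NoMark n r a b (W · ω) (U · ω)} ≤
      ENNReal.ofReal (voidProb r a b) + ENNReal.ofReal (Real.exp b * (1 / 2) ^ n) := by
    intro n
    refine (measure_mono (t := {ω | NoMark n r a b (W · ω) (U · ω) ∧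
      b < ∑ j ∈ Finset.range n, W j ω} ∪ {ω | ∑ j ∈ Finset.range n, W j ω ≤ b}) ?_).trans
      ((measure_union_le _ _).trans (add_le_add (measure_noMark_le n hr0 hr1 h hab)
        (measure_sum_le n h b)))
    intro ω hω
    rcases le_or_gt (∑ j ∈ Finset.range n, W j ω) b with hb | hb
    · exact Or.inr hb
    · exact Or.inl ⟨hω n, hb⟩
  have lim : Tendsto (fun n : ℕ => ENNReal.ofReal (voidProb r a b) +
      ENNReal.ofReal (Real.exp b * (1 / 2) ^ n)) atTop
      (𝓝 (ENNReal.ofReal (voidProb r a b) + ENNReal.ofReal (Real.exp b * 0))) := by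
    refine tendsto_const_nhds.add (ENNReal.tendsto_ofReal (tendsto_const_nhds.mul ?_))
    exact tendsto_pow_atTop_nhds_zero_of_lt_one (by norm_num) (by norm_num)
  have := ge_of_tendsto' lim key
  simpa using this

lemma measure_exists_mark_le (h : IsMarkedPoisson P W U) {r a b : ℝ} (hr0 : 0 ≤ r)
    (hab : a ≤ b) :
    P {ω | ∃ n, ¬ NoMark n r a b (W · ω) (U · ω)} ≤ ENNReal.ofReal (r * (b - a)) := by
  have hW := h.measurable_waiting
  have hU := h.measurable_mark
  have hms : ∀ (n : ℕ) (r : ℝ), MeasurableSet {ω | NoMark n r a b (W · ω) (U · ω)} := fun n r =>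
    measurableSet_noMark n r (by fun_prop) (by fun_prop) (by fun_prop) (by fun_prop)
  have hmono : ∀ (r : ℝ) (ω : Ω) (m n : ℕ), m ≤ n → NoMark n r a b (W · ω) (U · ω) →
      NoMark m r a b (W · ω) (U · ω) := fun r ω m n hmn hn i hi => hn i (by omega)
  have main : ∀ r, 0 ≤ r → r ≤ 1 →
      P {ω | ∃ n, ¬ NoMark n r a b (W · ω) (U · ω)} ≤ ENNReal.ofReal (r * (b - a)) := by
    intro r hr0 hr1
    rw [Set.ofPred_exists, Monotone.measure_iUnion]
    · refine iSup_le fun n => ?_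
      have e : {ω | ¬ NoMark n r a b (W · ω) (U · ω)} =
        {ω | NoMark n r a b (W · ω) (U · ω)}ᶜ := rfl
      rw [e, prob_compl_eq_one_sub (hms n r)]
      refine (tsub_le_tsub_left (ofReal_voidProb_le n hr0 hr1 h hab) 1).trans ?_
      rw [← ENNReal.ofReal_one, ← ENNReal.ofReal_sub _ (show 0 ≤ voidProb r a b from (Real.exp_pos _).le)]
      refine ENNReal.ofReal_le_ofReal ?_
      have h1 := Real.one_sub_le_exp_neg (r * (max b 0 - max a 0))
      have h2 : max b 0 - max a 0 ≤ b - a := by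
        rcases le_total a 0 with h | h <;> rcases le_total b 0 with h' | h' <;>
          simp [h, h'] <;> linarith
      have h3 := mul_le_mul_of_nonneg_left h2 hr0
      unfold voidProb
      linarith
    · exact fun m n hmn ω hω hn => hω (hmono r ω m n hmn hn)
  -- Marks are almost surely at most `1`, so ranks above `1` are no more permissive than rank `1`.
  rcases le_total r 1 with hr1 | hr1
  · exact main r hr0 hr1
  have hle : ∀ᵐ ω ∂P, ∀ i, U i ω ≤ 1 := by
    rw [ae_all_iff]
    intro i
    have : ∀ᵐ x ∂(P.map (U i)), x ≤ 1 := by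
      rw [h.mark_law]
      exact (ae_restrict_mem measurableSet_Icc).mono fun x hx => hx.2
    exact ae_of_ae_map (hU i).aemeasurable this
  refine (measure_mono_ae (hle.mono fun ω hω => ?_)).trans
    ((main 1 zero_le_one le_rfl).trans (ENNReal.ofReal_le_ofReal ?_))
  · rintro ⟨n, hn⟩
    refine ⟨n, fun h1 => hn fun i hi hS => ?_⟩
    exact absurd (h1 i hi hS) (not_lt.2 (hω i))
  · nlinarith

omit [IsProbabilityMeasure P] in
lemma ae_pos (h : IsMarkedPoisson P W U) : ∀ᵐ ω ∂P, ∀ i, 0 < W i ω := by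
  rw [ae_all_iff]
  intro i
  refine ae_of_ae_map (p := fun x => 0 < x) (h.measurable_waiting i).aemeasurable ?_
  rw [h.waiting_law, ae_iff]
  have hms : MeasurableSet {x : ℝ | ¬ 0 < x} :=
    (measurableSet_lt measurable_const measurable_id).compl
  have := lintegral_expMeasure_one (Set.indicator {x | ¬ 0 < x} fun _ => 1)
    (measurable_const.indicator hms)
  rw [lintegral_indicator hms] at this
  simp only [lintegral_const, one_mul, Measure.restrict_apply_univ] at this
  rw [this, setLIntegral_congr_fun measurableSet_Ioi (g := fun _ => 0), lintegral_zero]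
  intro x hx
  have : x ∉ {x : ℝ | ¬ 0 < x} := fun h => h hx
  exact (congrArg _ (Set.indicator_of_notMem this _)).trans (mul_zero _)

lemma ae_tendsto (h : IsMarkedPoisson P W U) :
    ∀ᵐ ω ∂P, ∀ t : ℝ, ∃ n, t < ∑ j ∈ Finset.range n, W j ω := by
  have key : ∀ᵐ ω ∂P, ∀ m : ℕ, ∃ n, (m : ℝ) < ∑ j ∈ Finset.range n, W j ω := by
    rw [ae_all_iff]
    intro m
    rw [ae_iff]
    have hle : ∀ n : ℕ, P {ω | ¬ ∃ n, (m : ℝ) < ∑ j ∈ Finset.range n, W j ω} ≤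
        ENNReal.ofReal (Real.exp m * (1 / 2) ^ n) := fun n =>
      (measure_mono (s := {ω | ¬ ∃ n, (m : ℝ) < ∑ j ∈ Finset.range n, W j ω})
        (t := {ω | ∑ j ∈ Finset.range n, W j ω ≤ m})
        fun ω hω => not_lt.1 fun hn => Set.notMem_of_mem_compl hω ⟨n, hn⟩).trans (measure_sum_le n h m)
    have lim : Tendsto (fun n : ℕ => ENNReal.ofReal (Real.exp m * (1 / 2) ^ n)) atTop
        (𝓝 (ENNReal.ofReal (Real.exp m * 0))) := by
      refine ENNReal.tendsto_ofReal (tendsto_const_nhds.mul ?_)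
      exact tendsto_pow_atTop_nhds_zero_of_lt_one (by norm_num) (by norm_num)
    have := ge_of_tendsto' lim hle
    simpa using this
  filter_upwards [key] with ω hω t
  obtain ⟨m, hm⟩ := exists_nat_ge t
  obtain ⟨n, hn⟩ := hω m
  exact ⟨n, hm.trans_lt hn⟩

end IsMarkedPoisson

/-! ### The marks of the graphical construction in a time window -/

/-- The site `x` has an arrival time `t` whose mark is at most `r`. -/
def HasMark {d : ℕ} (w u : Site d → ℕ → ℝ) (r : ℝ) (x : Site d) (t : ℝ) : Prop :=
  ∃ i, 1 ≤ i ∧ arrivalTime w x i = t ∧ u x i ≤ r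

/-- The site `x` has an arrival time in the window `(a, b]` whose mark is at most `r`. -/
def HasMarkIn {d : ℕ} (w u : Site d → ℕ → ℝ) (r : ℝ) (x : Site d) (a b : ℝ) : Prop :=
  ∃ t ∈ Set.Ioc a b, HasMark w u r x t

/-- The arrival `τ(x, i + 1)` is the sum of the first `i + 1` waiting times and carries the mark
`U(x, i + 1)`, whence the shift of the marks. -/
lemma hasMarkIn_iff {d : ℕ} (w u : Site d → ℕ → ℝ) (r : ℝ) (x : Site d) (a b : ℝ) :
    HasMarkIn w u r x a b ↔ ∃ n, ¬ NoMark n r a b (w x) (fun i => u x (i + 1)) := by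
  unfold HasMarkIn HasMark NoMark arrivalTime
  push Not
  constructor
  · rintro ⟨t, ht, i, hi, rfl, hu⟩
    obtain ⟨j, rfl⟩ : ∃ j, i = j + 1 := ⟨i - 1, by omega⟩
    exact ⟨j + 1, j, by omega, ht, hu⟩
  · rintro ⟨n, i, -, hi, hu⟩
    exact ⟨_, hi, i + 1, by omega, rfl, hu⟩

lemma measure_biInter_of_iIndep {Ω ι α : Type*} [MeasurableSpace Ω] {P : Measure Ω}
    [IsProbabilityMeasure P] {m : ι → MeasurableSpace Ω} (hle : ∀ i, m i ≤ ‹MeasurableSpace Ω›)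
    (hm : iIndep m P) (site : ι → α) (E : α → Set Ω)
    (hE : ∀ x, MeasurableSet[⨆ i ∈ site ⁻¹' {x}, m i] (E x)) (S : Finset α) :
    P (⋂ x ∈ S, E x) = ∏ x ∈ S, P (E x) := by
  classical
  induction S using Finset.induction_on with
  | empty => simp
  | insert x S hx ih =>
    have hind := indep_iSup_of_disjoint hle hm (S := site ⁻¹' {x}) (T := site ⁻¹' S)
      (Disjoint.preimage _ (by simpa using hx))
    rw [Finset.prod_insert hx, ← ih, Finset.set_biInter_insert]
    refine (Indep_iff _ _ _).1 hind _ _ (hE x) ?_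
    refine Finset.measurableSet_biInter (m := ⨆ i ∈ site ⁻¹' S, m i) S fun y hy => ?_
    refine (iSup₂_mono' fun i hi => ⟨i, ?_, le_rfl⟩ :
      (⨆ i ∈ site ⁻¹' {y}, m i) ≤ ⨆ i ∈ site ⁻¹' S, m i) _ (hE y)
    have : site i = y := hi
    simpa [this] using hy

/-! ### Independence of the sites and probabilities of marks -/

namespace IsGraphicalFamily

variable {Ω : Type*} [MeasurableSpace Ω] {P : Measure Ω} {d : ℕ} {W U : Site d → ℕ → Ω → ℝ}

/-- Random variables with a prescribed law are only almost everywhere measurable. Since there are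
countably many, measurable versions agree with all of them simultaneously outside a null set. -/
lemma exists_measurable (h : IsGraphicalFamily P W U) : ∃ W' U' : Site d → ℕ → Ω → ℝ,
    IsGraphicalFamily P W' U' ∧ (∀ x j, Measurable (W' x j)) ∧ (∀ x j, Measurable (U' x j)) ∧
    ∀ᵐ ω ∂P, ∀ x j, W x j ω = W' x j ω ∧ U x j ω = U' x j ω := by
  have hW := fun x j => (h.waiting_law x j).aemeasurable
  have hU := fun x j => (h.mark_law x j).aemeasurable
  refine ⟨fun x j => (hW x j).mk _, fun x j => (hU x j).mk _, ⟨fun x j => ?_, fun x j => ?_, ?_⟩,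
    fun x j => (hW x j).measurable_mk, fun x j => (hU x j).measurable_mk, ?_⟩
  · exact (h.waiting_law x j).congr (hW x j).ae_eq_mk.symm
  · exact (h.mark_law x j).congr (hU x j).ae_eq_mk.symm
  · refine (iIndepFun_congr fun i => ?_).1 h.indep
    cases i with
    | inl p => exact (hW p.1 p.2).ae_eq_mk
    | inr p => exact (hU p.1 p.2).ae_eq_mk
  · simp only [ae_all_iff]
    intro x j
    filter_upwards [(hW x j).ae_eq_mk, (hU x j).ae_eq_mk] with ω h1 h2 using ⟨h1, h2⟩

lemma isMarkedPoisson (h : IsGraphicalFamily P W U) (hW : ∀ x j, Measurable (W x j))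
    (hU : ∀ x j, Measurable (U x j)) (x : Site d) :
    IsMarkedPoisson P (W x) (fun i => U x (i + 1)) where
  measurable_waiting := hW x
  measurable_mark i := hU x (i + 1)
  waiting_law j := (h.waiting_law x j).map_eq
  mark_law j := (h.mark_law x (j + 1)).map_eq
  indep := by
    have := h.indep.precomp (g := Sum.map (fun j : ℕ => (x, j)) (fun j : ℕ => (x, j + 1)))
      (Sum.map_injective.2 ⟨fun a b h => by simpa using h, fun a b h => by simpa using h⟩)
    convert this using 1
    ext i ω
    cases i <;> rfl

omit [MeasurableSpace Ω] in
lemma measurableSet_hasMarkIn {m : MeasurableSpace Ω} {x : Site d}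
    (hW : ∀ j, Measurable[m] (W x j)) (hU : ∀ j, Measurable[m] (U x j)) (r a b : ℝ) :
    MeasurableSet[m] {ω | HasMarkIn (W · · ω) (U · · ω) r x a b} := by
  simp only [hasMarkIn_iff, Set.ofPred_exists]
  exact MeasurableSet.iUnion fun n => (measurableSet_noMark n r (by fun_prop) (by fun_prop)
    (by fun_prop) (by fun_prop)).compl

lemma measure_biInter_hasMarkIn [IsProbabilityMeasure P] (h : IsGraphicalFamily P W U)
    (hW : ∀ x j, Measurable (W x j)) (hU : ∀ x j, Measurable (U x j)) (r a b : ℝ)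
    (S : Finset (Site d)) :
    P (⋂ x ∈ S, {ω | HasMarkIn (W · · ω) (U · · ω) r x a b}) =
      ∏ x ∈ S, P {ω | HasMarkIn (W · · ω) (U · · ω) r x a b} ∧
    P (⋂ x ∈ S, {ω | HasMarkIn (W · · ω) (U · · ω) r x a b}ᶜ) =
      ∏ x ∈ S, P {ω | HasMarkIn (W · · ω) (U · · ω) r x a b}ᶜ := by
  set f := Sum.elim (fun p : Site d × ℕ => W p.1 p.2) (fun p : Site d × ℕ => U p.1 p.2) with hf
  set m : (Site d × ℕ) ⊕ (Site d × ℕ) → MeasurableSpace Ω :=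
    fun i => MeasurableSpace.comap (f i) inferInstance with hm
  set site : (Site d × ℕ) ⊕ (Site d × ℕ) → Site d := Sum.elim Prod.fst Prod.fst with hsite
  have hle : ∀ i, m i ≤ ‹MeasurableSpace Ω› := by
    intro i
    cases i
    · exact (hW _ _).comap_le
    · exact (hU _ _).comap_le
  have key : ∀ i, Measurable[⨆ i' ∈ site ⁻¹' {site i}, m i'] (f i) := fun i =>
    (comap_measurable (f i)).mono (le_iSup₂_of_le (f := fun i' _ => m i') i rfl le_rfl) le_rfl
  have hE : ∀ x, MeasurableSet[⨆ i ∈ site ⁻¹' {x}, m i]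
      {ω | HasMarkIn (W · · ω) (U · · ω) r x a b} := fun x =>
    measurableSet_hasMarkIn (fun j => key (Sum.inl (x, j))) (fun j => key (Sum.inr (x, j))) r a b
  exact ⟨measure_biInter_of_iIndep hle h.indep.iIndep site _ hE S,
    measure_biInter_of_iIndep hle h.indep.iIndep site _ (fun x => (hE x).compl) S⟩

lemma measure_forall_hasMarkIn_le [IsProbabilityMeasure P] (h : IsGraphicalFamily P W U)
    {r a b : ℝ} (hr : 0 ≤ r) (hab : a ≤ b) (S : Finset (Site d)) :
    P {ω | ∀ x ∈ S, HasMarkIn (W · · ω) (U · · ω) r x a b} ≤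
      ENNReal.ofReal (r * (b - a)) ^ S.card := by
  obtain ⟨W', U', h', hW, hU, hae⟩ := h.exists_measurable
  calc _ ≤ P (⋂ x ∈ S, {ω | HasMarkIn (W' · · ω) (U' · · ω) r x a b}) := by
        refine measure_mono_ae (hae.mono fun ω hω hS => ?_)
        have e1 : (fun x j => W x j ω) = fun x j => W' x j ω := by
          ext x j; exact (hω x j).1
        have e2 : (fun x j => U x j ω) = fun x j => U' x j ω := by
          ext x j; exact (hω x j).2
        refine Set.mem_iInter₂.2 fun x hx => ?_
        have := hS x hx
        rwa [e1, e2] at this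
    _ = ∏ x ∈ S, P {ω | HasMarkIn (W' · · ω) (U' · · ω) r x a b} :=
        (h'.measure_biInter_hasMarkIn hW hU r a b S).1
    _ ≤ ∏ _x ∈ S, ENNReal.ofReal (r * (b - a)) := by
        refine Finset.prod_le_prod' fun x _ => ?_
        simp only [hasMarkIn_iff]
        exact (h'.isMarkedPoisson hW hU x).measure_exists_mark_le hr hab
    _ = _ := by simp

/-- Rates may exceed `1`, where marks no longer become more frequent and the bound with `r` itself
would fail. Any smaller `s ≤ 1` can be used instead. -/
lemma measure_forall_not_hasMarkIn_le [IsProbabilityMeasure P] (h : IsGraphicalFamily P W U)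
    {r s a b : ℝ} (hs : 0 ≤ s) (hsr : s ≤ r) (hs1 : s ≤ 1) (ha : 0 ≤ a) (hab : a ≤ b)
    (S : Finset (Site d)) :
    P {ω | ∀ x ∈ S, ¬ HasMarkIn (W · · ω) (U · · ω) r x a b} ≤
      ENNReal.ofReal (Real.exp (-(S.card * (s * (b - a))))) := by
  obtain ⟨W', U', h', hW, hU, hae⟩ := h.exists_measurable
  calc _ ≤ P (⋂ x ∈ S, {ω | HasMarkIn (W' · · ω) (U' · · ω) s x a b}ᶜ) := by
        refine measure_mono_ae (hae.mono fun ω hω hS => ?_)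
        have e1 : (fun x j => W x j ω) = fun x j => W' x j ω := by
          ext x j; exact (hω x j).1
        have e2 : (fun x j => U x j ω) = fun x j => U' x j ω := by
          ext x j; exact (hω x j).2
        refine Set.mem_iInter₂.2 fun x hx => ?_
        rintro ⟨t, ht, i, hi, hit, hu⟩
        have := hS x hx
        rw [e1, e2] at this
        exact this ⟨t, ht, i, hi, hit, hu.trans hsr⟩
    _ = ∏ x ∈ S, P {ω | HasMarkIn (W' · · ω) (U' · · ω) s x a b}ᶜ :=
        (h'.measure_biInter_hasMarkIn hW hU s a b S).2
    _ ≤ ∏ _x ∈ S, ENNReal.ofReal (voidProb s a b) := by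
        refine Finset.prod_le_prod' fun x _ => ?_
        have := (h'.isMarkedPoisson hW hU x).measure_forall_noMark_le hs hs1 hab
        refine (measure_mono fun ω hω n => ?_).trans this
        by_contra hn
        exact hω ((hasMarkIn_iff _ _ _ _ _ _).2 ⟨n, hn⟩)
    _ = _ := by
        rw [Finset.prod_const, voidProb, ← ENNReal.ofReal_pow (Real.exp_pos _).le, ← Real.exp_nat_mul,
          max_eq_left ha, max_eq_left (ha.trans hab)]
        ring_nf

lemma ae_regular [IsProbabilityMeasure P] (h : IsGraphicalFamily P W U) :
    ∀ᵐ ω ∂P, (∀ x j, 0 < W x j ω) ∧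
      ∀ (x : Site d) (t : ℝ), ∃ n, t < arrivalTime (fun x j => W x j ω) x n := by
  obtain ⟨W', U', h', hW, hU, hae⟩ := h.exists_measurable
  have h1 := ae_all_iff.2 fun x => (h'.isMarkedPoisson hW hU x).ae_pos
  have h2 := ae_all_iff.2 fun x => (h'.isMarkedPoisson hW hU x).ae_tendsto
  filter_upwards [hae, h1, h2] with ω hω h1 h2
  refine ⟨fun x j => (hω x j).1 ▸ h1 x j, fun x t => ?_⟩
  obtain ⟨n, hn⟩ := h2 x t
  refine ⟨n, ?_⟩
  simpa only [arrivalTime, (hω x _).1] using hn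

end IsGraphicalFamily

/-! ### The growth model as a growing set -/

open Classical in
/-- The number of the neighbours of `x` in `S` which come before `x` in the order given by `T`. -/
noncomputable def earlier {d : ℕ} (S : Finset (Site d)) (T : Site d → ℝ) (x : Site d) : ℕ :=
  (S.filter fun y => Neighbours x y ∧ T y < T x).card

lemma mem_updateAt {d : ℕ} {Λ : Finset (Site d)} {c : ℕ → ℝ} {w u : Site d → ℕ → ℝ}
    {η : Finset (Site d)} {s : ℝ} {x : Site d} : x ∈ updateAt Λ c w u η s ↔
      x ∈ η ∨ x ∈ Λ ∧ HasMark w u (c (occupiedNeighbours x η)) x s := by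
  simp [updateAt, HasMark]

lemma subset_foldl_updateAt {d : ℕ} (Λ : Finset (Site d)) (c : ℕ → ℝ) (w u : Site d → ℕ → ℝ)
    (l : List ℝ) : ∀ η : Finset (Site d), η ⊆ l.foldl (updateAt Λ c w u) η := by
  induction l with
  | nil => exact fun η => subset_rfl
  | cons s l ih => exact fun η x hx => ih _ (mem_updateAt.2 (Or.inl hx))

/-- `T x` is the time of the update at which `x` enters. Sites entering together do not see each
other in `updateAt`, in agreement with the strict inequality in `earlier`; simultaneous arrivals
thus need not be excluded. -/
lemma exists_times_foldl_updateAt {d : ℕ} (Λ : Finset (Site d)) (c : ℕ → ℝ)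
    (w u : Site d → ℕ → ℝ) (l : List ℝ) (hl : l.Pairwise (· < ·)) : ∃ T : Site d → ℝ,
    ∀ x ∈ l.foldl (updateAt Λ c w u) ∅, x ∈ Λ ∧ T x ∈ l ∧
      HasMark w u (c (earlier (l.foldl (updateAt Λ c w u) ∅) T x)) x (T x) := by
  classical
  induction l using List.reverseRecOn with
  | nil => exact ⟨fun _ => 0, by simp⟩
  | append_singleton l s ih =>
    rw [List.pairwise_append] at hl
    obtain ⟨T, hT⟩ := ih hl.1
    rw [List.foldl_append, List.foldl_cons, List.foldl_nil]
    set η := l.foldl (updateAt Λ c w u) ∅ with hη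
    have hlt : ∀ x ∈ η, T x < s := fun x hx => hl.2.2 _ (hT x hx).2.1 s (by simp)
    refine ⟨fun x => if x ∈ η then T x else s, fun x hx => ?_⟩
    by_cases hxη : x ∈ η
    · refine ⟨(hT x hxη).1, by simp [hxη, (hT x hxη).2.1], ?_⟩
      have : earlier (updateAt Λ c w u η s) (fun x => if x ∈ η then T x else s) x =
          earlier η T x := by
        unfold earlier
        congr 1
        ext y
        simp only [Finset.mem_filter, hxη, if_true, mem_updateAt]
        by_cases hy : y ∈ η
        · simp [hy]
        · simp [hy, (hlt x hxη).le]
      simpa only [this, hxη, if_true] using (hT x hxη).2.2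
    · have hx' := (mem_updateAt.1 hx).resolve_left hxη
      refine ⟨hx'.1, by simp [hxη], ?_⟩
      have : earlier (updateAt Λ c w u η s) (fun x => if x ∈ η then T x else s) x =
          occupiedNeighbours x η := by
        unfold earlier occupiedNeighbours
        congr 1
        ext y
        simp only [Finset.mem_filter, hxη, if_false, mem_updateAt]
        by_cases hy : y ∈ η
        · simp [hy, hlt y hy]
        · simp [hy]
      simpa only [this, hxη, if_false] using hx'.2

lemma exists_times_occupiedSites {d : ℕ} (Λ : Finset (Site d)) (c : ℕ → ℝ)
    (w u : Site d → ℕ → ℝ) (t : ℝ) : ∃ T : Site d → ℝ, ∀ x ∈ occupiedSites Λ c w u t,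
      x ∈ Λ ∧ T x ≤ t ∧ HasMark w u (c (earlier (occupiedSites Λ c w u t) T x)) x (T x) := by
  unfold occupiedSites
  split_ifs with h
  · obtain ⟨T, hT⟩ := exists_times_foldl_updateAt Λ c w u (h.toFinset.sort (· ≤ ·))
      (Finset.sortedLT_sort _).pairwise
    refine ⟨T, fun x hx => ⟨(hT x hx).1, ?_, (hT x hx).2.2⟩⟩
    have := (hT x hx).2.1
    rw [Finset.mem_sort, Set.Finite.mem_toFinset] at this
    exact this.1
  · exact ⟨fun _ => 0, by simp⟩

/-- Waiting times which are positive and not summable. -/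
def RegularTimes {d : ℕ} (w : Site d → ℕ → ℝ) : Prop :=
  (∀ x j, 0 < w x j) ∧ ∀ (x : Site d) (t : ℝ), ∃ n, t < arrivalTime w x n

namespace RegularTimes

variable {d : ℕ} {w : Site d → ℕ → ℝ}

lemma arrivalTime_mono (hw : RegularTimes w) (x : Site d) : Monotone (arrivalTime w x) :=
  monotone_nat_of_le_succ fun n => by
    rw [arrivalTime, arrivalTime, Finset.sum_range_succ]
    linarith [hw.1 x n]

lemma arrivalTime_pos (hw : RegularTimes w) (x : Site d) {i : ℕ} (hi : 1 ≤ i) :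
    0 < arrivalTime w x i :=
  Finset.sum_pos (fun j _ => hw.1 x j) ⟨0, Finset.mem_range.2 hi⟩

lemma finite_arrivalTimesUpTo (hw : RegularTimes w) (Λ : Finset (Site d)) (t : ℝ) :
    (arrivalTimesUpTo Λ w t).Finite := by
  classical
  choose n hn using fun x => hw.2 x t
  refine (Λ.biUnion fun x => (Finset.range (n x)).image (arrivalTime w x)).finite_toSet.subset ?_
  rintro s ⟨hst, x, hx, i, -, rfl⟩
  simp only [Finset.coe_biUnion, Set.mem_iUnion]
  refine ⟨x, hx, ?_⟩
  simp only [Finset.coe_image, Finset.coe_range]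
  refine ⟨i, ?_, rfl⟩
  by_contra hi
  exact absurd ((hw.arrivalTime_mono x (not_lt.1 hi)).trans hst) (not_le.2 (hn x))

end RegularTimes

/-- This cuts the list of arrivals at an intermediate time: the evolution up to `t` is the evolution
up to `s`, continued from the configuration reached. -/
lemma sort_eq_append {F G : Finset ℝ} (hFG : F ⊆ G) (hlt : ∀ a ∈ F, ∀ b ∈ G, b ∉ F → a < b) :
    ∃ l : List ℝ, G.sort (· ≤ ·) = F.sort (· ≤ ·) ++ l ∧ ∀ b, b ∈ l ↔ b ∈ G ∧ b ∉ F := by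
  classical
  refine ⟨(G \ F).sort (· ≤ ·), ?_, fun b => by simp⟩
  refine List.Perm.eq_of_pairwise (le := (· ≤ ·)) (fun a b _ _ => le_antisymm)
    (Finset.pairwise_sort _ _) ?_ ?_
  · rw [List.pairwise_append]
    refine ⟨Finset.pairwise_sort _ _, Finset.pairwise_sort _ _, fun a ha b hb => ?_⟩
    simp only [Finset.mem_sort, Finset.mem_sdiff] at ha hb
    exact (hlt a ha b hb.1 hb.2).le
  · refine (List.perm_ext_iff_of_nodup (Finset.sort_nodup _ _) ?_).2 fun a => ?_
    · rw [List.nodup_append]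
      refine ⟨Finset.sort_nodup _ _, Finset.sort_nodup _ _, fun a ha b hb hab => ?_⟩
      simp only [Finset.mem_sort, Finset.mem_sdiff] at ha hb
      exact hb.2 (hab ▸ ha)
    · simp only [List.mem_append, Finset.mem_sort, Finset.mem_sdiff]
      have := @hFG a
      tauto

lemma occupiedSites_mono {d : ℕ} {w : Site d → ℕ → ℝ} (hw : RegularTimes w) (Λ : Finset (Site d))
    (c : ℕ → ℝ) (u : Site d → ℕ → ℝ) : Monotone (occupiedSites Λ c w u) := by
  intro s t hst
  have hs := hw.finite_arrivalTimesUpTo Λ s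
  have ht := hw.finite_arrivalTimesUpTo Λ t
  obtain ⟨l, hl, -⟩ := sort_eq_append (F := hs.toFinset) (G := ht.toFinset)
    (fun r hr => by
      simp only [Set.Finite.mem_toFinset] at hr ⊢
      exact ⟨hr.1.trans hst, hr.2⟩)
    (fun a ha b hb hbF => by
      simp only [Set.Finite.mem_toFinset] at ha hb hbF
      exact ha.1.trans_lt (not_le.1 fun h => hbF ⟨h, hb.2⟩))
  rw [occupiedSites, occupiedSites, dif_pos hs, dif_pos ht, hl, List.foldl_append]
  exact subset_foldl_updateAt _ _ _ _ _ _

lemma mem_occupiedSites_of_hasMarkIn {d : ℕ} {w : Site d → ℕ → ℝ} (hw : RegularTimes w)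
    {Λ : Finset (Site d)} {c : ℕ → ℝ} {u : Site d → ℕ → ℝ} {s t : ℝ} {x : Site d} (hx : x ∈ Λ)
    {r : ℝ} (hr : ∀ η, occupiedSites Λ c w u s ⊆ η → r ≤ c (occupiedNeighbours x η))
    (hm : HasMarkIn w u r x s t) : x ∈ occupiedSites Λ c w u t := by
  obtain ⟨q, hq, i, hi, hiq, hu⟩ := hm
  have hst : s ≤ t := hq.1.le.trans hq.2
  have hs := hw.finite_arrivalTimesUpTo Λ s
  have ht := hw.finite_arrivalTimesUpTo Λ t
  obtain ⟨l, hl, hlm⟩ := sort_eq_append (F := hs.toFinset) (G := ht.toFinset)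
    (fun r hr => by
      simp only [Set.Finite.mem_toFinset] at hr ⊢
      exact ⟨hr.1.trans hst, hr.2⟩)
    (fun a ha b hb hbF => by
      simp only [Set.Finite.mem_toFinset] at ha hb hbF
      exact ha.1.trans_lt (not_le.1 fun h => hbF ⟨h, hb.2⟩))
  have hql : q ∈ l := by
    rw [hlm, Set.Finite.mem_toFinset, Set.Finite.mem_toFinset]
    exact ⟨⟨hq.2, x, hx, i, hi, hiq⟩, fun h => not_le.2 hq.1 h.1⟩
  obtain ⟨l₁, l₂, rfl⟩ := List.append_of_mem hql
  have hsη : occupiedSites Λ c w u s ⊆ l₁.foldl (updateAt Λ c w u) (occupiedSites Λ c w u s) :=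
    subset_foldl_updateAt _ _ _ _ _ _
  have e : occupiedSites Λ c w u t = l₂.foldl (updateAt Λ c w u)
      (updateAt Λ c w u (l₁.foldl (updateAt Λ c w u) (occupiedSites Λ c w u s)) q) := by
    rw [occupiedSites, dif_pos ht, hl, List.foldl_append, List.foldl_append, List.foldl_cons,
      occupiedSites, dif_pos hs]
  rw [e]
  exact subset_foldl_updateAt _ _ _ _ _ _
    (mem_updateAt.2 (Or.inr ⟨hx, i, hi, hiq, hu.trans (hr _ hsη)⟩))

/-! ### Neighbours, connected sets and histories -/

lemma neighbours_iff {d : ℕ} {x y : Site d} :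
    Neighbours x y ↔ ∃ j, |x j - y j| = 1 ∧ ∀ i ≠ j, y i = x i := by
  unfold Neighbours
  constructor
  · intro h
    have hne : ∃ j, |x j - y j| ≠ 0 := by
      by_contra! h0
      simp [h0] at h
    obtain ⟨j, hj⟩ := hne
    have hsum := Finset.add_sum_erase Finset.univ (fun i => |x i - y i|) (Finset.mem_univ j)
    have hnn : ∀ i ∈ Finset.univ.erase j, 0 ≤ |x i - y i| := fun i _ => abs_nonneg _
    have h1 := Finset.sum_nonneg hnn
    have h2 : 1 ≤ |x j - y j| := by have := abs_nonneg (x j - y j); omega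
    refine ⟨j, by omega, fun i hi => ?_⟩
    have h3 : ∑ i ∈ Finset.univ.erase j, |x i - y i| = 0 := by omega
    have := (Finset.sum_eq_zero_iff_of_nonneg hnn).1 h3 i (by simp [hi])
    rw [abs_eq_zero, sub_eq_zero] at this
    exact this.symm
  · rintro ⟨j, hj, h⟩
    rw [Finset.sum_eq_single j (fun i _ hi => by simp [h i hi]) (by simp), hj]

lemma Neighbours.symm {d : ℕ} {x y : Site d} (h : Neighbours x y) : Neighbours y x := by
  unfold Neighbours at *
  simpa only [abs_sub_comm] using h

lemma Neighbours.abs_sub_le {d : ℕ} {x y : Site d} (h : Neighbours x y) (j : Fin d) :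
    |x j - y j| ≤ 1 := by
  obtain ⟨i, hi, h⟩ := neighbours_iff.1 h
  rcases eq_or_ne j i with rfl | hj
  · exact hi.le
  · simp [h j hj]

lemma Neighbours.eq_update {d : ℕ} {x y : Site d} (h : Neighbours x y) {j : Fin d} {v : ℤ}
    (hy : y j = v) (hx : x j ≠ v) : y = Function.update x j v := by
  obtain ⟨i, -, h⟩ := neighbours_iff.1 h
  have hij : i = j := by
    by_contra hij
    exact hx ((h j (Ne.symm hij)).symm.trans hy)
  subst hij
  ext k
  rcases eq_or_ne k i with rfl | hk
  · simp [hy]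
  · simp [hk, h k hk]

/-- Adjacency inside a finite set of sites. -/
def AdjIn {d : ℕ} (S : Finset (Site d)) (x y : Site d) : Prop := x ∈ S ∧ y ∈ S ∧ Neighbours x y

/-- A finite set of sites is connected in the lattice. -/
def LatticeConn {d : ℕ} (S : Finset (Site d)) : Prop :=
  ∀ x ∈ S, ∀ y ∈ S, Relation.ReflTransGen (AdjIn S) x y

open Classical in
/-- The connected component of `x` in `S`. -/
noncomputable def latticeComp {d : ℕ} (S : Finset (Site d)) (x : Site d) : Finset (Site d) :=
  S.filter fun y => Relation.ReflTransGen (AdjIn S) x y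

section Connected

variable {d : ℕ} {S : Finset (Site d)} {x y : Site d}

lemma AdjIn.symm (h : AdjIn S x y) : AdjIn S y x := ⟨h.2.1, h.1, h.2.2.symm⟩

lemma mem_latticeComp : y ∈ latticeComp S x ↔ y ∈ S ∧ Relation.ReflTransGen (AdjIn S) x y := by
  simp [latticeComp]

lemma latticeComp_subset : latticeComp S x ⊆ S := fun _ h => (mem_latticeComp.1 h).1

lemma self_mem_latticeComp (hx : x ∈ S) : x ∈ latticeComp S x :=
  mem_latticeComp.2 ⟨hx, .refl⟩

lemma mem_latticeComp_of_neighbours {z : Site d} (hy : y ∈ latticeComp S x) (hz : z ∈ S)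
    (h : Neighbours y z) : z ∈ latticeComp S x :=
  mem_latticeComp.2 ⟨hz, (mem_latticeComp.1 hy).2.tail ⟨(mem_latticeComp.1 hy).1, hz, h⟩⟩

lemma latticeConn_latticeComp : LatticeConn (latticeComp S x) := by
  have key : ∀ y ∈ latticeComp S x, Relation.ReflTransGen (AdjIn (latticeComp S x)) x y := by
    intro y hy
    have hxy := (mem_latticeComp.1 hy).2
    clear hy
    induction hxy with
    | refl => exact .refl
    | @tail u v hu huv ih =>
      have hu' : u ∈ latticeComp S x := mem_latticeComp.2 ⟨huv.1, hu⟩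
      exact ih.tail ⟨hu', mem_latticeComp_of_neighbours hu' huv.2.1 huv.2.2, huv.2.2⟩
  have key' : ∀ y ∈ latticeComp S x, Relation.ReflTransGen (AdjIn (latticeComp S x)) y x :=
    fun y hy =>
      have : Std.Symm (AdjIn (latticeComp S x)) := ⟨fun _ _ h => AdjIn.symm h⟩
      Std.Symm.symm (r := Relation.ReflTransGen (AdjIn (latticeComp S x))) _ _ (key y hy)
  intro y hy z hz
  exact (key' y hy).trans (key z hz)

lemma LatticeConn.exists_layer (hS : LatticeConn S) (hx : x ∈ S) (hy : y ∈ S) {j : Fin d} {h : ℤ}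
    (hxh : x j ≤ h) (hhy : h ≤ y j) : ∃ z ∈ S, z j = h := by
  have hxy := hS x hx y hy
  induction hxy with
  | refl => exact ⟨x, hx, le_antisymm hxh hhy⟩
  | @tail u v hu huv ih =>
    rcases le_or_gt h (u j) with hu' | hu'
    · exact ih huv.1 hu'
    · have := abs_le.1 (huv.2.2.abs_sub_le j)
      exact ⟨v, huv.2.1, by omega⟩

lemma LatticeConn.exists_boundary (hS : LatticeConn S) {C : Finset (Site d)} (hx : x ∈ S)
    (hxC : x ∈ C) (hy : y ∈ S) (hyC : y ∉ C) : ∃ u ∈ C, ∃ v ∈ S, v ∉ C ∧ Neighbours u v := by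
  have hxy := hS x hx y hy
  induction hxy with
  | refl => exact absurd hxC hyC
  | @tail u v hu huv ih =>
    by_cases hu' : u ∈ C
    · exact ⟨u, hu', v, hy, hyC, huv.2.2⟩
    · exact ih huv.1 hu'

end Connected

/-- All the sites of `S` become occupied in the window `(a, b]`, `x` at the time `T x`, when `x`
has `f x` occupied neighbours outside of `S`. The predicate `Q m x t` says that a site `x` with at
least `m` occupied neighbours becomes occupied at time `t`. -/
def IsHistory {d : ℕ} (Q : ℕ → Site d → ℝ → Prop) (f : Site d → ℕ) (a b : ℝ)
    (S : Finset (Site d)) (T : Site d → ℝ) : Prop :=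
  ∀ x ∈ S, a < T x ∧ T x ≤ b ∧ ∀ m ≤ d, f x + earlier S T x ≤ m → Q m x (T x)

/-- The extension of `S` in the direction `j` is at most `R j`. -/
def Spread {d : ℕ} (R : Fin d → ℤ) (S : Finset (Site d)) : Prop :=
  ∀ x ∈ S, ∀ y ∈ S, ∀ j, |x j - y j| ≤ R j

section History

variable {d : ℕ} {Q : ℕ → Site d → ℝ → Prop} {f f' : Site d → ℕ} {a b a' b' : ℝ}
  {S S' Λ : Finset (Site d)} {T : Site d → ℝ}

/-- A part of a history is again a history as soon as the new boundary condition compensates for the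
earlier neighbours that are discarded. -/
lemma IsHistory.restrict (h : IsHistory Q f a b S T) (hS : S' ⊆ S)
    (hT : ∀ x ∈ S', a' < T x ∧ T x ≤ b')
    (hf : ∀ x ∈ S', f x + earlier S T x ≤ f' x + earlier S' T x) : IsHistory Q f' a' b' S' T :=
  fun x hx => ⟨(hT x hx).1, (hT x hx).2, fun m hm hle => (h x (hS hx)).2.2 m hm
    ((hf x hx).trans hle)⟩

lemma earlier_le {x : Site d} (h : ∀ y ∈ S, Neighbours x y → T y < T x → y ∈ S') :
    earlier S T x ≤ earlier S' T x := by
  classical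
  refine Finset.card_le_card fun y hy => ?_
  rw [Finset.mem_filter] at hy ⊢
  exact ⟨h y hy.1 hy.2.1 hy.2.2, hy.2⟩

lemma earlier_le_add_one {x : Site d} (v : Site d)
    (h : ∀ y ∈ S, Neighbours x y → T y < T x → y ∈ S' ∨ y = v) :
    earlier S T x ≤ earlier S' T x + 1 := by
  classical
  refine (Finset.card_le_card (t := insert v (S'.filter fun y => Neighbours x y ∧ T y < T x))
    fun y hy => ?_).trans (Finset.card_insert_le _ _)
  rw [Finset.mem_filter] at hy
  rw [Finset.mem_insert, Finset.mem_filter]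
  rcases h y hy.1 hy.2.1 hy.2.2 with h | h
  · exact Or.inr ⟨h, hy.2⟩
  · exact Or.inl h

lemma earlier_eq_zero {x : Site d} (h : ∀ y ∈ S, Neighbours x y → ¬ T y < T x) :
    earlier S T x = 0 := by
  classical
  unfold earlier
  rw [Finset.card_eq_zero, Finset.filter_eq_empty_iff]
  exact fun _ hy hxy => h _ hy hxy.1 hxy.2

lemma IsHistory.comp (h : IsHistory Q f a b S T) (x : Site d) :
    IsHistory Q f a b (latticeComp S x) T :=
  h.restrict latticeComp_subset (fun _ hy => ⟨(h _ (latticeComp_subset hy)).1,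
    (h _ (latticeComp_subset hy)).2.1⟩) fun y hy => Nat.add_le_add_left
      (earlier_le fun _ hz hyz _ => mem_latticeComp_of_neighbours hy hz hyz) _

/-- If the connected histories of intermediate extension are of small extension, then all of them
are. -/
lemma spread_of_intermediate (R : Fin d → ℤ) (hR : ∀ j, 0 ≤ R j)
    (H : ∀ S ⊆ Λ, LatticeConn S → IsHistory Q f a b S T →
      Spread (fun j => 2 * R j + 2) S → Spread R S) :
    ∀ S ⊆ Λ, LatticeConn S → IsHistory Q f a b S T → Spread R S := by
  classical
  intro S
  induction S using Finset.strongInduction with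
  | H S ih =>
    intro hSΛ hS hist
    rcases S.eq_empty_or_nonempty with rfl | hne
    · exact fun x hx => absurd hx (Finset.notMem_empty x)
    -- Without the last site `x`, every component has spread at most `R` by induction, and each one
    -- is adjacent to `x` by connectedness. Hence `S` lies within `R + 1` of `x`.
    obtain ⟨x, hx, hmax⟩ := S.exists_max_image T hne
    have key : ∀ y ∈ S, ∀ j, |y j - x j| ≤ R j + 1 := by
      intro y hy j
      rcases eq_or_ne y x with rfl | hyx
      · simpa using (hR j).trans (by omega)
      have hy' : y ∈ S.erase x := Finset.mem_erase.2 ⟨hyx, hy⟩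
      set C := latticeComp (S.erase x) y with hC
      have hCS : C ⊆ S.erase x := latticeComp_subset
      have hxC : x ∉ C := fun h => Finset.notMem_erase x S (hCS h)
      have hist' : IsHistory Q f a b C T := by
        refine hist.restrict (hCS.trans (Finset.erase_subset _ _))
          (fun z hz => ?_) fun z hz => Nat.add_le_add_left (earlier_le fun v hv hzv hT => ?_) _
        · have := hist z (Finset.mem_of_mem_erase (hCS hz))
          exact ⟨this.1, this.2.1⟩
        · refine mem_latticeComp_of_neighbours hz (Finset.mem_erase.2 ⟨?_, hv⟩) hzv
          rintro rfl
          exact absurd hT (not_lt.2 (hmax z (Finset.mem_of_mem_erase (hCS hz))))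
      have hspread := ih C (hCS.trans_ssubset (Finset.erase_ssubset hx))
        ((hCS.trans (Finset.erase_subset _ _)).trans hSΛ) latticeConn_latticeComp hist'
      obtain ⟨u, hu, v, hv, hvC, huv⟩ :=
        hS.exists_boundary hy (self_mem_latticeComp hy') hx hxC
      have hvx : v = x := by
        by_contra hvx
        exact hvC (mem_latticeComp_of_neighbours hu (Finset.mem_erase.2 ⟨hvx, hv⟩) huv)
      subst hvx
      have h1 := abs_le.1 (hspread y (self_mem_latticeComp hy') u hu j)
      have h2 := abs_le.1 (huv.abs_sub_le j)
      rw [abs_le]; constructor <;> omega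
    refine H S hSΛ hS hist fun y hy z hz j => ?_
    have h1 := abs_le.1 (key y hy j)
    have h2 := abs_le.1 (key z hz j)
    show |y j - z j| ≤ 2 * R j + 2
    rw [abs_le]; constructor <;> omega

/-- Take the first site occupied in the two layers. Inside `S`, its only possible earlier neighbour
is the one across the outer face of the pair. -/
lemma IsHistory.exists_mark_of_adjacent_layers (hist : IsHistory Q f a b S T) {j : Fin d} {h : ℤ}
    {m : ℕ} (hm : m ≤ d) (hf : ∀ x ∈ S, x j = h ∨ x j = h + 1 → f x + 1 ≤ m)
    (h0 : ∃ x ∈ S, x j = h) (h1 : ∃ x ∈ S, x j = h + 1) :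
    ∃ x ∈ S, (x j = h ∨ x j = h + 1) ∧ Q m x (T x) := by
  classical
  obtain ⟨x, hx, hxmin⟩ := (S.filter fun x => x j = h).exists_min_image T
    (by obtain ⟨x, hx⟩ := h0; exact ⟨x, Finset.mem_filter.2 hx⟩)
  obtain ⟨y, hy, hymin⟩ := (S.filter fun x => x j = h + 1).exists_min_image T
    (by obtain ⟨x, hx⟩ := h1; exact ⟨x, Finset.mem_filter.2 hx⟩)
  rw [Finset.mem_filter] at hx hy
  have bound : ∀ z ∈ S, ∀ v, (z j = h ∨ z j = h + 1) →
      (∀ w ∈ S, Neighbours z w → T w < T z → w = v) → Q m z (T z) := by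
    intro z hz v hzj hw
    refine (hist z hz).2.2 m hm (le_trans (Nat.add_le_add_left ?_ _) (hf z hz hzj))
    have := earlier_le_add_one (S' := ∅) v fun w hwS hzw hT => Or.inr (hw w hwS hzw hT)
    simpa [earlier] using this
  rcases le_or_gt (T x) (T y) with hxy | hxy
  · refine ⟨x, hx.1, Or.inl hx.2, bound x hx.1 (Function.update x j (h - 1)) (Or.inl hx.2)
      fun w hw hxw hT => hxw.eq_update ?_ (by omega)⟩
    have h1 : w j ≠ h := fun hwj => not_lt.2 (hxmin w (Finset.mem_filter.2 ⟨hw, hwj⟩)) hT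
    have h2 : w j ≠ h + 1 := fun hwj =>
      not_lt.2 (hxy.trans (hymin w (Finset.mem_filter.2 ⟨hw, hwj⟩))) hT
    have := abs_le.1 (hxw.abs_sub_le j)
    omega
  · refine ⟨y, hy.1, Or.inr hy.2, bound y hy.1 (Function.update y j (h + 2)) (Or.inr hy.2)
      fun w hw hyw hT => hyw.eq_update ?_ (by omega)⟩
    have h1 : w j ≠ h + 1 := fun hwj => not_lt.2 (hymin w (Finset.mem_filter.2 ⟨hw, hwj⟩)) hT
    have h2 : w j ≠ h := fun hwj =>
      not_lt.2 (hxy.le.trans (hxmin w (Finset.mem_filter.2 ⟨hw, hwj⟩))) hT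
    have := abs_le.1 (hyw.abs_sub_le j)
    omega

/-- The number of the occupied neighbours of `x` in the boundary condition where, for each
direction `j ∈ A`, the sites next to the layer `x j = p j` are occupied. -/
def bdry (A : Finset (Fin d)) (p x : Site d) : ℕ := (A.filter fun j => x j = p j).card

lemma bdry_le (A : Finset (Fin d)) (p x : Site d) : bdry A p x ≤ A.card := Finset.card_filter_le _ _

lemma bdry_lt {A : Finset (Fin d)} {p x : Site d} {j : Fin d} (hj : j ∈ A) (hx : x j ≠ p j) :
    bdry A p x < A.card :=
  Finset.card_lt_card ((Finset.filter_ssubset).2 ⟨j, hj, hx⟩)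

lemma bdry_insert {A : Finset (Fin d)} {p : Site d} {j : Fin d} (hj : j ∉ A) (q : ℤ) (x : Site d) :
    bdry (insert j A) (Function.update p j q) x = bdry A p x + if x j = q then 1 else 0 := by
  have e : (A.filter fun i => x i = Function.update p j q i) = A.filter fun i => x i = p i := by
    refine Finset.filter_congr fun i hi => ?_
    have : i ≠ j := fun h => hj (h ▸ hi)
    simp [this]
  unfold bdry
  rw [Finset.filter_insert, Function.update_self, e]
  split_ifs with h
  · rw [Finset.card_insert_of_notMem fun hh => hj (Finset.mem_filter.1 hh).1]
  · simp

open Classical in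
-- Disjoint pairs of adjacent layers need distinct marks, so a long cluster would have more than `K`
-- of them. For `j ∈ A`, off the wall layer the boundary contributes at most `|A| - 1` neighbours,
-- so marks of rank `|A|` suffice.
lemma IsHistory.extent_le {A : Finset (Fin d)} {p : Site d} (hist : IsHistory Q (bdry A p) a b S T)
    (hS : LatticeConn S) {m K : ℕ} (hm : m ≤ d) {j : Fin d} (hA : A.card ≤ m)
    (hj : j ∈ A ∨ A.card + 1 ≤ m) (hK : (S.filter fun x => Q m x (T x)).card ≤ K) {x y : Site d}
    (hx : x ∈ S) (hy : y ∈ S) : y j - x j ≤ 2 * K + 2 := by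
  by_contra! hlt
  -- At most one pair of layers meets the wall, so `K + 2` pairs leave `K + 1` usable ones.
  set I := (Finset.range (K + 2)).filter fun i : ℕ => x j + 2 * i ≠ p j ∧ x j + 2 * i + 1 ≠ p j
    with hI
  have hIcard : K + 1 ≤ I.card := by
    have : Finset.range (K + 2) ⊆ insert (((p j - x j) / 2).toNat) I := by
      intro i hi
      rw [Finset.mem_insert, hI, Finset.mem_filter]
      by_cases h1 : x j + 2 * i ≠ p j ∧ x j + 2 * i + 1 ≠ p j
      · exact Or.inr ⟨hi, h1⟩
      · left; omega
    have := (Finset.card_le_card this).trans (Finset.card_insert_le _ _)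
    rw [Finset.card_range] at this
    omega
  have hsurj : Set.SurjOn (fun z : Site d => ((z j - x j) / 2).toNat)
      (S.filter fun x => Q m x (T x) : Finset (Site d)) I := by
    intro i hi
    rw [Finset.mem_coe, hI, Finset.mem_filter, Finset.mem_range] at hi
    obtain ⟨z, hz, hzj, hQ⟩ := hist.exists_mark_of_adjacent_layers (j := j) (h := x j + 2 * i) hm
      (fun z hz hzj => by
        rcases hj with hj | hj
        · exact (Nat.succ_le_of_lt (bdry_lt hj (by omega))).trans hA
        · exact (Nat.add_le_add_right (bdry_le _ _ _) 1).trans hj)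
      (hS.exists_layer hx hy (by omega) (by omega)) (hS.exists_layer hx hy (by omega) (by omega))
    refine ⟨z, by simpa using ⟨hz, hQ⟩, ?_⟩
    simp only
    omega
  have := Finset.card_le_card_of_surjOn _ hsurj
  omega

end History

/-! ### Crossing a slab without nucleation -/

/-- All the connected histories in `Λ` on the window `(a, b]`, with the boundary condition given by
`A` and `p`, have extension at most `V` in the directions of `A` and at most `M` in the others. -/
def SmallClusters {d : ℕ} (Q : ℕ → Site d → ℝ → Prop) (Λ : Finset (Site d)) (A : Finset (Fin d))
    (p : Site d) (a b : ℝ) (M V : ℤ) : Prop :=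
  ∀ S ⊆ Λ, ∀ T, LatticeConn S → IsHistory Q (bdry A p) a b S T →
    Spread (fun j => if j ∈ A then V else M) S

section Crossing

variable {d : ℕ} {Q : ℕ → Site d → ℝ → Prop} {a b : ℝ} {S Λ : Finset (Site d)} {T : Site d → ℝ}
  {A : Finset (Fin d)} {p : Site d} {j : Fin d}

lemma SmallClusters.mono {M V M' V' : ℤ} (h : SmallClusters Q Λ A p a b M V) (hM : M ≤ M')
    (hV : V ≤ V') : SmallClusters Q Λ A p a b M' V' := by
  intro S hS T hc hist x hx y hy j
  have := h S hS T hc hist x hx y hy j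
  simp only at this ⊢
  split_ifs at this ⊢ <;> omega

lemma sign_mul_eq_iff {s u v : ℤ} (hs : s = 1 ∨ s = -1) : s * u = v ↔ u = s * v := by
  rcases hs with rfl | rfl <;> constructor <;> intro h <;> omega

/-- Without nucleation, the growth from a half-space advances at bounded speed. -/
lemma IsHistory.advance_le (hj : j ∉ A) {s : ℤ} (hs : s = 1 ∨ s = -1) {α V M : ℤ} (hV : 0 ≤ V)
    {J : ℕ} {θ : ℕ → ℝ} (hSΛ : S ⊆ Λ)
    (hG : ∀ i < J, SmallClusters Q Λ (insert j A)
      (Function.update p j (s * (α + 1 + i * (V + 1)))) (θ i) (θ (i + 1)) M V)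
    (hist : IsHistory Q (bdry (insert j A) (Function.update p j (s * (α + 1)))) (θ 0) b S T)
    (hα : ∀ x ∈ S, α < s * x j)
    (hfree : ∀ x ∈ S, α + 2 ≤ s * x j → A.card < bdry A p x + earlier S T x) :
    ∀ i ≤ J, ∀ x ∈ S, T x ≤ θ i → s * x j ≤ α + i * (V + 1) := by
  classical
  intro i
  induction i with
  | zero => exact fun _ x hx hT => absurd (hist x hx).1 (not_lt.2 hT)
  | succ i ih =>
    intro hiJ x hx hT
    have ih := ih (by omega)
    have hiD : (0 : ℤ) ≤ i * (V + 1) := by positivity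
    by_contra! hlt
    push_cast at hlt
    have hlt' : α + i * (V + 1) + (V + 1) < s * x j := by linarith
    set S' := S.filter fun y => θ i < T y ∧ T y ≤ θ (i + 1) ∧ α + i * (V + 1) < s * y j with hS'
    have hx' : x ∈ S' := by
      refine Finset.mem_filter.2 ⟨hx, ?_, hT, by omega⟩
      by_contra! hTi
      have := ih x hx hTi
      omega
    -- The component of `x` in what is added above the current level during window `i`. It is a
    -- history for the wall moved up to that level.
    set C := latticeComp S' x with hC
    have hCS' : C ⊆ S' := latticeComp_subset
    have hCS : C ⊆ S := hCS'.trans (Finset.filter_subset _ _)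
    -- an earlier neighbour outside of the component sits below the current level
    have hout : ∀ z ∈ C, ∀ y ∈ S, Neighbours z y → T y < T z → y ∉ C →
        y = Function.update z j (z j - s) ∧ s * z j = α + i * (V + 1) + 1 ∧
          1 ≤ i * (V + 1) := by
      intro z hz y hy hzy hTy hyC
      have hz' := (Finset.mem_filter.1 (hCS' hz)).2
      have hyj : s * y j ≤ α + i * (V + 1) := by
        by_contra! hyj
        refine hyC (mem_latticeComp_of_neighbours hz (Finset.mem_filter.2 ⟨hy, ?_, ?_, hyj⟩) hzy)
        · by_contra! hTi
          have := ih y hy hTi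
          omega
        · exact hTy.le.trans hz'.2.1
      have h1 := abs_le.1 (hzy.abs_sub_le j)
      have h2 := hα y hy
      have h3 := hz'.2.2
      have h4 : y j = z j - s := by rcases hs with rfl | rfl <;> omega
      refine ⟨hzy.eq_update h4 (by rcases hs with rfl | rfl <;> omega), ?_, by omega⟩
      rcases hs with rfl | rfl <;> omega
    have histC : IsHistory Q (bdry (insert j A)
        (Function.update p j (s * (α + 1 + i * (V + 1))))) (θ i) (θ (i + 1)) C T := by
      refine hist.restrict hCS (fun z hz => ?_) fun z hz => ?_
      · have := (Finset.mem_filter.1 (hCS' hz)).2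
        exact ⟨this.1, this.2.1⟩
      · have hz' := (Finset.mem_filter.1 (hCS' hz)).2.2.2
        rw [bdry_insert hj, bdry_insert hj]
        simp only [← sign_mul_eq_iff hs]
        -- In the lowest layer the new wall replaces the neighbour below, which may be lost. If `i =
        -- 0` the wall has not moved and no earlier neighbour is lost.
        by_cases hzj : s * z j = α + i * (V + 1) + 1
        · rw [if_pos (show s * z j = α + 1 + i * (V + 1) by omega)]
          by_cases hi : 1 ≤ i * (V + 1)
          · rw [if_neg (by omega)]
            have := earlier_le_add_one (S := S) (S' := C) (T := T) (x := z)
              (Function.update z j (z j - s)) fun y hy hzy hTy => by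
                by_cases hyC : y ∈ C
                · exact Or.inl hyC
                · exact Or.inr (hout z hz y hy hzy hTy hyC).1
            omega
          · have := earlier_le (S := S) (S' := C) (T := T) (x := z) fun y hy hzy hTy => by
              by_contra hyC
              exact hi (hout z hz y hy hzy hTy hyC).2.2
            split_ifs <;> omega
        · rw [if_neg (show ¬ s * z j = α + 1 by omega)]
          have := earlier_le (S := S) (S' := C) (T := T) (x := z) fun y hy hzy hTy => by
              by_contra hyC
              exact hzj (hout z hz y hy hzy hTy hyC).2.1
          omega
    have hspread := hG i (by omega) C (hCS.trans hSΛ) T latticeConn_latticeComp histC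
    have hxC : x ∈ C := self_mem_latticeComp hx'
    obtain ⟨z, hz, hzmin⟩ := C.exists_min_image T ⟨x, hxC⟩
    -- A component away from the lowest layer would start at a site without earlier neighbours,
    -- which is a nucleation excluded by `hfree`. So it touches that layer, and its height is
    -- bounded by the spread.
    have hbottom : ∃ y ∈ C, s * y j = α + i * (V + 1) + 1 := by
      by_contra! hno
      have h0 : earlier S T z = 0 := earlier_eq_zero fun y hy hzy hTy => by
        by_cases hyC : y ∈ C
        · exact absurd hTy (not_lt.2 (hzmin y hyC))
        · exact hno z hz (hout z hz y hy hzy hTy hyC).2.1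
      have h1 := hno z hz
      have h2 := (Finset.mem_filter.1 (hCS' hz)).2.2.2
      have h3 := hfree z (hCS hz) (by omega)
      have h4 := bdry_le A p z
      omega
    obtain ⟨y, hy, hyj⟩ := hbottom
    have h1 := hspread x hxC y hy j
    simp only [Finset.mem_insert_self, if_true] at h1
    have h1 := abs_le.1 h1
    rcases hs with rfl | rfl <;> omega

/-- A slab without nucleation that is filled from below in the direction `s` is thin. -/
lemma IsHistory.thickness_le (hj : j ∉ A) {s : ℤ} (hs : s = 1 ∨ s = -1) {α β V M : ℤ} (hV : 0 ≤ V)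
    (hAd : A.card ≤ d) {J : ℕ} {θ : ℕ → ℝ} (hSΛ : S ⊆ Λ)
    (hG : ∀ z ∈ Λ, ∀ i < J, SmallClusters Q Λ (insert j A)
      (Function.update p j (z j + s * (i * (V + 1)))) (θ i) (θ (i + 1)) M V)
    (hist : IsHistory Q (bdry A p) (θ 0) (θ J) S T)
    (hlayer : ∀ h, α < h → h ≤ β → ∃ x ∈ S, s * x j = h)
    (hfree : ∀ x ∈ S, α < s * x j → s * x j ≤ β → ¬ Q A.card x (T x))
    (hlast : ∀ h, α < h → h ≤ β → ∃ x ∈ S, s * x j = h ∧ ∀ y ∈ S, s * y j = β → T x ≤ T y) :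
    β ≤ α + 1 + J * (V + 1) := by
  classical
  by_contra! hlt
  have hJ : (0 : ℤ) ≤ J * (V + 1) := by positivity
  -- The site `z₀` in the first layer anchors the wall positions allowed in `hG`. The site `x` is
  -- occupied no later than any site of layer `β`, so until `T x` the slab is fed from below only.
  obtain ⟨z₀, hz₀, hz₀j⟩ := hlayer (α + 1) (by omega) (by omega)
  obtain ⟨x, hx, hxj, hxlast⟩ := hlast (β - 1) (by omega) (by omega)
  set S' := S.filter fun y => α < s * y j ∧ s * y j ≤ β - 1 ∧ T y ≤ T x with hS'
  have hout : ∀ z ∈ S', ∀ y ∈ S, Neighbours z y → T y < T z → y ∉ S' →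
      y = Function.update z j (z j - s) ∧ s * z j = α + 1 := by
    intro z hz y hy hzy hTy hyS'
    have hz' := (Finset.mem_filter.1 hz).2
    have h1 := abs_le.1 (hzy.abs_sub_le j)
    have hTyx : T y ≤ T x := hTy.le.trans hz'.2.2
    have h2 : s * y j ≠ β := fun h => absurd (hxlast y hy h)
      (not_le.2 (hTy.trans_le hz'.2.2))
    have h3 : ¬ (α < s * y j ∧ s * y j ≤ β - 1) := fun h =>
      hyS' (Finset.mem_filter.2 ⟨hy, h.1, h.2, hTyx⟩)
    have h4 : y j = z j - s := by rcases hs with rfl | rfl <;> omega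
    refine ⟨hzy.eq_update h4 (by rcases hs with rfl | rfl <;> omega), ?_⟩
    rcases hs with rfl | rfl <;> omega
  have hist' : IsHistory Q (bdry (insert j A) (Function.update p j (s * (α + 1)))) (θ 0) (θ J)
      S' T := by
    refine hist.restrict (Finset.filter_subset _ _) (fun z hz => ?_) fun z hz => ?_
    · have := hist z (Finset.mem_filter.1 hz).1
      exact ⟨this.1, this.2.1⟩
    · rw [bdry_insert hj]
      simp only [← sign_mul_eq_iff hs]
      by_cases hzj : s * z j = α + 1
      · have := earlier_le_add_one (S := S) (S' := S') (T := T) (x := z)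
          (Function.update z j (z j - s)) fun y hy hzy hTy => by
            by_cases hyS : y ∈ S'
            · exact Or.inl hyS
            · exact Or.inr (hout z hz y hy hzy hTy hyS).1
        rw [if_pos hzj]
        omega
      · have := earlier_le (S := S) (S' := S') (T := T) (x := z) fun y hy hzy hTy => by
          by_contra hyS
          exact hzj (hout z hz y hy hzy hTy hyS).2
        omega
  have hz₀' : z₀ j = s * (α + 1) := (sign_mul_eq_iff hs).1 hz₀j
  have := hist'.advance_le hj hs hV (J := J) (θ := θ) (M := M) (Λ := Λ)
    ((Finset.filter_subset _ _).trans hSΛ) (fun i hi => by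
      have := hG z₀ (hSΛ hz₀) i hi
      rwa [hz₀', ← mul_add] at this) (fun z hz => (Finset.mem_filter.1 hz).2.1)
    (fun z hz hzj => by
      have hz' := Finset.mem_filter.1 hz
      by_contra! hle
      change bdry A p z + earlier S' T z ≤ A.card at hle
      refine hfree z hz'.1 hz'.2.1 (by omega) ((hist z hz'.1).2.2 _ hAd ?_)
      have := earlier_le (S := S) (S' := S') (T := T) (x := z) fun y hy hzy hTy => by
          by_contra hyS
          have := (hout z hz y hy hzy hTy hyS).2
          omega
      omega) J le_rfl x (Finset.mem_filter.2 ⟨hx, by omega, by omega, le_rfl⟩) (hist x hx).2.1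
  omega

/-- A slab without nucleation that is crossed by a history is thin. -/
lemma IsHistory.free_slab_lt (hj : j ∉ A) {g V M : ℤ} {w : ℕ} (hV : 0 ≤ V) (hAd : A.card ≤ d)
    {J : ℕ} {θ : ℕ → ℝ} (hSΛ : S ⊆ Λ)
    (hG : ∀ s : ℤ, s = 1 ∨ s = -1 → ∀ z ∈ Λ, ∀ i < J, SmallClusters Q Λ (insert j A)
      (Function.update p j (z j + s * (i * (V + 1)))) (θ i) (θ (i + 1)) M V)
    (hist : IsHistory Q (bdry A p) (θ 0) (θ J) S T)
    (hlayer : ∀ h, g < h → h ≤ g + w → ∃ x ∈ S, x j = h)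
    (hfree : ∀ x ∈ S, g < x j → x j ≤ g + w → ¬ Q A.card x (T x)) :
    w < 2 * (J * (V + 1)) + 2 := by
  classical
  have hJ : (0 : ℤ) ≤ J * (V + 1) := by positivity
  by_contra! hw
  have hmin : ∀ h : ℤ, ∃ x : Site d, g < h → h ≤ g + w →
      x ∈ S ∧ x j = h ∧ ∀ y ∈ S, y j = h → T x ≤ T y := by
    intro h
    by_cases hh : g < h ∧ h ≤ g + w
    · obtain ⟨x, hx, hxmin⟩ := (S.filter fun x => x j = h).exists_min_image T
        (by obtain ⟨x, hx⟩ := hlayer h hh.1 hh.2; exact ⟨x, Finset.mem_filter.2 hx⟩)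
      rw [Finset.mem_filter] at hx
      exact ⟨x, fun _ _ => ⟨hx.1, hx.2, fun y hy hyj => hxmin y (Finset.mem_filter.2 ⟨hy, hyj⟩)⟩⟩
    · exact ⟨p, fun h1 h2 => absurd ⟨h1, h2⟩ hh⟩
  choose X hX using hmin
  -- The layer `k` is the last to be reached. It separates the slab into two parts, each filled from
  -- its own outer side, and `thickness_le` bounds both.
  obtain ⟨k, hk, hmax⟩ := (Finset.Ioc g (g + w)).exists_max_image (fun h => T (X h))
    ⟨g + 1, Finset.mem_Ioc.2 ⟨by omega, by omega⟩⟩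
  rw [Finset.mem_Ioc] at hk
  have hlast : ∀ h, g < h → h ≤ g + w → X h ∈ S ∧ X h j = h ∧
      ∀ y ∈ S, y j = k → T (X h) ≤ T y := fun h h1 h2 =>
    ⟨(hX h h1 h2).1, (hX h h1 h2).2.1, fun y hy hyj =>
      (hmax h (Finset.mem_Ioc.2 ⟨h1, h2⟩)).trans ((hX k hk.1 hk.2).2.2 y hy hyj)⟩
  have hright := hist.thickness_le (α := g) (β := k) hj (Or.inl rfl) hV hAd hSΛ (hG 1 (Or.inl rfl))
    (fun h h1 h2 => by simpa using hlayer h h1 (by omega))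
    (fun x hx h1 h2 => hfree x hx (by omega) (by omega))
    (fun h h1 h2 => by
      obtain ⟨h3, h4, h5⟩ := hlast h h1 (by omega)
      exact ⟨X h, h3, by omega, fun y hy hyj => h5 y hy (by omega)⟩)
  have hleft := hist.thickness_le (α := -(g + w + 1)) (β := -k) hj (Or.inr rfl) hV hAd hSΛ
    (hG (-1) (Or.inr rfl))
    (fun h h1 h2 => by
      obtain ⟨x, hx, hxj⟩ := hlayer (-h) (by omega) (by omega)
      exact ⟨x, hx, by omega⟩)
    (fun x hx h1 h2 => hfree x hx (by omega) (by omega))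
    (fun h h1 h2 => by
      obtain ⟨h3, h4, h5⟩ := hlast (-h) (by omega) (by omega)
      exact ⟨X (-h), h3, by omega, fun y hy hyj => h5 y hy (by omega)⟩)
  omega

open Classical in
/-- The sites of `Λ` in the box of radii `R` centred at `z` having a mark of rank `m` in the window
`(a, b]`. -/
noncomputable def marksNear (Q : ℕ → Site d → ℝ → Prop) (Λ : Finset (Site d)) (m : ℕ) (a b : ℝ)
    (R : Fin d → ℤ) (z : Site d) : Finset (Site d) :=
  Λ.filter fun x => (∀ j, |x j - z j| ≤ R j) ∧ ∃ t ∈ Set.Ioc a b, Q m x t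

lemma subset_marksNear [DecidablePred fun x => Q m x (T x)] {f : Site d → ℕ} (hSΛ : S ⊆ Λ)
    (hist : IsHistory Q f a b S T) {R : Fin d → ℤ} (hR : Spread R S) {z : Site d} (hz : z ∈ S) :
    (S.filter fun x => Q m x (T x)) ⊆ marksNear Q Λ m a b R z := by
  classical
  intro x hx
  rw [Finset.mem_filter] at hx
  exact Finset.mem_filter.2 ⟨hSΛ hx.1, fun j => hR x hx.1 z hz j, T x,
    ⟨(hist x hx.1).1, (hist x hx.1).2.1⟩, hx.2⟩

/-- Few marks of rank `|A|` and slow crossing of slabs give small clusters. -/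
lemma smallClusters_of_crossing {M V : ℤ} {K w J : ℕ} {θ : ℕ → ℝ} {V' M' : ℤ} (hV' : 0 ≤ V')
    (hAd : A.card ≤ d) (hV : V = 2 * K + 2) (hw : 2 * (J * (V' + 1)) + 2 ≤ w)
    (hM : (K + 1) * w ≤ M + 1) (hM0 : 0 ≤ M)
    (hK : ∀ z ∈ Λ, (marksNear Q Λ A.card (θ 0) (θ J)
      (fun j => 2 * (if j ∈ A then V else M) + 2) z).card ≤ K)
    (hG : ∀ j ∉ A, ∀ s : ℤ, s = 1 ∨ s = -1 → ∀ z ∈ Λ, ∀ i < J, SmallClusters Q Λ (insert j A)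
      (Function.update p j (z j + s * (i * (V' + 1)))) (θ i) (θ (i + 1)) M' V') :
    SmallClusters Q Λ A p (θ 0) (θ J) M V := by
  classical
  intro S hSΛ T hS hist
  refine spread_of_intermediate (Λ := Λ) _ (fun j => by split_ifs <;> omega) ?_ S hSΛ hS hist
  clear hSΛ hS hist S
  intro S hSΛ hS hist hspread
  have hcard : (S.filter fun x => Q A.card x (T x)).card ≤ K := by
    rcases S.eq_empty_or_nonempty with rfl | ⟨z, hz⟩
    · simp
    · exact (Finset.card_le_card (subset_marksNear hSΛ hist hspread hz)).trans (hK z (hSΛ hz))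
  suffices H : ∀ x ∈ S, ∀ y ∈ S, ∀ j, y j - x j ≤ if j ∈ A then V else M by
    intro x hx y hy j
    have h1 := H x hx y hy j
    have h2 := H y hy x hx j
    simp only
    rw [abs_le]; constructor <;> omega
  intro x hx y hy j
  split_ifs with hj
  · rw [hV]
    exact hist.extent_le hS hAd le_rfl (Or.inl hj) (by convert hcard) hx hy
  by_contra! hlt
  have hwpos : 0 < w := by
    have : (0 : ℤ) ≤ J * (V' + 1) := by positivity
    omega
  have hwz : (0 : ℤ) < w := by exact_mod_cast hwpos
  -- Pigeonhole: `K` marks cannot meet all of `K + 1` disjoint blocks of width `w`.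
  have hblock : ∃ i ∈ Finset.range (K + 1), ∀ z ∈ S, x j - 1 + i * w < z j →
      z j ≤ x j - 1 + i * w + w → ¬ Q A.card z (T z) := by
    by_contra! hno
    have hsurj : Set.SurjOn (fun z : Site d => ((z j - x j) / w).toNat)
        (S.filter fun x => Q A.card x (T x) : Finset (Site d)) (Finset.range (K + 1)) := by
      intro i hi
      obtain ⟨z, hz, h1, h2, hQ⟩ := hno i hi
      refine ⟨z, by simpa using ⟨hz, hQ⟩, ?_⟩
      have : (z j - x j) / w = i := by
        rw [Int.ediv_eq_iff_of_pos hwz]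
        constructor <;> linarith
      simp [this]
    have := Finset.card_le_card_of_surjOn _ hsurj
    rw [Finset.card_range] at this
    omega
  obtain ⟨i, hi, hfree⟩ := hblock
  rw [Finset.mem_range] at hi
  have hiw : (i : ℤ) * w + w ≤ (K + 1) * w := by
    have : (i : ℤ) + 1 ≤ K + 1 := by exact_mod_cast hi
    nlinarith
  have hi0 : (0 : ℤ) ≤ i * w := by positivity
  have := hist.free_slab_lt hj hV' hAd hSΛ (hG j hj)
    (fun h h1 h2 => hS.exists_layer hx hy (by omega) (by omega)) hfree
  omega

/-- Few marks of a rank greater than `|A|` give small clusters. -/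
lemma smallClusters_of_few_marks {V : ℤ} {K m : ℕ} (hm : m ≤ d) (hA : A.card ≤ m)
    (hj : ∀ j ∉ A, A.card + 1 ≤ m) (hV : V = 2 * K + 2)
    (hK : ∀ z ∈ Λ, (marksNear Q Λ m a b (fun _ => 2 * V + 2) z).card ≤ K) :
    SmallClusters Q Λ A p a b V V := by
  classical
  intro S hSΛ T hS hist
  simp only [ite_self]
  refine spread_of_intermediate (Λ := Λ) _ (fun j => by omega) ?_ S hSΛ hS hist
  clear hSΛ hS hist S
  intro S hSΛ hS hist hspread
  have hcard : (S.filter fun x => Q m x (T x)).card ≤ K := by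
    rcases S.eq_empty_or_nonempty with rfl | ⟨z, hz⟩
    · simp
    · exact (Finset.card_le_card (subset_marksNear hSΛ hist hspread hz)).trans (hK z (hSΛ hz))
  have H : ∀ x ∈ S, ∀ y ∈ S, ∀ j, y j - x j ≤ V := fun x hx y hy j => by
    rw [hV]
    refine hist.extent_le hS hm hA ?_ (by convert hcard) hx hy
    by_cases h : j ∈ A
    · exact Or.inl h
    · exact Or.inr (hj j h)
  intro x hx y hy j
  have h1 := H x hx y hy j
  have h2 := H y hy x hx j
  show |x j - y j| ≤ V
  rw [abs_le]; constructor <;> omega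

end Crossing

/-! ### Exponential estimates -/

lemma eventually_const_mul_exp_le (C : ℝ) {u v : ℝ} (h : u < v) :
    ∀ᶠ β : ℝ in atTop, C * Real.exp (β * u) ≤ Real.exp (β * v) := by
  have h1 : Tendsto (fun β : ℝ => Real.exp (β * (v - u))) atTop atTop :=
    Real.tendsto_exp_atTop.comp (tendsto_id.atTop_mul_const (sub_pos.2 h))
  filter_upwards [h1.eventually_ge_atTop C] with β hβ
  calc C * Real.exp (β * u) ≤ Real.exp (β * (v - u)) * Real.exp (β * u) :=
        mul_le_mul_of_nonneg_right hβ (Real.exp_pos _).le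
    _ = _ := by rw [← Real.exp_add]; ring_nf

lemma eventually_const_le_exp (C : ℝ) {v : ℝ} (h : 0 < v) :
    ∀ᶠ β : ℝ in atTop, C ≤ Real.exp (β * v) := by
  simpa using eventually_const_mul_exp_le C h

namespace RateHypothesis

variable {d : ℕ} {c : ℝ → ℕ → ℝ} {Γ : ℕ → ℝ}

lemma eventually_le (hc : RateHypothesis d c Γ) {n : ℕ} (hn : n ≤ d) {ε : ℝ} (hε : 0 < ε) :
    ∀ᶠ β in atTop, c β (d - n) ≤ Real.exp (β * (-Γ n + ε)) := by
  have h := hc.lim_low (d - n) (Nat.sub_le _ _)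
  rw [Nat.sub_sub_self hn] at h
  filter_upwards [h.eventually_lt_const (show -Γ n < -Γ n + ε by linarith),
    eventually_gt_atTop 0] with β hβ h0
  rw [← Real.log_le_iff_le_exp (hc.pos β h0 _ (by omega))]
  rw [one_div, inv_mul_lt_iff₀ h0] at hβ
  exact hβ.le

lemma eventually_ge (hc : RateHypothesis d c Γ) {n : ℕ} (hn : n ≤ d) {ε : ℝ} (hε : 0 < ε) :
    ∀ᶠ β in atTop, Real.exp (β * (-Γ n - ε)) ≤ c β (d - n) := by
  have h := hc.lim_low (d - n) (Nat.sub_le _ _)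
  rw [Nat.sub_sub_self hn] at h
  filter_upwards [h.eventually_const_lt (show -Γ n - ε < -Γ n by linarith),
    eventually_gt_atTop 0] with β hβ h0
  rw [← Real.le_log_iff_exp_le (hc.pos β h0 _ (by omega))]
  rw [one_div, lt_inv_mul_iff₀ h0] at hβ
  exact hβ.le

/-- The two asymptotic hypotheses overlap at `n = d`. -/
lemma energy_zero (hc : RateHypothesis d c Γ) : Γ 0 = 0 := by
  have h1 := hc.lim_low d le_rfl
  have h2 := hc.lim_high d le_rfl (by omega)
  rw [Nat.sub_self] at h1
  linarith [tendsto_nhds_unique h1 h2]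

lemma energy_nonneg (hc : RateHypothesis d c Γ) {n : ℕ} (hn : n ≤ d) : 0 ≤ Γ n :=
  hc.energy_zero ▸ hc.energy_mono 0 n (Nat.zero_le _) hn

lemma criticalConstant_le (hc : RateHypothesis d c Γ) {n : ℕ} (hn : n ≤ d) :
    criticalConstant Γ n ≤ Γ n := by
  induction n with
  | zero => exact le_rfl
  | succ n ih =>
    have h1 := ih (by omega)
    have h2 := hc.energy_mono n (n + 1) (by omega) hn
    rw [criticalConstant]
    refine max_le h2 ((div_le_iff₀ (by positivity)).2 ?_)
    have h3 : ((n + 1 : ℕ) : ℝ) * criticalConstant Γ n ≤ ((n + 1 : ℕ) : ℝ) * Γ (n + 1) :=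
      mul_le_mul_of_nonneg_left (h1.trans h2) (by positivity)
    linarith

end RateHypothesis

/-! ### The union bounds for the slow regime -/

lemma measure_exists_mem_le {Ω ι : Type*} [MeasurableSpace Ω] (P : Measure Ω) (s : Finset ι)
    (E : ι → Ω → Prop) (q : ℝ≥0∞) (h : ∀ i ∈ s, P {ω | E i ω} ≤ q) :
    P {ω | ∃ i ∈ s, E i ω} ≤ s.card * q := by
  have e : {ω | ∃ i ∈ s, E i ω} = ⋃ i ∈ s, {ω | E i ω} := by ext; simp
  rw [e, ← nsmul_eq_mul]
  exact (measure_biUnion_finset_le s _).trans (Finset.sum_le_card_nsmul _ _ _ h)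

/-- The box of radii `R` centred at `z`. -/
noncomputable def boxAround {d : ℕ} (R : Fin d → ℤ) (z : Site d) : Finset (Site d) :=
  Fintype.piFinset fun j => Finset.Icc (z j - R j) (z j + R j)

lemma mem_boxAround {d : ℕ} {R : Fin d → ℤ} {z x : Site d} :
    x ∈ boxAround R z ↔ ∀ j, |x j - z j| ≤ R j := by
  simp only [boxAround, Fintype.mem_piFinset, Finset.mem_Icc, abs_le]
  exact forall_congr' fun j => ⟨fun h => ⟨by linarith, by linarith⟩,
    fun h => ⟨by linarith, by linarith⟩⟩

lemma card_boxAround {d : ℕ} {R : Fin d → ℤ} (hR : ∀ j, 0 ≤ R j) (z : Site d) :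
    ((boxAround R z).card : ℝ) = ∏ j, (2 * (R j : ℝ) + 1) := by
  rw [boxAround, Fintype.card_piFinset, Nat.cast_prod]
  refine Finset.prod_congr rfl fun j _ => ?_
  rw [Int.card_Icc, show z j + R j + 1 - (z j - R j) = 2 * R j + 1 by ring]
  have : (((2 * R j + 1).toNat : ℤ) : ℝ) = ((2 * R j + 1 : ℤ) : ℝ) := by
    rw [Int.toNat_of_nonneg (by have := hR j; omega)]
  exact_mod_cast this

section Marks

variable {Ω : Type*} [MeasurableSpace Ω] {P : Measure Ω} [IsProbabilityMeasure P] {d : ℕ}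
  {W U : Site d → ℕ → Ω → ℝ}

/-- Union bound over the centres `z` and over the sets of `K + 1` sites in a box; marks at distinct
sites are independent. -/
lemma measure_exists_marksNear_le (hWU : IsGraphicalFamily P W U) (Λ : Finset (Site d))
    {c : ℕ → ℝ} {m K : ℕ} (hcm : 0 ≤ c m) {a b : ℝ} (hab : a ≤ b) {R : Fin d → ℤ}
    {N : ℝ} (hN : ∀ z, ((boxAround R z).card : ℝ) ≤ N) :
    P {ω | ∃ z ∈ Λ, K < (marksNear (fun m => HasMark (W · · ω) (U · · ω) (c m)) Λ m a b R z).card}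
      ≤ ENNReal.ofReal (Λ.card * (N * (c m * (b - a))) ^ (K + 1)) := by
  have hba : 0 ≤ b - a := sub_nonneg.2 hab
  have key : ∀ z ∈ Λ, P {ω | K < (marksNear (fun m => HasMark (W · · ω) (U · · ω) (c m)) Λ m a b
      R z).card} ≤ ENNReal.ofReal ((N * (c m * (b - a))) ^ (K + 1)) := by
    intro z _
    have hN0 : 0 ≤ N := (Nat.cast_nonneg _).trans (hN z)
    calc _ ≤ P {ω | ∃ S ∈ (boxAround R z).powersetCard (K + 1),
          ∀ x ∈ S, HasMarkIn (W · · ω) (U · · ω) (c m) x a b} := by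
          classical
          refine measure_mono fun ω hω => ?_
          obtain ⟨S, hS, hcard⟩ := Finset.exists_subset_card_eq (Nat.succ_le_of_lt hω)
          have hS' := fun x (hx : x ∈ S) => (Finset.mem_filter.1 (hS hx)).2
          exact ⟨S, Finset.mem_powersetCard.2 ⟨fun x hx => mem_boxAround.2 (hS' x hx).1, hcard⟩,
            fun x hx => (hS' x hx).2⟩
      _ ≤ ((boxAround R z).powersetCard (K + 1)).card *
          ENNReal.ofReal (c m * (b - a)) ^ (K + 1) := by
          refine measure_exists_mem_le P _ _ _ fun S hS => ?_
          rw [← (Finset.mem_powersetCard.1 hS).2]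
          exact hWU.measure_forall_hasMarkIn_le hcm hab S
      _ ≤ ENNReal.ofReal N ^ (K + 1) * ENNReal.ofReal (c m * (b - a)) ^ (K + 1) := by
          gcongr
          rw [Finset.card_powersetCard]
          calc (((boxAround R z).card.choose (K + 1) : ℕ) : ℝ≥0∞)
              ≤ (((boxAround R z).card ^ (K + 1) : ℕ) : ℝ≥0∞) :=
                Nat.cast_le.2 (Nat.choose_le_pow _ _)
            _ = ENNReal.ofReal ((boxAround R z).card : ℝ) ^ (K + 1) := by
                rw [ENNReal.ofReal_natCast]; push_cast; rfl
            _ ≤ _ := by gcongr; exact hN z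
      _ = _ := by
          rw [← mul_pow, ← ENNReal.ofReal_mul hN0, ENNReal.ofReal_pow (by positivity)]
  refine (measure_exists_mem_le P Λ _ _ key).trans ?_
  rw [ENNReal.ofReal_mul (Nat.cast_nonneg _), ENNReal.ofReal_natCast]

/-- When the expected number of marks in a box is exponentially small, a bounded `K` makes the power
`K + 1` beat the number of centres and any prescribed exponential. -/
lemma measure_exists_marksNear_le_exp (hWU : IsGraphicalFamily P W U) {Λ : Finset (Site d)}
    {c : ℕ → ℝ} {m K : ℕ} (hcm : 0 ≤ c m) {a b : ℝ} (hab : a ≤ b) {R : Fin d → ℤ}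
    {N β δ B L : ℝ} (hN : ∀ z, ((boxAround R z).card : ℝ) ≤ N) (hβ : 0 ≤ β)
    (hδ : N * (c m * (b - a)) ≤ Real.exp (-(β * δ))) (hΛ : (Λ.card : ℝ) ≤ Real.exp (β * L))
    (hK : B + L ≤ (K + 1) * δ) :
    P {ω | ∃ z ∈ Λ, K < (marksNear (fun m => HasMark (W · · ω) (U · · ω) (c m)) Λ m a b R z).card}
      ≤ ENNReal.ofReal (Real.exp (-(β * B))) := by
  refine (measure_exists_marksNear_le hWU Λ hcm hab hN).trans (ENNReal.ofReal_le_ofReal ?_)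
  have hN0 : 0 ≤ N := (Nat.cast_nonneg _).trans (hN 0)
  have h0 : 0 ≤ N * (c m * (b - a)) :=
    mul_nonneg hN0 (mul_nonneg hcm (sub_nonneg.2 hab))
  calc _ ≤ Real.exp (β * L) * Real.exp (-(β * δ)) ^ (K + 1) :=
        mul_le_mul hΛ (pow_le_pow_left₀ h0 hδ _) (pow_nonneg h0 _) (Real.exp_pos _).le
    _ = Real.exp (β * L + ((K + 1 : ℕ) : ℝ) * (-(β * δ))) := by
        rw [← Real.exp_nat_mul, ← Real.exp_add]
    _ ≤ _ := by
        rw [Real.exp_le_exp]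
        push_cast
        nlinarith [mul_le_mul_of_nonneg_left hK hβ]

end Marks

/-! ### Induction on the number of free directions -/

section SmallClustersLikely

variable {Ω : Type*} [MeasurableSpace Ω] {P : Measure Ω} [IsProbabilityMeasure P] {d : ℕ}
  {W U : Site d → ℕ → Ω → ℝ} {c : ℝ → ℕ → ℝ} {Γ : ℕ → ℝ}

/-- For `n` free directions and windows of length `exp (β κ)`, except with a probability smaller
than any given exponential, the clusters have a bounded extension in the directions of the boundary
condition, and an extension at most `exp (β l)` in the free directions, where boxes of this size
are too small for a nucleation to be likely. -/
def SmallClustersLikely (P : Measure Ω) (W U : Site d → ℕ → Ω → ℝ) (c : ℝ → ℕ → ℝ) (Γ : ℕ → ℝ)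
    (n : ℕ) (κ : ℝ) : Prop :=
  ∃ l : ℝ, 0 < l ∧ n * l + κ < Γ n ∧ ∀ B L : ℝ, ∃ V : ℤ, 0 ≤ V ∧ ∀ᶠ β in atTop,
    ∀ (A : Finset (Fin d)) (p : Site d) (a b : ℝ) (Λ : Finset (Site d)), A.card = d - n → a ≤ b →
      b - a ≤ Real.exp (β * κ) → (Λ.card : ℝ) ≤ Real.exp (β * L) →
      P {ω | ¬ SmallClusters (fun m => HasMark (W · · ω) (U · · ω) (c β m)) Λ A p a b
        ⌊Real.exp (β * l)⌋ V} ≤ ENNReal.ofReal (Real.exp (-(β * B)))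

/-- The case where even the marks of the next rank are rare. -/
lemma smallClustersLikely_of_rare (hWU : IsGraphicalFamily P W U) (hc : RateHypothesis d c Γ)
    {n k : ℕ} (hn : n ≤ d) (hkn : k ≤ n) (hk : n = 0 ∨ k < n) {κ : ℝ} (hκ : κ < Γ k) :
    SmallClustersLikely P W U c Γ n κ := by
  have hΓ := hc.energy_mono k n hkn hn
  have hn0 : (0 : ℝ) ≤ n := Nat.cast_nonneg n
  -- Clusters are bounded in all directions here, so any positive `l` with `n l + κ < Γ n` will do.
  refine ⟨(Γ n - κ) / (2 * (n + 1)), div_pos (by linarith) (by positivity), ?_, fun B L => ?_⟩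
  · have : (n : ℝ) * ((Γ n - κ) / (2 * (n + 1))) ≤ (Γ n - κ) / 2 := by
      rw [mul_div_assoc', div_le_div_iff₀ (by positivity) (by positivity)]
      nlinarith
    linarith
  set l := (Γ n - κ) / (2 * (n + 1)) with hl
  have hlpos : 0 < l := div_pos (by linarith) (by positivity)
  set ε := (Γ k - κ) / 2 with hε
  have hεpos : 0 < ε := by rw [hε]; linarith
  obtain ⟨K, hK⟩ := exists_nat_ge ((B + L) / (ε / 2))
  have hK' : B + L ≤ (K + 1) * (ε / 2) := by
    rw [div_le_iff₀ (by positivity)] at hK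
    linarith
  set V : ℤ := 2 * K + 2 with hV
  have hV0 : 0 ≤ V := by omega
  refine ⟨V, hV0, ?_⟩
  set N : ℝ := (2 * ((2 * V + 2 : ℤ) : ℝ) + 1) ^ d with hN
  filter_upwards [hc.eventually_le (hkn.trans hn) hεpos, eventually_gt_atTop 0,
    eventually_const_le_exp V hlpos, eventually_const_mul_exp_le N (u := -ε) (v := -(ε / 2))
      (by linarith)] with β hrate hβ hVM hNβ
  intro A p a b Λ hA hab hlen hΛ
  have hcpos := (hc.pos β hβ (d - k) (by omega)).le
  have hmarks := measure_exists_marksNear_le_exp hWU (Λ := Λ) (c := c β) (m := d - k) (K := K)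
    hcpos hab (R := fun _ => 2 * V + 2) (N := N) (β := β) (δ := ε / 2) (B := B) (L := L)
    (fun z => by rw [card_boxAround (fun _ => by omega)]; simp [hN]) hβ.le ?_ hΛ hK'
  · refine (measure_mono fun ω hω => ?_).trans hmarks
    by_contra hno
    refine hω ((smallClusters_of_few_marks (m := d - k) (K := K) (V := V) (by omega) (by omega)
      (fun j hj => ?_) hV fun z hz => ?_).mono (Int.le_floor.2 hVM) le_rfl)
    · rcases hk with rfl | hk
      · have : A = Finset.univ := (Finset.card_eq_iff_eq_univ A).1 (by simpa using hA)
        simp [this] at hj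
      · omega
    · by_contra! hlt
      exact hno ⟨z, hz, hlt⟩
  · have hba : 0 ≤ b - a := sub_nonneg.2 hab
    have hN0 : 0 ≤ N := by positivity
    calc N * (c β (d - k) * (b - a)) ≤ N * (Real.exp (β * (-Γ k + ε)) * Real.exp (β * κ)) := by
          gcongr
      _ = N * Real.exp (β * -ε) := by
          rw [← Real.exp_add, hε]; ring_nf
      _ ≤ _ := by rw [← mul_neg]; exact hNβ

lemma card_crossing_index_le (Λ : Finset (Site d)) (A : Finset (Fin d)) (J : ℕ) :
    (((Aᶜ ×ˢ ({1, -1} : Finset ℤ)) ×ˢ (Λ ×ˢ Finset.range J)).card : ℝ) ≤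
      2 * d * (Λ.card * J) := by
  rw [Finset.card_product, Finset.card_product, Finset.card_product, Finset.card_range]
  have h1 : (Aᶜ.card : ℝ) ≤ d := by
    exact_mod_cast (Finset.card_le_univ _).trans_eq (Fintype.card_fin d)
  have h2 : ((({1, -1} : Finset ℤ)).card : ℝ) = 2 := by norm_num
  push_cast
  rw [h2]
  have : (0 : ℝ) ≤ Λ.card * J := by positivity
  nlinarith

set_option maxHeartbeats 1000000 in
/-- The inductive step, where the time is long compared to the growth of the faces. -/
lemma smallClustersLikely_succ (hWU : IsGraphicalFamily P W U) (hc : RateHypothesis d c Γ)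
    {n : ℕ} (hn : n + 1 ≤ d) {κ κn : ℝ}
    (ih : ∀ κ' < κn, SmallClustersLikely P W U c Γ n κ')
    (hκn : κn ≤ Γ (n + 1)) (hκ : κ < (Γ (n + 1) + (n + 1 : ℕ) * κn) / ((n + 1 : ℕ) + 1)) :
    SmallClustersLikely P W U c Γ (n + 1) κ := by
  set n' : ℝ := ((n + 1 : ℕ) : ℝ) with hn'
  have hn'pos : 0 < n' := by positivity
  rw [lt_div_iff₀ (by positivity)] at hκ
  have hκΓ : κ < Γ (n + 1) := by nlinarith
  -- The upper bound makes nucleations rare in boxes of size `exp (β l)`; the lower bound makes such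
  -- boxes too long to be crossed. The interval is nonempty exactly by the assumption on `κ`,
  -- together with `κ < Γ (n + 1)`.
  obtain ⟨l, hl1, hl2⟩ : ∃ l, max 0 (κ - κn) < l ∧ l < (Γ (n + 1) - κ) / n' := by
    refine exists_between (max_lt (div_pos (by linarith) hn'pos) ?_)
    rw [lt_div_iff₀ hn'pos]
    linarith
  have hlpos : 0 < l := (le_max_left _ _).trans_lt hl1
  have hlκ : κ - κn < l := (le_max_right _ _).trans_lt hl1
  rw [lt_div_iff₀ hn'pos] at hl2
  refine ⟨l, hlpos, by linarith, fun B L => ?_⟩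
  -- A time exponent below `κn`, so that the induction hypothesis applies, but above `κ - l`, so
  -- that the number `exp (β (κ - κ'))` of subwindows is smaller than `exp (β l)`.
  set κ' := min κ ((κn + (κ - l)) / 2) with hκ'
  have hκ'n : κ' < κn := (min_le_right _ _).trans_lt (by linarith)
  have hκ'κ : κ' ≤ κ := min_le_left _ _
  have hκ'l : κ - κ' < l := by
    rcases min_choice κ ((κn + (κ - l)) / 2) with h | h
    · rw [hκ', h]; linarith
    · rw [hκ', h]; linarith
  -- Only the bounded extension `V'` across the walls is needed from the previous case, not the
  -- extension along them. The extra exponent `L + (κ - κ' + 1)` pays for the number of walls and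
  -- subwindows.
  obtain ⟨l', -, -, ih'⟩ := ih κ' hκ'n
  obtain ⟨V', hV'0, ih''⟩ := ih' (B + 1 + (L + (κ - κ' + 1))) L
  set δ := Γ (n + 1) - κ - n' * l with hδ
  have hδpos : 0 < δ := by rw [hδ]; linarith
  obtain ⟨K, hK⟩ := exists_nat_ge ((B + 1 + L) / (δ / 4))
  have hK' : B + 1 + L ≤ (K + 1) * (δ / 4) := by
    rw [div_le_iff₀ (by positivity)] at hK
    linarith
  set V : ℤ := 2 * K + 2 with hV
  refine ⟨V, by omega, ?_⟩
  -- A box of radii `2 V + 2` or `2 M + 2` has sides `4 V + 5` or `4 M + 5`, and the latter is at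
  -- most `9 exp (β l)`.
  set N : ℝ := (4 * (V : ℝ) + 5) ^ d * 9 ^ (n + 1) with hN
  have hV0 : 0 ≤ V := by omega
  have hVR : (0 : ℝ) ≤ V := by exact_mod_cast hV0
  filter_upwards [hc.eventually_le hn (show 0 < δ / 2 by positivity), eventually_gt_atTop 0,
    eventually_const_mul_exp_le N (u := -(δ / 2)) (v := -(δ / 4)) (by linarith), ih'',
    eventually_const_mul_exp_le (2 * ((K + 1) * (4 * (V' + 1) + 2))) hκ'l,
    eventually_const_mul_exp_le (4 * d) (show κ - κ' < κ - κ' + 1 by linarith),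
    eventually_const_le_exp 2 one_pos] with β hrate hβ hNβ hG hM hd h2
  intro A p a b Λ hA hab hlen hΛ
  set m := A.card with hm
  have hmd : d - (n + 1) = m := hA.symm
  rw [hmd] at hrate
  have hcpos : 0 ≤ c β m := (hc.pos β hβ m (by omega)).le
  set E := Real.exp (β * (κ - κ')) with hE
  have hE1 : 1 ≤ E := Real.one_le_exp (mul_nonneg hβ.le (by linarith))
  set J := ⌈E⌉₊ with hJ
  have hJE : E ≤ J := Nat.le_ceil _
  have hJE2 : (J : ℝ) ≤ 2 * E := by linarith [(Nat.ceil_lt_add_one (zero_le_one.trans hE1)).le]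
  have hJpos : (0 : ℝ) < J := by linarith
  set M := ⌊Real.exp (β * l)⌋ with hMdef
  have hel : 1 ≤ Real.exp (β * l) := Real.one_le_exp (mul_nonneg hβ.le hlpos.le)
  have hM0 : 0 ≤ M := Int.floor_nonneg.2 (Real.exp_pos _).le
  have hMle : (M : ℝ) ≤ Real.exp (β * l) := Int.floor_le _
  have hMlt : Real.exp (β * l) < M + 1 := Int.lt_floor_add_one _
  -- The smallest width which `free_slab_lt` rules out after `J` subwindows.
  set w : ℕ := (2 * (J * (V' + 1)) + 2).toNat with hw
  have hwz : (w : ℤ) = 2 * (J * (V' + 1)) + 2 := Int.toNat_of_nonneg (by positivity)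
  have hV'R : (0 : ℝ) ≤ V' := by exact_mod_cast hV'0
  have hKw : ((K : ℤ) + 1) * w ≤ M + 1 := by
    have hwR : (w : ℝ) = 2 * (J * (V' + 1)) + 2 := by exact_mod_cast hwz
    have h1 : (w : ℝ) ≤ (4 * (V' + 1) + 2) * E := by
      rw [hwR]
      have := mul_le_mul_of_nonneg_right hJE2 (show (0 : ℝ) ≤ V' + 1 by linarith)
      linarith only [this, hE1]
    have h3 : ((K : ℝ) + 1) * w ≤ M + 1 := by
      have h4 : ((K : ℝ) + 1) * w ≤ (K + 1) * ((4 * (V' + 1) + 2) * E) :=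
        mul_le_mul_of_nonneg_left h1 (by positivity)
      have h5 : (0 : ℝ) ≤ (K + 1) * ((4 * (V' + 1) + 2) * E) := by positivity
      calc ((K : ℝ) + 1) * w ≤ 2 * ((K + 1) * (4 * (V' + 1) + 2)) * E := by
            rw [mul_assoc 2, mul_assoc ((K : ℝ) + 1)]; linarith only [h4, h5]
        _ ≤ Real.exp (β * l) := hM
        _ ≤ M + 1 := hMlt.le
    exact_mod_cast h3
  set θ : ℕ → ℝ := fun i => a + i * ((b - a) / J) with hθ
  have hθ0 : θ 0 = a := by simp [hθ]
  have hθJ : θ J = b := by simp only [hθ]; field_simp; ring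
  have hba : 0 ≤ b - a := sub_nonneg.2 hab
  have hθs : ∀ i, θ (i + 1) - θ i = (b - a) / J := fun i => by simp only [hθ]; push_cast; ring
  have hθlen : (b - a) / J ≤ Real.exp (β * κ') := by
    rw [div_le_iff₀ hJpos]
    calc b - a ≤ Real.exp (β * κ) := hlen
      _ = Real.exp (β * κ') * E := by rw [hE, ← Real.exp_add]; ring_nf
      _ ≤ _ := by gcongr
  set R : Fin d → ℤ := fun j => 2 * (if j ∈ A then V else M) + 2 with hR
  have hbox : ∀ z, ((boxAround R z).card : ℝ) ≤
      (4 * (V : ℝ) + 5) ^ d * (9 * Real.exp (β * l)) ^ (n + 1) := by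
    intro z
    rw [card_boxAround (fun j => by simp only [hR]; split_ifs <;> omega),
      ← Finset.prod_mul_prod_compl A]
    have h1 : ∏ j ∈ A, (2 * (R j : ℝ) + 1) = (4 * (V : ℝ) + 5) ^ m := by
      rw [hm, ← Finset.prod_const]
      refine Finset.prod_congr rfl fun j hj => ?_
      simp only [hR, hj, if_true]
      push_cast; ring
    have h2 : ∏ j ∈ Aᶜ, (2 * (R j : ℝ) + 1) = (4 * (M : ℝ) + 5) ^ (n + 1) := by
      have hcard : Aᶜ.card = n + 1 := by
        rw [Finset.card_compl, Fintype.card_fin]; omega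
      rw [← hcard, ← Finset.prod_const]
      refine Finset.prod_congr rfl fun j hj => ?_
      simp only [hR, Finset.mem_compl.1 hj, if_false]
      push_cast; ring
    rw [h1, h2]
    have hMR : (0 : ℝ) ≤ M := by exact_mod_cast hM0
    gcongr
    · linarith
    · omega
    · linarith
  have hmarks := measure_exists_marksNear_le_exp hWU (Λ := Λ) (c := c β) (m := m) (K := K)
    hcpos hab (R := R) (β := β) (δ := δ / 4) (B := B + 1) (L := L) hbox hβ.le ?_ hΛ hK'
  · have hcross : P {ω | ∃ i ∈ (Aᶜ ×ˢ ({1, -1} : Finset ℤ)) ×ˢ (Λ ×ˢ Finset.range J),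
        ¬ SmallClusters (fun m => HasMark (W · · ω) (U · · ω) (c β m)) Λ (insert i.1.1 A)
          (Function.update p i.1.1 (i.2.1 i.1.1 + i.1.2 * (i.2.2 * (V' + 1)))) (θ i.2.2)
          (θ (i.2.2 + 1)) ⌊Real.exp (β * l')⌋ V'} ≤
        ENNReal.ofReal (Real.exp (-(β * (B + 1)))) := by
      refine (measure_exists_mem_le P _ _
        (ENNReal.ofReal (Real.exp (-(β * (B + 1 + (L + (κ - κ' + 1))))))) fun i hi => ?_).trans ?_
      · simp only [Finset.mem_product, Finset.mem_compl] at hi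
        refine hG _ _ _ _ Λ ?_ ?_ ?_ hΛ
        · rw [Finset.card_insert_of_notMem hi.1.1]; omega
        · have := hθs i.2.2
          have h0 : 0 ≤ (b - a) / J := by positivity
          linarith
        · rw [hθs]; exact hθlen
      · rw [← ENNReal.ofReal_natCast, ← ENNReal.ofReal_mul (Nat.cast_nonneg _)]
        refine ENNReal.ofReal_le_ofReal ?_
        have h3 : (((Aᶜ ×ˢ ({1, -1} : Finset ℤ)) ×ˢ (Λ ×ˢ Finset.range J)).card : ℝ) ≤
            Real.exp (β * (L + (κ - κ' + 1))) := by
          refine (card_crossing_index_le Λ A J).trans ?_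
          calc 2 * (d : ℝ) * (Λ.card * J) ≤ 2 * d * (Real.exp (β * L) * (2 * E)) := by gcongr
            _ = Real.exp (β * L) * (4 * d * E) := by ring
            _ ≤ Real.exp (β * L) * Real.exp (β * (κ - κ' + 1)) := by gcongr
            _ = _ := by rw [← Real.exp_add]; ring_nf
        calc _ ≤ Real.exp (β * (L + (κ - κ' + 1))) *
              Real.exp (-(β * (B + 1 + (L + (κ - κ' + 1))))) := by gcongr
          _ = _ := by rw [← Real.exp_add]; ring_nf
    calc _ ≤ _ := measure_mono (t := _ ∪ _) fun ω hω => ?_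
      _ ≤ _ := measure_union_le _ _
      _ ≤ _ := add_le_add hmarks hcross
      _ = ENNReal.ofReal (2 * Real.exp (-(β * (B + 1)))) := by
          rw [← ENNReal.ofReal_add (Real.exp_pos _).le (Real.exp_pos _).le, two_mul]
      _ ≤ _ := by
          refine ENNReal.ofReal_le_ofReal ?_
          calc _ ≤ Real.exp (β * 1) * Real.exp (-(β * (B + 1))) := by gcongr
            _ = _ := by rw [← Real.exp_add]; ring_nf
    by_contra hno
    refine hω ?_
    rw [Set.mem_union, not_or] at hno
    have h1 := hno.1
    have h2 := hno.2
    simp only [Set.mem_ofPred_eq, not_exists, not_and, not_lt, not_not] at h1 h2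
    rw [← hθ0, ← hθJ] at h1 ⊢
    refine smallClusters_of_crossing (K := K) (w := w) (J := J)
      (M' := ⌊Real.exp (β * l')⌋) hV'0 (by omega) hV hwz.ge hKw hM0
      h1 fun j hj s hs z hz i hi => ?_
    refine h2 ((j, s), (z, i)) ?_
    simp only [Finset.mem_product, Finset.mem_compl, Finset.mem_insert, Finset.mem_singleton,
      Finset.mem_range]
    exact ⟨⟨hj, hs⟩, hz, hi⟩
  · calc _ ≤ (4 * (V : ℝ) + 5) ^ d * (9 * Real.exp (β * l)) ^ (n + 1) *
          (Real.exp (β * (-Γ (n + 1) + δ / 2)) * Real.exp (β * κ)) := by gcongr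
      _ = N * Real.exp (β * -(δ / 2)) := by
          have e : Real.exp (β * l) ^ (n + 1) * (Real.exp (β * (-Γ (n + 1) + δ / 2)) *
              Real.exp (β * κ)) = Real.exp (β * -(δ / 2)) := by
            rw [← Real.exp_nat_mul, ← Real.exp_add, ← Real.exp_add, ← hn']
            congr 1
            linear_combination (-β) * hδ
          rw [hN, mul_pow, ← e]
          ring
      _ ≤ _ := by rw [← mul_neg]; exact hNβ

theorem smallClustersLikely (hWU : IsGraphicalFamily P W U) (hc : RateHypothesis d c Γ)
    {n : ℕ} (hn : n ≤ d) : ∀ κ < criticalConstant Γ n, SmallClustersLikely P W U c Γ n κ := by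
  induction n with
  | zero => exact fun κ hκ => smallClustersLikely_of_rare hWU hc hn le_rfl (Or.inl rfl) hκ
  | succ n ih =>
    intro κ hκ
    rw [criticalConstant] at hκ
    rcases lt_max_iff.1 hκ with hκ | hκ
    · exact smallClustersLikely_of_rare hWU hc hn (Nat.le_succ n) (Or.inr (Nat.lt_succ_self n)) hκ
    · exact smallClustersLikely_succ hWU hc hn (ih (by omega))
        ((hc.criticalConstant_le (by omega)).trans (hc.energy_mono n (n + 1) (by omega) hn)) hκ

end SmallClustersLikely

/-! ### The slow regime -/

lemma log_div_le {q : ℝ≥0∞} {β r : ℝ} (hβ : 0 < β)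
    (h : q ≤ ENNReal.ofReal (Real.exp (-(β * r)))) :
    ENNReal.log q / (β : EReal) ≤ ((-r : ℝ) : EReal) := by
  have h1 : ENNReal.log q ≤ ((-(β * r) : ℝ) : EReal) := by
    refine (ENNReal.log_monotone h).trans_eq ?_
    rw [ENNReal.log_ofReal_of_pos (Real.exp_pos _), Real.log_exp]
  refine (EReal.div_le_div_right_of_nonneg (by exact_mod_cast hβ.le) h1).trans_eq ?_
  rw [← EReal.coe_div]
  congr 1
  field_simp

lemma exponentiallySmall_of_le {q : ℝ → ℝ≥0∞} {δ : ℝ} (hδ : 0 < δ)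
    (h : ∀ᶠ β in atTop, q β ≤ ENNReal.ofReal (Real.exp (-(β * δ)))) :
    Tendsto q atTop (𝓝 0) ∧ ExponentiallySmall q := by
  constructor
  · refine tendsto_of_tendsto_of_tendsto_of_le_of_le' tendsto_const_nhds (h := fun β =>
      ENNReal.ofReal (Real.exp (-(β * δ)))) ?_ (Eventually.of_forall fun _ => zero_le) h
    rw [← ENNReal.ofReal_zero]
    refine ENNReal.tendsto_ofReal (Real.tendsto_exp_atBot.comp ?_)
    exact tendsto_neg_atTop_atBot.comp (tendsto_id.atTop_mul_const hδ)
  · refine (limsup_le_of_le (h := ?_)).trans_lt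
      (show ((-δ : ℝ) : EReal) < 0 by exact_mod_cast neg_lt_zero.2 hδ)
    filter_upwards [h, eventually_gt_atTop 0] with β hβ h0 using log_div_le h0 hβ

lemma superExponentiallySmall_of_le {q : ℝ → ℝ≥0∞}
    (h : ∀ B : ℝ, ∀ᶠ β in atTop, q β ≤ ENNReal.ofReal (Real.exp (-(β * B)))) :
    Tendsto q atTop (𝓝 0) ∧ SuperExponentiallySmall q := by
  refine ⟨(exponentiallySmall_of_le one_pos (h 1)).1, ?_⟩
  unfold SuperExponentiallySmall
  rw [EReal.tendsto_nhds_bot_iff_real]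
  intro x
  filter_upwards [h (-x + 1), eventually_gt_atTop 0] with β hβ h0
  refine (log_div_le h0 hβ).trans_lt ?_
  exact_mod_cast (by linarith : -(-x + 1) < x)

lemma card_cubicBox_le (d : ℕ) {ℓ : ℝ} (hℓ : 1 ≤ ℓ) :
    ((cubicBox d ℓ).card : ℝ) ≤ (2 * ℓ) ^ d := by
  rw [cubicBox, Fintype.card_piFinset, Finset.prod_const, Finset.card_univ, Fintype.card_fin]
  push_cast
  refine pow_le_pow_left₀ (Nat.cast_nonneg _) ?_ d
  rw [Int.card_Icc, Int.ceil_neg]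
  have h0 : 0 ≤ ⌊ℓ / 2⌋ := Int.floor_nonneg.2 (by linarith)
  have h1 : ((⌊ℓ / 2⌋ + 1 - -⌊ℓ / 2⌋).toNat : ℤ) = 2 * ⌊ℓ / 2⌋ + 1 := by omega
  have h2 : ((⌊ℓ / 2⌋ + 1 - -⌊ℓ / 2⌋).toNat : ℝ) = 2 * ⌊ℓ / 2⌋ + 1 := by exact_mod_cast h1
  have h3 := Int.floor_le (ℓ / 2)
  rw [h2]
  linarith

section Slow

variable {Ω : Type*} [MeasurableSpace Ω] {P : Measure Ω} [IsProbabilityMeasure P] {d : ℕ}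
  {W U : Site d → ℕ → Ω → ℝ} {c : ℝ → ℕ → ℝ} {Γ : ℕ → ℝ}

lemma exists_history {w u : Site d → ℕ → ℝ} (hw : RegularTimes w) {c : ℕ → ℝ}
    (hc : ∀ m n, m ≤ n → n ≤ 2 * d → c m ≤ c n) (Λ : Finset (Site d)) (t : ℝ) :
    ∃ T, IsHistory (fun m => HasMark w u (c m)) (bdry ∅ 0) 0 t (occupiedSites Λ c w u t) T := by
  obtain ⟨T, hT⟩ := exists_times_occupiedSites Λ c w u t
  refine ⟨T, fun x hx => ⟨?_, (hT x hx).2.1, fun m hm hle => ?_⟩⟩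
  · obtain ⟨i, hi, hiT, -⟩ := (hT x hx).2.2
    exact hiT ▸ hw.arrivalTime_pos x hi
  · obtain ⟨i, hi, hiT, hu⟩ := (hT x hx).2.2
    exact ⟨i, hi, hiT, hu.trans (hc _ _ (by omega) (by omega))⟩

lemma occupiedSites_subset {w u : Site d → ℕ → ℝ} {c : ℕ → ℝ} (Λ : Finset (Site d)) (t : ℝ) :
    occupiedSites Λ c w u t ⊆ Λ := by
  obtain ⟨T, hT⟩ := exists_times_occupiedSites Λ c w u t
  exact fun x hx => (hT x hx).1

/-- The first site to be occupied has no occupied neighbours. -/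
lemma IsHistory.exists_nucleation {w u : Site d → ℕ → ℝ} {c : ℕ → ℝ} {S : Finset (Site d)} {a b : ℝ}
    {T : Site d → ℝ} (h : IsHistory (fun m => HasMark w u (c m)) (bdry ∅ 0) a b S T)
    (hS : S.Nonempty) : ∃ x ∈ S, HasMarkIn w u (c 0) x a b := by
  obtain ⟨x, hx, hmin⟩ := S.exists_min_image T hS
  have h0 : earlier S T x = 0 := earlier_eq_zero fun y hy _ => not_lt.2 (hmin y hy)
  obtain ⟨h1, h2, h3⟩ := h x hx
  exact ⟨x, hx, T x, ⟨h1, h2⟩, h3 0 (Nat.zero_le _) (by simp [h0, bdry])⟩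

lemma measure_exists_hasMarkIn_le (hWU : IsGraphicalFamily P W U) (S : Finset (Site d)) {r a b N : ℝ}
    (hr : 0 ≤ r) (hab : a ≤ b) (hS : (S.card : ℝ) ≤ N) :
    P {ω | ∃ x ∈ S, HasMarkIn (W · · ω) (U · · ω) r x a b} ≤
      ENNReal.ofReal (N * (r * (b - a))) := by
  have hba : 0 ≤ b - a := sub_nonneg.2 hab
  refine (measure_exists_mem_le P S _ (ENNReal.ofReal (r * (b - a))) fun x _ => ?_).trans ?_
  · simpa using hWU.measure_forall_hasMarkIn_le hr hab {x}
  · rw [← ENNReal.ofReal_natCast, ← ENNReal.ofReal_mul (Nat.cast_nonneg _)]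
    exact ENNReal.ofReal_le_ofReal (mul_le_mul_of_nonneg_right hS (by positivity))

theorem slow_of_small_volume (hWU : IsGraphicalFamily P W U) (hc : RateHypothesis d c Γ)
    {L κ : ℝ} (hL : 0 < L) (hκ : κ < Γ d - d * L) :
    ∃ δ > 0, ∀ᶠ β in atTop, P {ω | (0 : Site d) ∈ sigma W U (cubicBox d (Real.exp (β * L))) (c β)
      (Real.exp (β * κ)) ω} ≤ ENNReal.ofReal (Real.exp (-(β * δ))) := by
  -- One third of the gap absorbs the error in the rate, one third the numerical constant, and one
  -- third remains.
  set δ := (Γ d - d * L - κ) / 3 with hδ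
  have hδpos : 0 < δ := by rw [hδ]; linarith
  refine ⟨δ, hδpos, ?_⟩
  filter_upwards [hc.eventually_le le_rfl hδpos, eventually_gt_atTop 0,
    eventually_const_mul_exp_le (2 ^ d) (u := -(2 * δ)) (v := -δ) (by linarith)] with β hrate hβ h2
  rw [Nat.sub_self] at hrate
  have hc0 := (hc.pos β hβ 0 (Nat.zero_le _)).le
  set Λ := cubicBox d (Real.exp (β * L)) with hΛ
  refine (measure_mono_ae (hWU.ae_regular.mono fun ω hω h0 => ?_)).trans
    ((measure_exists_hasMarkIn_le hWU Λ hc0 (Real.exp_pos (β * κ)).le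
      (card_cubicBox_le d (Real.one_le_exp (by positivity)))).trans (ENNReal.ofReal_le_ofReal ?_))
  · obtain ⟨T, hT⟩ := exists_history (u := (U · · ω)) hω (hc.mono β hβ) Λ (Real.exp (β * κ))
    obtain ⟨x, hx, hm⟩ := hT.exists_nucleation ⟨0, h0⟩
    exact ⟨x, occupiedSites_subset _ _ hx, hm⟩
  · calc _ ≤ (2 * Real.exp (β * L)) ^ d * (Real.exp (β * (-Γ d + δ)) *
          (Real.exp (β * κ) - 0)) := by
          have := (Real.exp_pos (β * κ)).le
          gcongr
      _ = 2 ^ d * Real.exp (β * -(2 * δ)) := by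
          rw [mul_pow, ← Real.exp_nat_mul, sub_zero, mul_assoc, ← Real.exp_add, ← Real.exp_add]
          congr 2
          rw [hδ]; ring
      _ ≤ _ := by simpa only [mul_neg] using h2

/-- With no walls, the cluster of the origin has extension at most `exp (β l)`, and it contains a
nucleation. As `d l + κ < Γ d`, there is likely none in the box of radius `exp (β l)` at the origin.
-/
theorem slow_of_lt_criticalConstant (hWU : IsGraphicalFamily P W U) (hc : RateHypothesis d c Γ)
    {L κ : ℝ} (hL : 0 < L) (hκ : κ < criticalConstant Γ d) :
    ∃ δ > 0, ∀ᶠ β in atTop, P {ω | (0 : Site d) ∈ sigma W U (cubicBox d (Real.exp (β * L))) (c β)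
      (Real.exp (β * κ)) ω} ≤ ENNReal.ofReal (Real.exp (-(β * δ))) := by
  obtain ⟨l, hlpos, hl, h⟩ := smallClustersLikely hWU hc le_rfl κ hκ
  set δ := (Γ d - d * l - κ) / 3 with hδ
  have hδpos : 0 < δ := by rw [hδ]; linarith
  obtain ⟨V, -, hV⟩ := h (2 * δ) (d * L + 1)
  refine ⟨δ, hδpos, ?_⟩
  filter_upwards [hc.eventually_le le_rfl hδpos, eventually_gt_atTop 0, hV,
    eventually_const_mul_exp_le (3 ^ d + 1) (u := -(2 * δ)) (v := -δ) (by linarith),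
    eventually_const_le_exp (2 ^ d) one_pos] with β hrate hβ hV h3 h2
  rw [Nat.sub_self] at hrate
  have hc0 := (hc.pos β hβ 0 (Nat.zero_le _)).le
  set Λ := cubicBox d (Real.exp (β * L)) with hΛ
  have hΛcard : (Λ.card : ℝ) ≤ Real.exp (β * (d * L + 1)) := by
    refine (card_cubicBox_le d (Real.one_le_exp (by positivity))).trans ?_
    rw [mul_pow, ← Real.exp_nat_mul]
    calc _ ≤ Real.exp (β * 1) * Real.exp (d * (β * L)) := by gcongr
      _ = _ := by rw [← Real.exp_add]; ring_nf
  set M := ⌊Real.exp (β * l)⌋ with hM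
  have hM0 : 0 ≤ M := Int.floor_nonneg.2 (Real.exp_pos _).le
  have hMle : (M : ℝ) ≤ Real.exp (β * l) := Int.floor_le _
  have hel : 1 ≤ Real.exp (β * l) := Real.one_le_exp (by positivity)
  have hsmall := hV ∅ 0 0 (Real.exp (β * κ)) Λ (by simp) (Real.exp_pos _).le (by simp) hΛcard
  have hbox : ((boxAround (fun _ => M) (0 : Site d)).card : ℝ) ≤ (3 * Real.exp (β * l)) ^ d := by
    rw [card_boxAround (fun _ => hM0), Finset.prod_const, Finset.card_univ, Fintype.card_fin]
    have : (0 : ℝ) ≤ M := by exact_mod_cast hM0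
    gcongr
    linarith
  have hnuc := measure_exists_hasMarkIn_le hWU (boxAround (fun _ => M) (0 : Site d)) hc0
    (Real.exp_pos (β * κ)).le hbox
  refine (measure_mono_ae (t := {ω | ¬ SmallClusters (fun m => HasMark (W · · ω) (U · · ω) (c β m))
    Λ ∅ 0 0 (Real.exp (β * κ)) M V} ∪ {ω | ∃ x ∈ boxAround (fun _ => M) (0 : Site d),
      HasMarkIn (W · · ω) (U · · ω) (c β 0) x 0 (Real.exp (β * κ))})
    (hWU.ae_regular.mono fun ω hω h0 => ?_)).trans
    ((measure_union_le _ _).trans ((add_le_add hsmall hnuc).trans ?_))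
  · by_cases hs : SmallClusters (fun m => HasMark (W · · ω) (U · · ω) (c β m))
      Λ ∅ 0 0 (Real.exp (β * κ)) M V
    · refine Or.inr ?_
      obtain ⟨T, hT⟩ := exists_history (u := (U · · ω)) hω (hc.mono β hβ) Λ (Real.exp (β * κ))
      have h0C := self_mem_latticeComp (S := occupiedSites Λ (c β) (W · · ω) (U · · ω)
        (Real.exp (β * κ))) h0
      have hC := hT.comp 0
      obtain ⟨x, hx, hm⟩ := hC.exists_nucleation ⟨0, h0C⟩
      refine ⟨x, mem_boxAround.2 fun j => ?_, hm⟩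
      simpa using hs _ (latticeComp_subset.trans (occupiedSites_subset _ _)) T
        latticeConn_latticeComp hC x hx 0 h0C j
    · exact Or.inl hs
  · rw [← ENNReal.ofReal_add (Real.exp_pos _).le (by rw [sub_zero]; positivity)]
    refine ENNReal.ofReal_le_ofReal ?_
    calc _ ≤ Real.exp (-(β * (2 * δ))) + (3 * Real.exp (β * l)) ^ d *
          (Real.exp (β * (-Γ d + δ)) * (Real.exp (β * κ) - 0)) := by
          have := (Real.exp_pos (β * κ)).le
          gcongr
      _ = (3 ^ d + 1) * Real.exp (β * -(2 * δ)) := by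
          rw [mul_pow, ← Real.exp_nat_mul, sub_zero, mul_assoc, ← Real.exp_add, ← Real.exp_add,
            add_comm, add_mul, one_mul, mul_neg]
          congr 3
          rw [hδ]; ring
      _ ≤ _ := by simpa only [mul_neg] using h3

end Slow

/-! ### Filling boxes -/

section Filling

variable {d : ℕ}

/-- In every direction outside of `I`, the site `x` has a neighbour in `S`. -/
def Supported (S : Set (Site d)) (x : Site d) (I : Finset (Fin d)) : Prop :=
  ∀ l ∉ I, ∃ y ∈ S, |x l - y l| = 1 ∧ ∀ i ≠ l, y i = x i

lemma Supported.mono {S S' : Set (Site d)} {x : Site d} {I : Finset (Fin d)}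
    (h : Supported S x I) (hS : S ⊆ S') : Supported S' x I := fun l hl =>
  let ⟨y, hy, h'⟩ := h l hl
  ⟨y, hS hy, h'⟩

/-- The increasing set-valued function `σ` includes the sites `x` of `R` which are supported in
`n` directions and have a mark of rank `n`, where `N n x s t` is the event that `x` has a mark of
rank `n` in the window `(s, t]`. -/
structure GrowsOn (N : ℕ → Site d → ℝ → ℝ → Prop) (R : Set (Site d)) (σ : ℝ → Set (Site d)) :
    Prop where
  mono : Monotone σ
  grow : ∀ x ∈ R, ∀ (I : Finset (Fin d)) (s t : ℝ), Supported (σ s) x I → N Iᶜ.card x s t → x ∈ σ t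

lemma GrowsOn.subset {N : ℕ → Site d → ℝ → ℝ → Prop} {R R' : Set (Site d)} {σ : ℝ → Set (Site d)}
    (h : GrowsOn N R σ) (hR : R' ⊆ R) : GrowsOn N R' σ :=
  ⟨h.mono, fun x hx => h.grow x (hR hx)⟩

/-- A box all of whose sites are supported at time `s` in the directions outside of `I` is
entirely occupied at time `t`. -/
def Fills (N : ℕ → Site d → ℝ → ℝ → Prop) (I : Finset (Fin d)) (a b : Site d) (s t : ℝ) : Prop :=
  ∀ σ, GrowsOn N (Set.Icc a b) σ → (∀ x ∈ Set.Icc a b, Supported (σ s) x I) → Set.Icc a b ⊆ σ t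

/-- The lower corner of the intersection of the box `[a, b]` with the box of radii `r` at `z`. -/
def lowCorner (a z r : Site d) : Site d := fun l => max (a l) (z l - r l)

/-- The upper corner of the intersection of the box `[a, b]` with the box of radii `r` at `z`. -/
def highCorner (b z r : Site d) : Site d := fun l => min (b l) (z l + r l)

variable {N : ℕ → Site d → ℝ → ℝ → Prop} {I : Finset (Fin d)} {a b z r : Site d} {s t : ℝ}
  {σ : ℝ → Set (Site d)}

lemma mem_corners {x : Site d} : x ∈ Set.Icc (lowCorner a z r) (highCorner b z r) ↔
    ∀ l, a l ≤ x l ∧ x l ≤ b l ∧ |x l - z l| ≤ r l := by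
  simp only [Set.mem_Icc, Pi.le_def, lowCorner, highCorner, ← forall_and, max_le_iff, le_min_iff,
    abs_le]
  refine forall_congr' fun l => ?_
  constructor <;> intro h <;> omega

lemma mem_layer {x : Site d} {j : Fin d} {v : ℤ} :
    x ∈ Set.Icc (Function.update (lowCorner a z r) j v) (Function.update (highCorner b z r) j v) ↔
      x j = v ∧ ∀ l ≠ j, a l ≤ x l ∧ x l ≤ b l ∧ |x l - z l| ≤ r l := by
  simp only [Set.mem_Icc, Pi.le_def, ← forall_and]
  constructor
  · intro h
    refine ⟨?_, fun l hl => ?_⟩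
    · have := h j
      simp only [Function.update_self] at this
      omega
    · have := h l
      simp only [Function.update_of_ne hl, lowCorner, highCorner, max_le_iff, le_min_iff] at this
      rw [abs_le]
      omega
  · rintro ⟨rfl, h⟩ l
    rcases eq_or_ne l j with rfl | hl
    · simp
    · have := h l hl
      simp only [Function.update_of_ne hl, lowCorner, highCorner, max_le_iff, le_min_iff]
      rw [abs_le] at this
      omega

lemma layer_subset {j : Fin d} {v : ℤ} (hav : a j ≤ v) (hvb : v ≤ b j) :
    Set.Icc (Function.update (lowCorner a z r) j v) (Function.update (highCorner b z r) j v) ⊆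
      Set.Icc a b := by
  intro x hx
  rw [mem_layer] at hx
  refine ⟨fun l => ?_, fun l => ?_⟩ <;> rcases eq_or_ne l j with rfl | hl
  · exact hx.1 ▸ hav
  · exact (hx.2 l hl).1
  · exact hx.1 ▸ hvb
  · exact (hx.2 l hl).2.1

/-- The new faces orthogonal to `j` rest on the box already occupied, so `j` joins the supported
directions and the faces fill as boxes with free directions `I.erase j`. -/
lemma GrowsOn.extend (hσ : GrowsOn N (Set.Icc a b) σ) (hst : s ≤ t)
    (hsupp : ∀ x ∈ Set.Icc a b, Supported (σ s) x I) (hz : z ∈ Set.Icc a b) {j : Fin d}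
    (hr : 0 ≤ r j) (hbox : Set.Icc (lowCorner a z r) (highCorner b z r) ⊆ σ s)
    (hfill : ∀ v, a j ≤ v → v ≤ b j → |v - z j| = r j + 1 → Fills N (I.erase j)
      (Function.update (lowCorner a z r) j v) (Function.update (highCorner b z r) j v) s t) :
    Set.Icc (lowCorner a z (Function.update r j (r j + 1)))
      (highCorner b z (Function.update r j (r j + 1))) ⊆ σ t := by
  intro x hx
  rw [mem_corners] at hx
  have hxj := hx j
  simp only [Function.update_self] at hxj
  have hxl : ∀ l ≠ j, a l ≤ x l ∧ x l ≤ b l ∧ |x l - z l| ≤ r l := fun l hl => by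
    simpa only [Function.update_of_ne hl] using hx l
  by_cases hj : |x j - z j| ≤ r j
  · refine hσ.mono hst (hbox (mem_corners.2 fun l => ?_))
    rcases eq_or_ne l j with rfl | hl
    · exact ⟨hxj.1, hxj.2.1, hj⟩
    · exact hxl l hl
  have hv : |x j - z j| = r j + 1 := by omega
  refine hfill (x j) hxj.1 hxj.2.1 hv σ (hσ.subset (layer_subset hxj.1 hxj.2.1))
    (fun y hy l hl => ?_) (mem_layer.2 ⟨rfl, hxl⟩)
  have hyab := layer_subset hxj.1 hxj.2.1 hy
  by_cases hlI : l ∈ I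
  swap
  · exact hsupp y hyab l hlI
  have hlj : l = j := by
    by_contra h
    exact hl (Finset.mem_erase.2 ⟨h, hlI⟩)
  subst hlj
  rw [mem_layer] at hy
  have hzl : a l ≤ z l := hz.1 l
  have hzl' : z l ≤ b l := hz.2 l
  obtain ⟨q, hq1, hq2, hq3, hq4⟩ : ∃ q : ℤ, |y l - q| = 1 ∧ a l ≤ q ∧ q ≤ b l ∧
      |q - z l| ≤ r l := by
    rw [hy.1]
    rcases le_total (z l) (x l) with h | h
    · rw [abs_of_nonneg (by omega)] at hv
      exact ⟨x l - 1, by simp, by omega, by omega, by rw [abs_le]; omega⟩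
    · rw [abs_of_nonpos (by omega)] at hv
      exact ⟨x l + 1, by simp, by omega, by omega, by rw [abs_le]; omega⟩
  refine ⟨Function.update y l q, hbox (mem_corners.2 fun i => ?_), by simpa using hq1,
    fun i hi => by simp [hi]⟩
  rcases eq_or_ne i l with rfl | hi
  · simpa using ⟨hq2, hq3, hq4⟩
  · simpa only [Function.update_of_ne hi] using hy.2 i hi

open Classical in
/-- The radii of the growing box in the course of its extension from radius `k` to `k + 1`: the
directions in `J` have been treated. -/
noncomputable def radii (k : ℕ) (J : Finset (Fin d)) : Site d := fun l => if l ∈ J then k + 1 else k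

lemma le_radii (k : ℕ) (J : Finset (Fin d)) (l : Fin d) : (k : ℤ) ≤ radii k J l := by
  unfold radii
  split_ifs <;> omega

/-- The time at which `n` directions have been treated in the extension of the growing box from
radius `k` to `k + 1`, when the treatment of a direction takes the time `T k`. -/
noncomputable def growthTime (p : ℕ) (s : ℝ) (T : ℕ → ℝ) (k n : ℕ) : ℝ :=
  s + p * ∑ i ∈ Finset.range k, T i + n * T k

lemma growthTime_succ (p : ℕ) (s : ℝ) (T : ℕ → ℝ) (k n : ℕ) :
    growthTime p s T k (n + 1) = growthTime p s T k n + T k := by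
  unfold growthTime
  push_cast
  ring

lemma le_growthTime (p : ℕ) (s : ℝ) {T : ℕ → ℝ} (hT : ∀ k, 0 ≤ T k) (k n : ℕ) :
    s ≤ growthTime p s T k n := by
  have h1 : 0 ≤ (p : ℝ) * ∑ i ∈ Finset.range k, T i :=
    mul_nonneg (Nat.cast_nonneg _) (Finset.sum_nonneg fun i _ => hT i)
  have h2 : 0 ≤ (n : ℝ) * T k := mul_nonneg (Nat.cast_nonneg _) (hT k)
  unfold growthTime
  linarith

/-- Starting from the nucleus `z`, the radius increases by one after all directions of `I` have been
treated in turn. Boxes are truncated to `[a, b]`, so `z` may be anywhere in it. -/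
lemma GrowsOn.growth (hσ : GrowsOn N (Set.Icc a b) σ)
    (hsupp : ∀ x ∈ Set.Icc a b, Supported (σ s) x I) (hz : z ∈ Set.Icc a b) (hzs : z ∈ σ s)
    (hab : ∀ l ∉ I, a l = b l) {T : ℕ → ℝ} (hT : ∀ k, 0 ≤ T k) {K : ℕ}
    (hK : ∀ l ∈ I, b l - a l ≤ K)
    (hfill : ∀ k < K, ∀ J ⊆ I, ∀ j ∈ I, j ∉ J → ∀ v, a j ≤ v → v ≤ b j → |v - z j| = k + 1 →
      Fills N (I.erase j) (Function.update (lowCorner a z (radii k J)) j v)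
        (Function.update (highCorner b z (radii k J)) j v) (growthTime I.card s T k J.card)
        (growthTime I.card s T k (J.card + 1))) :
    Set.Icc a b ⊆ σ (growthTime I.card s T K 0) := by
  classical
  have hz1 : ∀ l, a l ≤ z l := hz.1
  have hz2 : ∀ l, z l ≤ b l := hz.2
  have hsle : ∀ k n, s ≤ growthTime I.card s T k n := le_growthTime I.card s hT
  have step : ∀ k < K, Set.Icc (lowCorner a z (radii k ∅)) (highCorner b z (radii k ∅)) ⊆
      σ (growthTime I.card s T k 0) → ∀ J ⊆ I,
      Set.Icc (lowCorner a z (radii k J)) (highCorner b z (radii k J)) ⊆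
        σ (growthTime I.card s T k J.card) := by
    intro k hk h0 J
    induction J using Finset.induction_on with
    | empty => exact fun _ => by simpa using h0
    | insert j J hj ih =>
      intro hJ
      have hJ' := (Finset.insert_subset_iff.1 hJ).2
      have hrj : radii k J j = k := by simp [radii, hj]
      have hr : radii k (insert j J) = Function.update (radii k J) j (radii k J j + 1) := by
        ext l
        rcases eq_or_ne l j with rfl | hl
        · simp [radii, hj]
        · simp [radii, hl]
      rw [hr, Finset.card_insert_of_notMem hj]
      refine hσ.extend (s := growthTime I.card s T k J.card) (I := I) ?_
        (fun x hx => (hsupp x hx).mono (hσ.mono (hsle _ _))) hz (by rw [hrj]; positivity)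
        (ih hJ') ?_
      · rw [growthTime_succ]
        linarith [hT k]
      · intro v hv1 hv2 hv3
        exact hfill k hk J hJ' j (hJ (Finset.mem_insert_self _ _)) hj v hv1 hv2 (hrj ▸ hv3)
  have main : ∀ k ≤ K, Set.Icc (lowCorner a z (radii k ∅)) (highCorner b z (radii k ∅)) ⊆
      σ (growthTime I.card s T k 0) := by
    intro k
    induction k with
    | zero =>
      intro _ x hx
      have : x = z := by
        ext l
        have := (mem_corners.1 hx l).2.2
        simp only [radii, Finset.notMem_empty, if_false, Nat.cast_zero, abs_nonpos_iff] at this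
        omega
      exact this ▸ hσ.mono (hsle _ _) hzs
    | succ k ih =>
      intro hk x hx
      have e : growthTime I.card s T (k + 1) 0 = growthTime I.card s T k I.card := by
        simp only [growthTime, Finset.sum_range_succ]
        push_cast
        ring
      rw [e]
      refine step k (by omega) (ih (by omega)) I subset_rfl (mem_corners.2 fun l => ?_)
      have hx := mem_corners.1 hx l
      refine ⟨hx.1, hx.2.1, ?_⟩
      by_cases hl : l ∈ I
      · simpa [radii, hl] using hx.2.2
      · have h1 := hab l hl
        have h2 := hz1 l
        have h3 := hz2 l
        have h4 : x l = z l := by omega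
        simp [radii, hl, h4]
  intro x hx
  refine main K le_rfl (mem_corners.2 fun l => ?_)
  have h1 : a l ≤ x l := hx.1 l
  have h2 : x l ≤ b l := hx.2 l
  have h3 := hz1 l
  have h4 := hz2 l
  refine ⟨h1, h2, ?_⟩
  simp only [radii, Finset.notMem_empty, if_false]
  rw [abs_le]
  by_cases hl : l ∈ I
  · have := hK l hl
    omega
  · have := hab l hl
    omega

lemma fills_of_nucleation {s₀ t : ℝ} (hab : ∀ l ∉ I, a l = b l) {T : ℕ → ℝ} (hT : ∀ k, 0 ≤ T k)
    {K : ℕ} (hK : ∀ l ∈ I, b l - a l ≤ K) (hs : s ≤ s₀) (ht : growthTime I.card s₀ T K 0 ≤ t)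
    (hnuc : ∃ x ∈ Set.Icc a b, N Iᶜ.card x s s₀)
    (hfill : ∀ z ∈ Set.Icc a b, ∀ k < K, ∀ J ⊆ I, ∀ j ∈ I, j ∉ J → ∀ v, a j ≤ v → v ≤ b j →
      |v - z j| = k + 1 →
      Fills N (I.erase j) (Function.update (lowCorner a z (radii k J)) j v)
        (Function.update (highCorner b z (radii k J)) j v) (growthTime I.card s₀ T k J.card)
        (growthTime I.card s₀ T k (J.card + 1))) : Fills N I a b s t := by
  intro σ hσ hsupp
  obtain ⟨z, hz, hzN⟩ := hnuc
  exact (hσ.growth (fun x hx => (hsupp x hx).mono (hσ.mono hs)) hz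
    (hσ.grow z hz I s s₀ (hsupp z hz) hzN) hab hT hK (hfill z hz)).trans (hσ.mono ht)

open Classical in
/-- The lower corner of a cube of side `m` in the directions of `I`, inside the box `[a, b]`,
which contains `y`. -/
noncomputable def cubeLow (I : Finset (Fin d)) (b : Site d) (m : ℕ) (y : Site d) : Site d :=
  fun l => if l ∈ I then min (y l) (b l - m + 1) else y l

open Classical in
/-- The upper corner of a cube of side `m` in the directions of `I`, inside the box `[a, b]`,
which contains `y`. -/
noncomputable def cubeHigh (I : Finset (Fin d)) (b : Site d) (m : ℕ) (y : Site d) : Site d :=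
  fun l => if l ∈ I then min (y l) (b l - m + 1) + m - 1 else y l

lemma cube_subset {m : ℕ} {y : Site d} (hm : ∀ l ∈ I, (m : ℤ) ≤ b l - a l + 1)
    (hy : y ∈ Set.Icc a b) : Set.Icc (cubeLow I b m y) (cubeHigh I b m y) ⊆ Set.Icc a b := by
  intro x hx
  have h : ∀ l, cubeLow I b m y l ≤ x l ∧ x l ≤ cubeHigh I b m y l ∧ a l ≤ y l ∧ y l ≤ b l :=
    fun l => ⟨hx.1 l, hx.2 l, hy.1 l, hy.2 l⟩
  refine ⟨fun l => ?_, fun l => ?_⟩ <;> have h := h l <;> by_cases hl : l ∈ I <;>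
    simp only [cubeLow, cubeHigh, hl, if_true, if_false] at h
  · have := hm l hl
    show a l ≤ x l
    omega
  all_goals
    first
    | show a l ≤ x l
      omega
    | show x l ≤ b l
      omega

lemma mem_cube {m : ℕ} {y : Site d} (hm1 : 1 ≤ m) (hy : y ∈ Set.Icc a b) :
    y ∈ Set.Icc (cubeLow I b m y) (cubeHigh I b m y) := by
  refine ⟨fun l => ?_, fun l => ?_⟩ <;> have h2 : y l ≤ b l := hy.2 l <;> by_cases hl : l ∈ I <;>
    simp only [cubeLow, cubeHigh, hl, if_true, if_false]
  all_goals omega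

/-- Large boxes are treated by covering them with cubes, so that growth from a nucleus never has to
go beyond the critical size. -/
lemma fills_of_cubes {m : ℕ} (hm1 : 1 ≤ m) (hm : ∀ l ∈ I, (m : ℤ) ≤ b l - a l + 1)
    (h : ∀ y ∈ Set.Icc a b, Fills N I (cubeLow I b m y) (cubeHigh I b m y) s t) :
    Fills N I a b s t := fun σ hσ hsupp y hy =>
  h y hy σ (hσ.subset (cube_subset hm hy)) (fun x hx => hsupp x (cube_subset hm hy hx))
    (mem_cube hm1 hy)

end Filling

/-! ### The growth model fills boxes -/

section Growth

variable {d : ℕ}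

lemma occupiedNeighbours_le (x : Site d) (η : Finset (Site d)) : occupiedNeighbours x η ≤ 2 * d := by
  classical
  have h : (η.filter fun y => Neighbours x y) ⊆ ((Finset.univ : Finset (Fin d)) ×ˢ
      ({1, -1} : Finset ℤ)).image fun p => Function.update x p.1 (x p.1 + p.2) := by
    intro y hy
    obtain ⟨j, hj, h⟩ := neighbours_iff.1 (Finset.mem_filter.1 hy).2
    refine Finset.mem_image.2 ⟨(j, y j - x j), ?_, ?_⟩
    · simp only [Finset.mem_product, Finset.mem_univ, true_and, Finset.mem_insert,
        Finset.mem_singleton]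
      rw [abs_eq one_pos.le] at hj
      omega
    · ext i
      rcases eq_or_ne i j with rfl | hi
      · simp
      · simp [hi, h i hi]
  calc occupiedNeighbours x η = (η.filter fun y => Neighbours x y).card := by
        unfold occupiedNeighbours; congr
    _ ≤ _ := (Finset.card_le_card h).trans Finset.card_image_le
    _ ≤ d * 2 := by
        rw [Finset.card_product, Finset.card_univ, Fintype.card_fin]
        exact Nat.mul_le_mul_left _ Finset.card_le_two
    _ = _ := mul_comm _ _

lemma Supported.card_le_occupiedNeighbours {x : Site d} {η η' : Finset (Site d)}
    {I : Finset (Fin d)} (h : Supported (η : Set (Site d)) x I) (hη : η ⊆ η') :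
    Iᶜ.card ≤ occupiedNeighbours x η' := by
  classical
  choose! y hy using h
  have e : occupiedNeighbours x η' = (η'.filter fun y => Neighbours x y).card := by
    unfold occupiedNeighbours; congr
  rw [e]
  refine Finset.card_le_card_of_injOn y (fun l hl => ?_) fun l hl l' hl' hll => ?_
  · have hl := hy l (by simpa using hl)
    simp only [Finset.coe_filter, Set.mem_ofPred_eq]
    exact ⟨hη (by simpa using hl.1), neighbours_iff.2 ⟨l, hl.2⟩⟩
  · by_contra hne
    have h1 := hy l (by simpa using hl)
    have h2 := hy l' (by simpa using hl')
    have h3 := h1.2.1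
    rw [hll, h2.2.2 l hne] at h3
    simp at h3

/-- This is where monotonicity of the rates enters: support in `n` directions gives at least `n`
occupied neighbours, and any further ones only help. -/
lemma growsOn_occupiedSites {w u : Site d → ℕ → ℝ} (hw : RegularTimes w) {c : ℕ → ℝ}
    (hc : ∀ m n, m ≤ n → n ≤ 2 * d → c m ≤ c n) {Λ : Finset (Site d)} {R : Set (Site d)}
    (hR : R ⊆ Λ) : GrowsOn (fun n => HasMarkIn w u (c n)) R
      (fun t => (occupiedSites Λ c w u t : Set (Site d))) where
  mono := fun _ _ hst => Finset.coe_subset.2 (occupiedSites_mono hw Λ c u hst)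
  grow := fun x hx _ _ _ hsupp hm => mem_occupiedSites_of_hasMarkIn hw (hR hx) (fun η hη =>
    hc _ _ (hsupp.card_le_occupiedNeighbours hη) (occupiedNeighbours_le x η)) hm

end Growth

/-! ### Union bounds for the filling of boxes -/

section FillingProbability

variable {Ω : Type*} [MeasurableSpace Ω] {P : Measure Ω} {d : ℕ}

lemma measure_not_fills_le_of_cubes (P : Measure Ω) {N : Ω → ℕ → Site d → ℝ → ℝ → Prop}
    {I : Finset (Fin d)} {a b : Site d} {s t : ℝ} {m : ℕ} (hm1 : 1 ≤ m)
    (hm : ∀ l ∈ I, (m : ℤ) ≤ b l - a l + 1) {q : ℝ≥0∞} (hq : ∀ y ∈ Set.Icc a b,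
      P {ω | ¬ Fills (N ω) I (cubeLow I b m y) (cubeHigh I b m y) s t} ≤ q) :
    P {ω | ¬ Fills (N ω) I a b s t} ≤ (Finset.Icc a b).card * q := by
  refine (measure_mono fun ω hω => ?_).trans (measure_exists_mem_le P (Finset.Icc a b)
    (fun y ω => ¬ Fills (N ω) I (cubeLow I b m y) (cubeHigh I b m y) s t) q
    fun y hy => hq y (Finset.mem_Icc.1 hy))
  by_contra h
  simp only [Set.mem_ofPred_eq, not_exists, not_and, not_not] at h
  exact hω (fills_of_cubes hm1 hm fun y hy => h y (Finset.mem_Icc.2 hy))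

lemma measure_not_fills_le_of_layers (P : Measure Ω) {N : Ω → ℕ → Site d → ℝ → ℝ → Prop}
    {I : Finset (Fin d)} {a b : Site d} {s s₀ t : ℝ} (hab : ∀ l ∉ I, a l = b l) {T : ℕ → ℝ}
    (hT : ∀ k, 0 ≤ T k) {K : ℕ} (hK : ∀ l ∈ I, b l - a l ≤ K) (hs : s ≤ s₀)
    (ht : growthTime I.card s₀ T K 0 ≤ t) {p q : ℝ≥0∞}
    (hp : P {ω | ∀ x ∈ Finset.Icc a b, ¬ N ω Iᶜ.card x s s₀} ≤ p)
    (hq : ∀ z ∈ Set.Icc a b, ∀ k < K, ∀ J ⊆ I, ∀ j ∈ I, j ∉ J → ∀ v, a j ≤ v → v ≤ b j →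
      P {ω | ¬ Fills (N ω) (I.erase j) (Function.update (lowCorner a z (radii k J)) j v)
        (Function.update (highCorner b z (radii k J)) j v) (growthTime I.card s₀ T k J.card)
        (growthTime I.card s₀ T k (J.card + 1))} ≤ q) :
    P {ω | ¬ Fills (N ω) I a b s t} ≤
      p + ((Finset.Icc a b).card * (K * (2 ^ d * (d * 2))) : ℕ) * q := by
  classical
  -- The faces are indexed by the nucleus, the radius, the set of directions already extended, the
  -- next direction and its sign.
  let E : Site d × ℕ × Finset (Fin d) × Fin d × ℤ → Ω → Prop := fun i ω =>
    i.2.2.1 ⊆ I ∧ i.2.2.2.1 ∈ I ∧ i.2.2.2.1 ∉ i.2.2.1 ∧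
    a i.2.2.2.1 ≤ i.1 i.2.2.2.1 + i.2.2.2.2 * (i.2.1 + 1) ∧
    i.1 i.2.2.2.1 + i.2.2.2.2 * (i.2.1 + 1) ≤ b i.2.2.2.1 ∧
    ¬ Fills (N ω) (I.erase i.2.2.2.1)
      (Function.update (lowCorner a i.1 (radii i.2.1 i.2.2.1)) i.2.2.2.1
        (i.1 i.2.2.2.1 + i.2.2.2.2 * (i.2.1 + 1)))
      (Function.update (highCorner b i.1 (radii i.2.1 i.2.2.1)) i.2.2.2.1
        (i.1 i.2.2.2.1 + i.2.2.2.2 * (i.2.1 + 1)))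
      (growthTime I.card s₀ T i.2.1 i.2.2.1.card) (growthTime I.card s₀ T i.2.1 (i.2.2.1.card + 1))
  let X := Finset.Icc a b ×ˢ Finset.range K ×ˢ (Finset.univ : Finset (Finset (Fin d))) ×ˢ
    (Finset.univ : Finset (Fin d)) ×ˢ ({1, -1} : Finset ℤ)
  have hX : X.card = (Finset.Icc a b).card * (K * (2 ^ d * (d * 2))) := by
    simp only [X, Finset.card_product, Finset.card_range, Finset.card_univ, Fintype.card_finset,
      Fintype.card_fin]
    rw [show ({1, -1} : Finset ℤ).card = 2 by decide]
  rw [← hX]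
  refine (measure_mono (t := {ω | ∀ x ∈ Finset.Icc a b, ¬ N ω Iᶜ.card x s s₀} ∪
    {ω | ∃ i ∈ X, E i ω}) fun ω hω => ?_).trans ((measure_union_le _ _).trans (add_le_add hp
      (measure_exists_mem_le P X E q fun i hi => ?_)))
  · by_contra hcon
    rw [Set.mem_union, not_or] at hcon
    simp only [Set.mem_ofPred_eq, not_exists, not_and, not_forall, not_not] at hcon
    obtain ⟨⟨x, hx, hxN⟩, h2⟩ := hcon
    refine hω (fills_of_nucleation hab hT hK hs ht ⟨x, Finset.mem_Icc.1 hx, hxN⟩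
      fun z hz k hk J hJ j hj hjJ v hv1 hv2 hv3 => ?_)
    obtain ⟨e, he, hv⟩ : ∃ e ∈ ({1, -1} : Finset ℤ), v = z j + e * (k + 1) := by
      rcases (abs_eq (by positivity)).1 hv3 with h | h
      · exact ⟨1, by simp, by omega⟩
      · exact ⟨-1, by simp, by omega⟩
    subst hv
    by_contra hF
    refine h2 (z, k, J, j, e) ?_ ⟨hJ, hj, hjJ, hv1, hv2, hF⟩
    simp only [X, Finset.mem_product, Finset.mem_range, Finset.mem_univ, true_and]
    exact ⟨Finset.mem_Icc.2 hz, hk, he⟩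
  · obtain ⟨z, k, J, j, e⟩ := i
    simp only [X, Finset.mem_product, Finset.mem_range, Finset.mem_univ, true_and] at hi
    by_cases hcond : J ⊆ I ∧ j ∈ I ∧ j ∉ J ∧ a j ≤ z j + e * (k + 1) ∧ z j + e * (k + 1) ≤ b j
    · obtain ⟨h1, h2, h3, h4, h5⟩ := hcond
      refine (measure_mono fun ω hω => ?_).trans
        (hq z (Finset.mem_Icc.1 hi.1) k hi.2.1 J h1 j h2 h3 _ h4 h5)
      exact hω.2.2.2.2.2
    · have : {ω | E (z, k, J, j, e) ω} = ∅ := by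
        refine Set.eq_empty_of_forall_notMem fun ω hω => hcond ?_
        exact ⟨hω.1, hω.2.1, hω.2.2.1, hω.2.2.2.1, hω.2.2.2.2.1⟩
      rw [this, measure_empty]
      exact zero_le

end FillingProbability

/-! ### Summation of the filling times of the faces -/

section FillingTimes

lemma eventually_linear_le_exp (A B : ℝ) {ε : ℝ} (hε : 0 < ε) :
    ∀ᶠ β : ℝ in atTop, A + β * B ≤ Real.exp (β * ε) := by
  filter_upwards [eventually_const_mul_exp_le (|A| + 2 * |B| / ε) (half_lt_self hε),
    eventually_ge_atTop 0] with β hβ h0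
  refine le_trans ?_ hβ
  have h1 : 1 ≤ Real.exp (β * (ε / 2)) := Real.one_le_exp (by positivity)
  have h2 : β * (ε / 2) ≤ Real.exp (β * (ε / 2)) := by linarith [Real.add_one_le_exp (β * (ε / 2))]
  have h3 : β * |B| = 2 * |B| / ε * (β * (ε / 2)) := by field_simp
  calc A + β * B ≤ |A| * 1 + β * |B| := by
        have := le_abs_self A
        have := mul_le_mul_of_nonneg_left (le_abs_self B) h0
        linarith
    _ ≤ |A| * Real.exp (β * (ε / 2)) + 2 * |B| / ε * Real.exp (β * (ε / 2)) := by
        rw [h3]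
        gcongr
    _ = _ := by ring

lemma sum_inv_succ_le {n : ℕ} {x : ℝ} (hx : 0 ≤ x) (hn : (n : ℝ) ≤ 2 * Real.exp x) :
    ∑ k ∈ Finset.range n, ((k : ℝ) + 1)⁻¹ ≤ 2 + x := by
  rcases Nat.eq_zero_or_pos n with rfl | hpos
  · simp only [Finset.range_zero, Finset.sum_empty]
    linarith
  have h1 := harmonic_le_one_add_log n
  have h2 : ((harmonic n : ℚ) : ℝ) = ∑ k ∈ Finset.range n, ((k : ℝ) + 1)⁻¹ := by
    simp [harmonic]
  have h3 : Real.log n ≤ Real.log (2 * Real.exp x) :=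
    Real.log_le_log (by exact_mod_cast hpos) hn
  rw [Real.log_mul two_ne_zero (Real.exp_pos x).ne', Real.log_exp] at h3
  have := Real.log_two_lt_d9
  rw [← h2]
  linarith

/-- For `i ≥ 1` the first terms are bounded by a harmonic sum, of order `β L`. For `i = 0` they do
not decay, but then coincide with the second ones, whose sum is controlled by `L + κ ≤ κ'`. -/
lemma sum_fillingTime_le {i n : ℕ} {β Γ κ κ' L : ℝ} (hβ : 0 ≤ β) (hL : 0 ≤ L)
    (hn : (n : ℝ) ≤ 2 * Real.exp (β * L)) (h0 : i = 0 → Γ = κ) (hΓ : Γ ≤ κ') (hκ : L + κ ≤ κ') :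
    ∑ k ∈ Finset.range n, (Real.exp (β * Γ) / ((k + 1 : ℕ) : ℝ) ^ i + Real.exp (β * κ)) ≤
      (4 + β * L) * Real.exp (β * κ') := by
  have h1 : n * Real.exp (β * κ) ≤ 2 * Real.exp (β * κ') := by
    calc n * Real.exp (β * κ) ≤ 2 * Real.exp (β * L) * Real.exp (β * κ) := by gcongr
      _ = 2 * Real.exp (β * (L + κ)) := by rw [mul_assoc, ← Real.exp_add]; ring_nf
      _ ≤ _ := by gcongr
  have hpos : 0 ≤ β * L * Real.exp (β * κ') := by positivity
  rw [Finset.sum_add_distrib, Finset.sum_const, Finset.card_range, nsmul_eq_mul]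
  rcases Nat.eq_zero_or_pos i with rfl | hi
  · simp only [pow_zero, div_one, Finset.sum_const, Finset.card_range, nsmul_eq_mul, h0 rfl]
    linarith
  · have h2 : ∑ k ∈ Finset.range n, Real.exp (β * Γ) / ((k + 1 : ℕ) : ℝ) ^ i ≤
        ∑ k ∈ Finset.range n, Real.exp (β * κ') * ((k : ℝ) + 1)⁻¹ := by
      refine Finset.sum_le_sum fun k _ => ?_
      rw [← div_eq_mul_inv]
      have h3 : (1 : ℝ) ≤ (k : ℝ) + 1 := by linarith [(Nat.cast_nonneg k : (0 : ℝ) ≤ k)]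
      push_cast
      gcongr
      exact le_self_pow₀ h3 (by omega)
    rw [← Finset.mul_sum] at h2
    have h4 := mul_le_mul_of_nonneg_left (sum_inv_succ_le (mul_nonneg hβ hL) hn)
      (Real.exp_pos (β * κ')).le
    linarith

end FillingTimes

/-! ### Boxes are filled with overwhelming probability -/

section LayerGeometry

variable {d : ℕ} {I : Finset (Fin d)} {a b z : Site d}

lemma layer_flat (hab : ∀ l ∉ I, a l = b l) (hz : z ∈ Set.Icc a b) (k : ℕ) (J : Finset (Fin d))
    (j : Fin d) (v : ℤ) : ∀ l ∉ I.erase j,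
    Function.update (lowCorner a z (radii k J)) j v l =
      Function.update (highCorner b z (radii k J)) j v l := by
  intro l hl
  rcases eq_or_ne l j with rfl | hlj
  · simp
  · have h1 : a l ≤ z l := hz.1 l
    have h2 : z l ≤ b l := hz.2 l
    have h3 := hab l fun h => hl (Finset.mem_erase.2 ⟨hlj, h⟩)
    have h4 := le_radii k J l
    simp only [Function.update_of_ne hlj, lowCorner, highCorner]
    omega

lemma layer_side {m k : ℕ} (hm : ∀ l ∈ I, (m : ℤ) ≤ b l - a l + 1) (hk : k < m)
    (hz : z ∈ Set.Icc a b) (J : Finset (Fin d)) (j : Fin d) (v : ℤ) : ∀ l ∈ I.erase j,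
    ((k + 1 : ℕ) : ℤ) ≤ Function.update (highCorner b z (radii k J)) j v l -
      Function.update (lowCorner a z (radii k J)) j v l + 1 := by
  intro l hl
  have hlj := Finset.ne_of_mem_erase hl
  have h1 : a l ≤ z l := hz.1 l
  have h2 : z l ≤ b l := hz.2 l
  have h3 := hm l (Finset.mem_of_mem_erase hl)
  have h4 := le_radii k J l
  simp only [Function.update_of_ne hlj, lowCorner, highCorner]
  push_cast
  omega

lemma card_cube {m : ℕ} {y : Site d} :
    (Finset.Icc (cubeLow I b m y) (cubeHigh I b m y)).card = m ^ I.card := by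
  classical
  rw [Pi.card_Icc]
  have h : ∀ l ∈ Finset.univ, (Finset.Icc (cubeLow I b m y l) (cubeHigh I b m y l)).card =
      if l ∈ I then m else 1 := fun l _ => by
    rw [Int.card_Icc]
    by_cases hl : l ∈ I <;> simp only [cubeLow, cubeHigh, hl, if_true, if_false] <;> omega
  rw [Finset.prod_congr rfl h, Finset.prod_ite_mem, Finset.univ_inter, Finset.prod_const]

end LayerGeometry

/-! ### Induction on the dimension of the box -/

section BoxesFill

variable {Ω : Type*} [MeasurableSpace Ω] {P : Measure Ω} [IsProbabilityMeasure P] {d : ℕ}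
  {W U : Site d → ℕ → Ω → ℝ} {c : ℝ → ℕ → ℝ} {Γ : ℕ → ℝ}

/-- Guarantees enough expected nucleations in a cube of side `min m ⌈exp (β L)⌉`: the first term of
the filling time suffices when the side is `m`, the second when it is the critical length. -/
lemma exp_le_volume_mul {i m : ℕ} (hm : 1 ≤ m) {β L Γ κ : ℝ}
    (hL : ((i : ℝ) + 1) * L = Γ - κ) : Real.exp (β * Γ) ≤
      ((min m ⌈Real.exp (β * L)⌉₊ : ℕ) : ℝ) ^ (i + 1) *
        (Real.exp (β * Γ) / (m : ℝ) ^ (i + 1) + Real.exp (β * κ)) := by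
  have hmpos : (0 : ℝ) < (m : ℝ) := by exact_mod_cast hm
  rcases min_choice m ⌈Real.exp (β * L)⌉₊ with h | h
  · rw [h, mul_add, mul_div_cancel₀ _ (by positivity)]
    have : 0 ≤ (m : ℝ) ^ (i + 1) * Real.exp (β * κ) := by positivity
    linarith
  · rw [h]
    calc Real.exp (β * Γ) = Real.exp (β * L) ^ (i + 1) * Real.exp (β * κ) := by
          rw [← Real.exp_nat_mul, ← Real.exp_add]
          congr 1
          push_cast
          linear_combination (-β) * hL
      _ ≤ (⌈Real.exp (β * L)⌉₊ : ℝ) ^ (i + 1) * Real.exp (β * κ) := by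
          gcongr
          exact Nat.le_ceil _
      _ ≤ _ := by
          gcongr
          have : 0 ≤ Real.exp (β * Γ) / (m : ℝ) ^ (i + 1) := by positivity
          linarith

/-- The growth may use half of the available time, the other half being reserved for nucleation. The
factor linear in `β` is absorbed by `exp (β (ε / 2))`. -/
lemma sum_fillingTime_le_half {i m n : ℕ} {β ε Γ Γ' κ κ' L : ℝ} (hβ : 0 ≤ β) (hL : 0 ≤ L)
    (hn : (n : ℝ) ≤ 2 * Real.exp (β * L)) (h0 : i = 0 → Γ = κ) (hΓ : Γ ≤ κ') (hκ : L + κ ≤ κ')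
    (hε : 2 * ((i : ℝ) + 1) * 4 + β * (2 * (i + 1) * L) ≤ Real.exp (β * (ε / 2))) :
    ((i : ℝ) + 1) * ∑ k ∈ Finset.range n, Real.exp (β * (ε / 2)) *
      (Real.exp (β * Γ) / ((k + 1 : ℕ) : ℝ) ^ i + Real.exp (β * κ)) ≤
      Real.exp (β * ε) * (Real.exp (β * Γ') / (m : ℝ) ^ (i + 1) + Real.exp (β * κ')) / 2 := by
  have h1 := sum_fillingTime_le hβ hL hn h0 hΓ hκ
  rw [← Finset.mul_sum]
  calc _ ≤ ((i : ℝ) + 1) * (Real.exp (β * (ε / 2)) * ((4 + β * L) * Real.exp (β * κ'))) := by gcongr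
    _ = (2 * (i + 1) * 4 + β * (2 * (i + 1) * L)) *
        (Real.exp (β * (ε / 2)) * Real.exp (β * κ')) / 2 := by ring
    _ ≤ Real.exp (β * (ε / 2)) * (Real.exp (β * (ε / 2)) * Real.exp (β * κ')) / 2 := by gcongr
    _ = Real.exp (β * ε) * (0 + Real.exp (β * κ')) / 2 := by
        rw [← mul_assoc, ← Real.exp_add]; ring_nf
    _ ≤ _ := by gcongr; positivity

/-- The boxes of dimension `i` and of sides at least `m`, which are supported in the other
directions, are filled after a time slightly larger than `exp (β Γ_i) / m ^ i + exp (β κ_i)`, up to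
a super-exponentially small probability. -/
def BoxesFill (P : Measure Ω) (W U : Site d → ℕ → Ω → ℝ) (c : ℝ → ℕ → ℝ) (Γ : ℕ → ℝ) (i : ℕ) :
    Prop :=
  ∀ ε > 0, ∀ B C : ℝ, ∀ᶠ β in atTop, ∀ (I : Finset (Fin d)) (a b : Site d) (m : ℕ) (s t : ℝ),
    I.card = i → 1 ≤ m → (∀ l ∉ I, a l = b l) → (∀ l ∈ I, (m : ℤ) ≤ b l - a l + 1) →
    ((Finset.Icc a b).card : ℝ) ≤ Real.exp (β * C) → 0 ≤ s →
    s + Real.exp (β * ε) * (Real.exp (β * Γ i) / (m : ℝ) ^ i +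
      Real.exp (β * criticalConstant Γ i)) ≤ t →
    P {ω | ¬ Fills (fun n => HasMarkIn (W · · ω) (U · · ω) (c β n)) I a b s t} ≤
      ENNReal.ofReal (Real.exp (-(β * B)))

lemma measure_no_nucleation_le (hWU : IsGraphicalFamily P W U) (S : Finset (Site d))
    {r q s s₀ A : ℝ} (hq : 0 ≤ q) (hqr : q ≤ r) (hq1 : q ≤ 1) (hs : 0 ≤ s) (hss : s ≤ s₀)
    (hA : A ≤ S.card * (q * (s₀ - s))) :
    P {ω | ∀ x ∈ S, ¬ HasMarkIn (W · · ω) (U · · ω) r x s s₀} ≤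
      ENNReal.ofReal (Real.exp (-A)) :=
  (hWU.measure_forall_not_hasMarkIn_le hq hqr hq1 hs hss S).trans
    (ENNReal.ofReal_le_ofReal (Real.exp_le_exp.2 (neg_le_neg hA)))

lemma boxesFill_zero (hWU : IsGraphicalFamily P W U) (hc : RateHypothesis d c Γ) :
    BoxesFill P W U c Γ 0 := by
  intro ε hε B C
  filter_upwards [hc.eventually_ge (Nat.zero_le d) (half_pos hε), eventually_ge_atTop 0,
    eventually_linear_le_exp 0 B (half_pos hε)] with β hrate hβ hB I a b m s t hI hm hab _ _ hs ht
  rw [Finset.card_eq_zero] at hI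
  subst hI
  obtain rfl : a = b := funext fun l => hab l (Finset.notMem_empty l)
  rw [pow_zero, div_one] at ht
  have hst : Real.exp (β * ε) * Real.exp (β * Γ 0) ≤ t - s := by
    have := mul_pos (Real.exp_pos (β * ε)) (Real.exp_pos (β * criticalConstant Γ 0))
    linarith
  have hst' : s ≤ t := by
    have := mul_pos (Real.exp_pos (β * ε)) (Real.exp_pos (β * Γ 0))
    linarith
  have hnuc := measure_no_nucleation_le hWU (Finset.Icc a a) (A := β * B) (Real.exp_pos _).le hrate
    (by
      rw [Real.exp_le_one_iff, hc.energy_zero]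
      nlinarith) hs hst' (by
      rw [Finset.Icc_self, Finset.card_singleton, Nat.cast_one, one_mul]
      calc β * B ≤ Real.exp (β * (ε / 2)) := by linarith
        _ = Real.exp (β * (-Γ 0 - ε / 2)) * (Real.exp (β * ε) * Real.exp (β * Γ 0)) := by
            rw [← Real.exp_add, ← Real.exp_add]; ring_nf
        _ ≤ _ := by gcongr)
  refine (measure_not_fills_le_of_layers P (I := ∅) (T := 0) (K := 0) (q := 0) hab
    (fun _ => le_rfl) (by simp) hst' (by simp [growthTime]) (p := _) ?_ (by simp)).trans_eq
    (by rw [mul_zero, add_zero])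
  rw [Finset.compl_empty, Finset.card_univ, Fintype.card_fin]
  exact hnuc

lemma boxesFill_succ (hWU : IsGraphicalFamily P W U) (hc : RateHypothesis d c Γ) {i : ℕ}
    (hi : i + 1 ≤ d) (ih : BoxesFill P W U c Γ i) : BoxesFill P W U c Γ (i + 1) := by
  intro ε hε B C
  set κ := criticalConstant Γ i with hκ
  set κ' := criticalConstant Γ (i + 1) with hκ'
  -- The exponent of the critical length: a cube of side `exp (β L)` in `i + 1` dimensions nucleates
  -- in time about `exp (β κ')`. By the recursion for `κ'`, growing across it at the speed `exp (-β
  -- κ)` takes no longer.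
  set L := (Γ (i + 1) - κ') / ((i : ℝ) + 1) with hL
  have hi0 : (0 : ℝ) < (i : ℝ) + 1 := by positivity
  have hL0 : 0 ≤ L := div_nonneg (sub_nonneg.2 (hc.criticalConstant_le hi)) hi0.le
  have hLmul : ((i : ℝ) + 1) * L = Γ (i + 1) - κ' := by rw [hL]; field_simp
  have hΓκ : Γ i ≤ κ' := by rw [hκ', criticalConstant]; exact le_max_left _ _
  have hLκ : L + κ ≤ κ' := by
    have h1 : (Γ (i + 1) + ((i + 1 : ℕ) : ℝ) * κ) / (((i + 1 : ℕ) : ℝ) + 1) ≤ κ' := by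
      rw [hκ', criticalConstant]; exact le_max_right _ _
    rw [div_le_iff₀ (by positivity)] at h1
    push_cast at h1
    have : ((i : ℝ) + 1) * (L + κ) ≤ (i + 1) * κ' := by linarith
    exact le_of_mul_le_mul_left this hi0
  have h0κ : i = 0 → Γ i = κ := by rintro rfl; rfl
  -- The bound on the faces must beat their number, at most `exp (β (C + L + 1))`; this leaves `B +
  -- C + 1`. A further `C` pays for the cubes and the last `1` for a factor two.
  filter_upwards [hc.eventually_ge hi (show 0 < ε / 4 by positivity), eventually_ge_atTop 0,
    ih (ε / 2) (half_pos hε) (B + 2 * C + L + 2) C,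
    eventually_linear_le_exp 0 (B + C + 1) (half_pos hε),
    eventually_const_mul_exp_le 2 (show ε / 2 < 3 * ε / 4 by linarith),
    eventually_linear_le_exp (2 * (i + 1) * 4) (2 * (i + 1) * L) (half_pos hε),
    eventually_const_le_exp (2 * (2 ^ d * (d * 2))) one_pos,
    eventually_const_le_exp 2 one_pos] with β hrate hβ hlayers hnucB hnuc2 htime hcount htwo
    I a b m s t hI hm hab hside hcard hs ht
  set m₀ := min m ⌈Real.exp (β * L)⌉₊ with hm₀
  have hL1 : 1 ≤ Real.exp (β * L) := Real.one_le_exp (by positivity)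
  have hm₀1 : 1 ≤ m₀ := le_min hm (Nat.one_le_ceil_iff.2 (Real.exp_pos _))
  have hm₀le : (m₀ : ℝ) ≤ 2 * Real.exp (β * L) := by
    have h1 : (m₀ : ℝ) ≤ ⌈Real.exp (β * L)⌉₊ := by exact_mod_cast min_le_right _ _
    have h2 := Nat.ceil_lt_add_one (Real.exp_pos (β * L)).le
    linarith
  have hside₀ : ∀ l ∈ I, (m₀ : ℤ) ≤ b l - a l + 1 := fun l hl =>
    le_trans (by exact_mod_cast min_le_left _ _) (hside l hl)
  have hnum := exp_le_volume_mul (m := m) (β := β) hm hLmul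
  set τ := Real.exp (β * ε) * (Real.exp (β * Γ (i + 1)) / (m : ℝ) ^ (i + 1) + Real.exp (β * κ'))
    with hτ
  have hτ0 : 0 < τ := by positivity
  set s₀ := s + τ / 2 with hs₀
  set T : ℕ → ℝ := fun k => Real.exp (β * (ε / 2)) *
    (Real.exp (β * Γ i) / ((k + 1 : ℕ) : ℝ) ^ i + Real.exp (β * κ)) with hT
  have hT0 : ∀ k, 0 ≤ T k := fun k => by positivity
  have hss : s ≤ s₀ := by linarith
  have hgrowth : growthTime I.card s₀ T m₀ 0 ≤ t := by
    have h2 := sum_fillingTime_le_half hβ hL0 hm₀le h0κ hΓκ hLκ htime (m := m) (Γ' := Γ (i + 1))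
    rw [growthTime, hI]
    push_cast
    linarith
  have hcube : ∀ y ∈ Set.Icc a b,
      P {ω | ¬ Fills (fun n => HasMarkIn (W · · ω) (U · · ω) (c β n)) I (cubeLow I b m₀ y)
        (cubeHigh I b m₀ y) s t} ≤ ENNReal.ofReal (2 * Real.exp (-(β * (B + C + 1)))) := by
    intro y hy
    have hsub := cube_subset hside₀ hy
    have hflat : ∀ l ∉ I, cubeLow I b m₀ y l = cubeHigh I b m₀ y l := fun l hl => by
      simp [cubeLow, cubeHigh, hl]
    have hcside : ∀ l ∈ I, cubeHigh I b m₀ y l - cubeLow I b m₀ y l + 1 = m₀ := fun l hl => by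
      simp only [cubeLow, cubeHigh, hl, if_true]
      ring
    have hcc : ((Finset.Icc (cubeLow I b m₀ y) (cubeHigh I b m₀ y)).card : ℝ) ≤
        Real.exp (β * C) := by
      refine le_trans ?_ hcard
      exact_mod_cast Finset.card_le_card fun x hx =>
        Finset.mem_Icc.2 (hsub (Finset.mem_Icc.1 hx))
    refine (measure_not_fills_le_of_layers P hflat hT0 (K := m₀)
      (fun l hl => by have := hcside l hl; omega) hss hgrowth
      (p := ENNReal.ofReal (Real.exp (-(β * (B + C + 1)))))
      (q := ENNReal.ofReal (Real.exp (-(β * (B + 2 * C + L + 2))))) ?_ ?_).trans ?_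
    · have hIc : Iᶜ.card = d - (i + 1) := by rw [Finset.card_compl, Fintype.card_fin, hI]
      rw [hIc]
      refine measure_no_nucleation_le hWU _ (Real.exp_pos _).le hrate ?_ hs hss ?_
      · rw [Real.exp_le_one_iff]
        have := hc.energy_nonneg hi
        nlinarith
      · rw [card_cube, hI]
        push_cast
        have e : s₀ - s = τ / 2 := by rw [hs₀]; ring
        rw [e, hτ]
        -- The `exp (β ε)` in the time outweighs the error `ε / 4` in the rate, so the expected
        -- number of nucleations is exponentially large and their absence super-exponentially
        -- unlikely.
        calc β * (B + C + 1) ≤ Real.exp (β * (ε / 2)) := by linarith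
          _ ≤ Real.exp (β * (3 * ε / 4)) / 2 := by linarith
          _ = Real.exp (β * (-Γ (i + 1) - ε / 4)) * (Real.exp (β * ε) / 2) *
              Real.exp (β * Γ (i + 1)) := by
              rw [show β * (3 * ε / 4) = β * (-Γ (i + 1) - ε / 4) + β * ε + β * Γ (i + 1) by ring,
                Real.exp_add, Real.exp_add]
              ring
          _ ≤ Real.exp (β * (-Γ (i + 1) - ε / 4)) * (Real.exp (β * ε) / 2) * ((m₀ : ℝ) ^ (i + 1) *
              (Real.exp (β * Γ (i + 1)) / (m : ℝ) ^ (i + 1) + Real.exp (β * κ'))) := by gcongr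
          _ = _ := by ring
    · intro z hz k hk J hJ j hj hjJ v hv1 hv2
      refine hlayers (I.erase j) _ _ (k + 1) _ _ ?_ (by omega) (layer_flat hflat hz k J j v)
        (layer_side (fun l hl => (hcside l hl).ge) hk hz J j v) ?_ ?_ ?_
      · rw [Finset.card_erase_of_mem hj, hI, Nat.add_sub_cancel]
      · refine le_trans ?_ hcc
        exact_mod_cast Finset.card_le_card fun x hx =>
          Finset.mem_Icc.2 (layer_subset hv1 hv2 (Finset.mem_Icc.1 hx))
      · exact (hs.trans hss).trans (le_growthTime _ _ hT0 _ _)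
      · rw [growthTime_succ]
    · have hcnt : (((Finset.Icc (cubeLow I b m₀ y) (cubeHigh I b m₀ y)).card *
          (m₀ * (2 ^ d * (d * 2))) : ℕ) : ℝ) ≤ Real.exp (β * (C + L + 1)) := by
        push_cast
        calc _ ≤ Real.exp (β * C) * (2 * Real.exp (β * L) * (2 ^ d * (d * 2))) := by gcongr
          _ = Real.exp (β * C) * Real.exp (β * L) * (2 * (2 ^ d * (d * 2))) := by ring
          _ ≤ Real.exp (β * C) * Real.exp (β * L) * Real.exp (β * 1) := by gcongr
          _ = _ := by rw [← Real.exp_add, ← Real.exp_add]; ring_nf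
      rw [← ENNReal.ofReal_natCast, ← ENNReal.ofReal_mul (Nat.cast_nonneg _),
        ← ENNReal.ofReal_add (by positivity) (by positivity)]
      refine ENNReal.ofReal_le_ofReal ?_
      have h1 := mul_le_mul_of_nonneg_right hcnt (Real.exp_pos (-(β * (B + 2 * C + L + 2)))).le
      have h2 : Real.exp (β * (C + L + 1)) * Real.exp (-(β * (B + 2 * C + L + 2))) =
          Real.exp (-(β * (B + C + 1))) := by rw [← Real.exp_add]; ring_nf
      linarith
  refine (measure_not_fills_le_of_cubes P hm₀1 hside₀ hcube).trans ?_
  rw [← ENNReal.ofReal_natCast, ← ENNReal.ofReal_mul (Nat.cast_nonneg _)]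
  refine ENNReal.ofReal_le_ofReal ?_
  calc _ ≤ Real.exp (β * C) * (Real.exp (β * 1) * Real.exp (-(β * (B + C + 1)))) := by gcongr
    _ = _ := by rw [← Real.exp_add, ← Real.exp_add]; ring_nf

lemma boxesFill (hWU : IsGraphicalFamily P W U) (hc : RateHypothesis d c Γ) {i : ℕ} (hi : i ≤ d) :
    BoxesFill P W U c Γ i := by
  induction i with
  | zero => exact boxesFill_zero hWU hc
  | succ i ih => exact boxesFill_succ hWU hc hi (ih (by omega))

theorem fast_of_criticalConstant_lt (hWU : IsGraphicalFamily P W U) (hc : RateHypothesis d c Γ)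
    {L κ : ℝ} (hL : 0 < L) (hκ : max (Γ d - d * L) (criticalConstant Γ d) < κ) (B : ℝ) :
    ∀ᶠ β in atTop, P {ω | ∃ x ∈ cubicBox d (Real.exp (β * L)),
      x ∉ sigma W U (cubicBox d (Real.exp (β * L))) (c β) (Real.exp (β * κ)) ω} ≤
      ENNReal.ofReal (Real.exp (-(β * B))) := by
  set ε := (κ - max (Γ d - d * L) (criticalConstant Γ d)) / 2 with hε
  have hεpos : 0 < ε := half_pos (sub_pos.2 hκ)
  have h1 : Γ d - d * L + ε ≤ κ - ε := by
    have := le_max_left (Γ d - d * L) (criticalConstant Γ d)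
    linarith
  have h2 : criticalConstant Γ d + ε ≤ κ - ε := by
    have := le_max_right (Γ d - d * L) (criticalConstant Γ d)
    linarith
  filter_upwards [boxesFill hWU hc le_rfl ε hεpos B (d * L + 1), eventually_gt_atTop 0,
    eventually_const_le_exp (2 ^ d) one_pos, eventually_const_le_exp 2 hL,
    eventually_const_mul_exp_le (2 ^ d + 1) (show κ - ε < κ by linarith)] with β hfill hβ hcard hside
    htime
  set ℓ := Real.exp (β * L) with hℓ
  set n := ⌊ℓ / 2⌋ with hn
  have hn0 : 0 ≤ n := Int.floor_nonneg.2 (by positivity)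
  have hnlt : ℓ / 2 < n + 1 := Int.lt_floor_add_one _
  have hbox : cubicBox d ℓ = Finset.Icc (fun _ => -n) (fun _ => n) := by
    ext x
    simp only [cubicBox, Fintype.mem_piFinset, Finset.mem_Icc, Pi.le_def, Int.ceil_neg, ← hn,
      forall_and]
  have hmcast : ((2 * n + 1).toNat : ℤ) = 2 * n + 1 := Int.toNat_of_nonneg (by omega)
  have hm : ℓ / 2 ≤ ((2 * n + 1).toNat : ℝ) := by
    have : ((2 * n + 1).toNat : ℝ) = 2 * n + 1 := by exact_mod_cast hmcast
    rw [this]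
    linarith
  have hℓpos : 0 < ℓ := Real.exp_pos _
  -- The whole volume is a box with all directions free, so the support condition is void.
  have key := hfill Finset.univ (fun _ => -n) (fun _ => n) (2 * n + 1).toNat 0 (Real.exp (β * κ))
    (by simp) (by omega) (by simp) (fun l _ => by rw [hmcast]; ring_nf; rfl) ?_ le_rfl ?_
  · refine (measure_mono_ae (hWU.ae_regular.mono fun ω hω h => ?_)).trans key
    obtain ⟨x, hx, hxσ⟩ := h
    intro hF
    refine hxσ (hF _ (growsOn_occupiedSites (u := (U · · ω)) hω (hc.mono β hβ)
      (Λ := cubicBox d ℓ) (by rw [hbox, Finset.coe_Icc])) (fun y _ l hl => absurd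
      (Finset.mem_univ l) hl) (Finset.mem_Icc.1 (hbox ▸ hx)))
  · rw [← hbox]
    refine (card_cubicBox_le d (Real.one_le_exp (by positivity))).trans ?_
    rw [mul_pow, ← Real.exp_nat_mul]
    calc _ ≤ Real.exp (β * 1) * Real.exp (d * (β * L)) := by gcongr
      _ = _ := by rw [← Real.exp_add]; ring_nf
  · rw [zero_add]
    calc _ ≤ Real.exp (β * ε) * (Real.exp (β * Γ d) / (ℓ / 2) ^ d +
          Real.exp (β * criticalConstant Γ d)) := by gcongr
      _ = 2 ^ d * Real.exp (β * (Γ d - d * L + ε)) +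
          Real.exp (β * (criticalConstant Γ d + ε)) := by
          have e : Real.exp (β * (Γ d - d * L + ε)) =
              Real.exp (β * ε) * Real.exp (β * Γ d) / ℓ ^ d := by
            rw [hℓ, ← Real.exp_nat_mul, ← Real.exp_add, ← Real.exp_sub]
            ring_nf
          rw [e, mul_add β, Real.exp_add, div_pow]
          field_simp
      _ ≤ 2 ^ d * Real.exp (β * (κ - ε)) + Real.exp (β * (κ - ε)) := by gcongr
      _ = (2 ^ d + 1) * Real.exp (β * (κ - ε)) := by ring
      _ ≤ _ := htime

end BoxesFill

theorem mainTheorem2 {Ω : Type*} [MeasurableSpace Ω] (P : Measure Ω) [IsProbabilityMeasure P]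
    (d : ℕ) (W U : Site d → ℕ → Ω → ℝ) (hWU : IsGraphicalFamily P W U)
    (c : ℝ → ℕ → ℝ) (Γ : ℕ → ℝ) (hc : RateHypothesis d c Γ)
    (L κ : ℝ) (hL : 0 < L) (hκ : 0 < κ)
    (Λ : ℝ → Finset (Site d)) (hΛ : ∀ β, Λ β = cubicBox d (Real.exp (β * L)))
    (τ : ℝ → ℝ) (hτ : ∀ β, τ β = Real.exp (β * κ)) :
    (κ < max (Γ d - d * L) (criticalConstant Γ d) →
      Tendsto (fun β => P {ω | (0 : Site d) ∈ sigma W U (Λ β) (c β) (τ β) ω}) atTop (𝓝 0) ∧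
      ExponentiallySmall (fun β => P {ω | (0 : Site d) ∈ sigma W U (Λ β) (c β) (τ β) ω})) ∧
    (max (Γ d - d * L) (criticalConstant Γ d) < κ →
      Tendsto (fun β => P {ω | ∃ x ∈ Λ β, x ∉ sigma W U (Λ β) (c β) (τ β) ω}) atTop (𝓝 0) ∧
      SuperExponentiallySmall
        (fun β => P {ω | ∃ x ∈ Λ β, x ∉ sigma W U (Λ β) (c β) (τ β) ω})) := by
  simp only [hΛ, hτ]
  refine ⟨fun h => ?_, fun h => superExponentiallySmall_of_le fun B =>
    fast_of_criticalConstant_lt hWU hc hL h B⟩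
  obtain ⟨δ, hδ, hp⟩ := (lt_max_iff.1 h).elim (slow_of_small_volume hWU hc hL)
    (slow_of_lt_criticalConstant hWU hc hL)
  exact exponentiallySmall_of_le hδ hp
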